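/- **Setting.** For even $N\ge 2$ let $H=\sum_{n=1}^{N}(\sigma_n^x\sigma_{n+1}^x+\sigma_n^y\sigma_{n+1}^y)$, $\vec\sigma_{N+1}\equiv\vec\sigma_1$, be the XX Hamiltonian on $(\mathbb C^2)^{\otimes N}$, let $|\Omega\rangle=2^{-N/2}\binom11^{\otimes N}$, and let $$S_N(t)=\langle\Omega|e^{iHt}\sigma_1^x e^{-iHt}|\Omega\rangle ,\qquad t\in\mathbb R .$$ Put $\varepsilon_p=4\cos p$, let $B_\pm$ be the set of $p\in[-\pi,\pi)$ with $e^{ipN}=\pm1$, and let $$\Phi^{(N)}_{m,n}(t)=\frac1{N^2}\sum_{p\in B_+,\,q\in B_-}\frac{(1+e^{-ip})(1+e^{iq})\,e^{i[2(mp-nq)+t(\varepsilon_p-\varepsilon_q)]}}{e^{i(p-q)}-1}.$$ Let $J_k$ be the Bessel function of the first kind of integer order $k$, and write $J_k=J_k(4t)$. For integers $m\ne n$ let $$\begin{aligned}K_{m,n}(t)={}&\frac{t}{m-n}\bigl(J_{2m}J_{2n-1}-J_{2n}J_{2m-1}\bigr)+\frac{t}{m-n}\bigl(J_{2m-1}J_{2n-2}-J_{2n-1}J_{2m-2}\bigr)\\&+\frac{it}{m-n-1/2}\bigl(J_{2m-2}J_{2n}-J_{2n-1}J_{2m-1}\bigr)-\frac{it}{m-n+1/2}\bigl(J_{2m-1}J_{2n-1}-J_{2n-2}J_{2m}\bigr),\end{aligned}$$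 and for $n\ge1$ let $$K_{n,n}(t)=-1-J_0^2+J_{2n-1}^2+2\sum_{j=0}^{2n-2}J_j^2 .$$ Finally let $A_{m,n}(t)=\delta_{m,n}+K_{m,n}(t)+K_{m,1-n}(t)$ for $m,n\ge1$, and $S(r,t)=\bigl|\det_{m,n=1,\dots,r}A_{m,n}(t)\bigr|^2$. **Claim.** For every $t\in\mathbb R$: 1. for all integers $m,n\ge1$, as $N\to\infty$ through even integers, $\Phi^{(N)}_{m,n}(t)\to(-1)^{m-n}\bigl(\delta_{m,n}+K_{m,n}(t)\bigr)$; 2. the limit $S(t)=\lim_{N\to\infty}S_N(t)$ (over even $N$) exists and is real, the limit $D(t)=\lim_{r\to\infty}\det_{m,n=1,\dots,r}A_{m,n}(t)$ exists, and $$S(t)=\lim_{r\to\infty}S(r,t)=D(t)\,\overline{D(t)},$$ a product of two infinite determinants. -/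

import Mathlib

open Filter Topology

noncomputable section

namespace SpinHelix

/-! ### The XX chain on a ring of `N` qubits

The Hilbert space `(ℂ²)^{⊗N}` is written in the computational basis: a basis vector is a
configuration `s : Fin N → Fin 2`, a state is a function of `s`, an operator is a matrix. -/

/-- The configurations of `N` qubits, indexing the computational basis. -/
abbrev Config (N : ℕ) : Type := Fin N → Fin 2

/-- The Pauli matrix `σ^x`. -/
def sigmaX : Matrix (Fin 2) (Fin 2) ℂ := !![0, 1; 1, 0]

/-- The Pauli matrix `σ^y`. -/
def sigmaY : Matrix (Fin 2) (Fin 2) ℂ := !![0, -Complex.I; Complex.I, 0]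

/-- The tensor product `A₁ ⊗ ⋯ ⊗ A_N` of one-qubit operators. -/
def tensorOp {N : ℕ} (A : Fin N → Matrix (Fin 2) (Fin 2) ℂ) :
    Matrix (Config N) (Config N) ℂ :=
  Matrix.of fun s s' => ∏ k, A k (s k) (s' k)

/-- The tensor product `v₁ ⊗ ⋯ ⊗ v_N` of one-qubit states. -/
def tensorState {N : ℕ} (v : Fin N → Fin 2 → ℂ) : Config N → ℂ :=
  fun s => ∏ k, v k (s k)

/-- The operator acting as `A` on the qubit at site `n` and as the identity elsewhere. -/
def siteOp {N : ℕ} (A : Matrix (Fin 2) (Fin 2) ℂ) (n : Fin N) :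
    Matrix (Config N) (Config N) ℂ :=
  tensorOp (Function.update (fun _ => 1) n A)

/-- The XX Hamiltonian `∑ₙ (σₙ^x σₙ₊₁^x + σₙ^y σₙ₊₁^y)` with periodic boundary conditions;
`finRotate N n` is the site following `n` on the ring. -/
def hamiltonian (N : ℕ) : Matrix (Config N) (Config N) ℂ :=
  ∑ n : Fin N, (siteOp sigmaX n * siteOp sigmaX (finRotate N n)
    + siteOp sigmaY n * siteOp sigmaY (finRotate N n))

/-- The state `Ω` with all spins polarized in the positive `x` direction. -/
def omega (N : ℕ) : Config N → ℂ :=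
  ((1 / Real.sqrt (2 ^ N) : ℝ) : ℂ) • tensorState fun _ => ![1, 1]

/-- `S_N(t) = ⟨Ω| e^{iHt} σ₁^x e^{-iHt} |Ω⟩`; the first site has index `0`. -/
def relaxationN (N : ℕ) [NeZero N] (t : ℝ) : ℂ :=
  star (omega N) ⬝ᵥ
    ((NormedSpace.exp ((Complex.I * t) • hamiltonian N) * siteOp sigmaX (0 : Fin N)
      * NormedSpace.exp (-(Complex.I * t) • hamiltonian N)).mulVec (omega N))

/-! ### The finite-size matrix -/

/-- The quasi-momenta `p ∈ [-π, π)` with `e^{ipN} = z`; the sets `B₊`, `B₋` are those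
for `z = 1`, `z = -1`. -/
def quasiMomenta (N : ℕ) (z : ℂ) : Set ℝ :=
  {p | p ∈ Set.Ico (-Real.pi) Real.pi ∧ Complex.exp (Complex.I * p * N) = z}

/-- The dispersion `ε_p = 4 cos p`. -/
def dispersion (p : ℝ) : ℝ := 4 * Real.cos p

/-- The entries `Φ^{(N)}_{m,n}(t)`. For `N ≥ 1` both sums are over sets of `N` points, and no
denominator vanishes. -/
def PhiN (N : ℕ) (m n : ℤ) (t : ℝ) : ℂ :=
  1 / (N : ℂ) ^ 2 * ∑ᶠ (p : ℝ) (_ : p ∈ quasiMomenta N 1), ∑ᶠ (q : ℝ) (_ : q ∈ quasiMomenta N (-1)),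
    (1 + Complex.exp (-(Complex.I * p))) * (1 + Complex.exp (Complex.I * q))
      * Complex.exp (Complex.I * (2 * (m * p - n * q) + t * (dispersion p - dispersion q)))
      / (Complex.exp (Complex.I * (p - q)) - 1)

/-! ### The Bessel kernel -/

/-- The Bessel function of the first kind `J_k(x)` of integer order, by Bessel's integral. -/
def besselJ (k : ℤ) (x : ℝ) : ℝ :=
  1 / (2 * Real.pi) * ∫ θ in (-Real.pi)..Real.pi, Real.cos (k * θ - x * Real.sin θ)

/-- The kernel `K_{m,n}(t)`. On the diagonal it is meant for `n ≥ 1` only, where the sum runs over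
`0 ≤ j ≤ 2n - 2`. -/
def kernelK (m n : ℤ) (t : ℝ) : ℂ :=
  let J : ℤ → ℂ := fun k => (besselJ k (4 * t) : ℂ)
  if m = n then
    -1 - J 0 ^ 2 + J (2 * n - 1) ^ 2 + 2 * ∑ j ∈ Finset.range (2 * n - 1).toNat, J j ^ 2
  else
    t / (m - n) * (J (2 * m) * J (2 * n - 1) - J (2 * n) * J (2 * m - 1))
      + t / (m - n) * (J (2 * m - 1) * J (2 * n - 2) - J (2 * n - 1) * J (2 * m - 2))
      + Complex.I * t / (m - n - 1 / 2)
        * (J (2 * m - 2) * J (2 * n) - J (2 * n - 1) * J (2 * m - 1))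
      - Complex.I * t / (m - n + 1 / 2)
        * (J (2 * m - 1) * J (2 * n - 1) - J (2 * n - 2) * J (2 * m))

/-- The Kronecker symbol. -/
def kronecker (m n : ℤ) : ℂ := if m = n then 1 else 0

/-- The matrix `A_{m,n}(t) = δ_{m,n} + K_{m,n}(t) + K_{m,1-n}(t)`, `m, n = 1, …, r`; the row and
column indexed by `i : Fin r` are those with `m = i + 1`, `n = i + 1`. -/
def matrixA (r : ℕ) (t : ℝ) : Matrix (Fin r) (Fin r) ℂ :=
  Matrix.of fun i j =>
    let m : ℤ := (i : ℕ) + 1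
    let n : ℤ := (j : ℕ) + 1
    kronecker m n + kernelK m n t + kernelK m (1 - n) t

/-- `S(r,t) = |det_{m,n=1,…,r} A_{m,n}(t)|²`. -/
def relaxationTrunc (r : ℕ) (t : ℝ) : ℝ := ‖(matrixA r t).det‖ ^ 2

end SpinHelix

end

/-! A sitewise change of basis turns each bond of the ring into a position that is either empty or
occupied by a domain wall, and the Hamiltonian into the hopping of walls to adjacent bonds. The
number of walls is conserved, and the walls are free fermions. Flipping all spins splits the states
into two parities. A spin flip at site `1` carries a wall across the end of the ring, so the two
parities see opposite boundary signs. In each parity, `Ω` is a Slater determinant with one orbital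
on each of the `N / 2` successive pairs of bonds, and it evolves orbital by orbital. As `σ₁^x`
couples the two parities, `S_N(t)` is by Cauchy–Binet the real part of a determinant of overlaps of
orbitals with opposite boundary signs.

The orbitals are combinations of Bessel functions `J_k(4t)`, periodized with signs. As the ring
grows, their overlaps tend to half-line sums of products of Bessel functions, which telescope by the
three-term recurrence and give `K`. Up to signs, the overlaps and their limits differ from the
identity by `O((1 + |m|)⁻² (1 + |n|)⁻²)`, uniformly in the length of the ring, so expanding in
principal minors gives convergence to a Fredholm determinant over `ℤ`. The limit kernel is Hermitian
and changes sign when both indices are reflected by `n ↦ 1 - n`, which makes the determinant over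
`{1 - r, …, r}` the product `D conj D`, where `D` is the determinant of the kernel folded onto
`{1, …, r}`. -/

noncomputable section

namespace SpinHelix

open Complex (I)
open scoped Matrix Real ComplexConjugate

/-! ### Determinants -/

section FredholmDet

variable {ι n R : Type*}

/-- The finite principal submatrix of a possibly infinite matrix on the indices in `S`. -/
abbrev principal (K : Matrix ι ι R) (S : Finset ι) : Matrix S S R := K.submatrix (↑) (↑)

/-- The Fredholm determinant `det (1 + K)` of a matrix with an arbitrary index type, defined by its
expansion in principal minors. -/
def fredholmDet [CommRing R] [TopologicalSpace R] [DecidableEq ι] (K : Matrix ι ι R) : R :=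
  ∑' S : Finset ι, (principal K S).det

theorem det_one_add_eq_sum_minors [CommRing R] [Fintype n] [DecidableEq n] (A : Matrix n n R) :
    (1 + A).det = ∑ S : Finset n, (principal A S).det := by
  have map_eval : (1 + (Polynomial.X : Polynomial R) • A.map Polynomial.C).map
      (Polynomial.evalRingHom 1) = 1 + A := by
    ext i j
    by_cases h : i = j <;> simp [h]
  have natDegree_lt : (1 + (Polynomial.X : Polynomial R) • A.map Polynomial.C).det.natDegree
      < Fintype.card n + 1 := by
    rw [add_comm, ← Matrix.map_one Polynomial.C (map_zero _) (map_one _)]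
    exact Nat.lt_succ_of_le (Polynomial.natDegree_det_X_add_C_le A 1)
  rw [← map_eval, ← RingHom.mapMatrix_apply, ← RingHom.map_det, Polynomial.coe_evalRingHom,
    Polynomial.eval_eq_sum_range' natDegree_lt, ← Finset.powerset_univ, Finset.sum_powerset,
    Finset.card_univ]
  simp only [Matrix.coeff_det_one_add_X_smul_eq_sum_minors, one_pow, mul_one]

theorem det_one_add_principal [CommRing R] [DecidableEq ι] (K : Matrix ι ι R) (W : Finset ι) :
    (1 + principal K W).det = ∑ S ∈ W.powerset, (principal K S).det := by
  have det_principal_map : ∀ S : Finset W, (principal (principal K W) S).det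
      = (principal K (S.map (Function.Embedding.subtype (· ∈ W)))).det := fun S => by
    rw [← Matrix.det_submatrix_equiv_self (Finset.equivMap (.subtype (· ∈ W)) S)]
    rfl
  rw [det_one_add_eq_sum_minors]
  refine Finset.sum_bij (fun S _ => S.map (Function.Embedding.subtype _))
    (fun S _ => Finset.mem_powerset.mpr (Finset.map_subtype_subset S))
    (fun S _ T _ h => Finset.map_injective _ h)
    (fun S hS => ⟨S.subtype (· ∈ W), Finset.mem_univ _,
      Finset.subtype_map_of_mem fun _ hx => Finset.mem_powerset.mp hS hx⟩)
    fun S _ => det_principal_map S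

theorem norm_det_le_prod_sum [NormedCommRing R] [NormOneClass R] [Fintype n] [DecidableEq n]
    (A : Matrix n n R) : ‖A.det‖ ≤ ∏ j, ∑ i, ‖A i j‖ := by
  calc ‖A.det‖ ≤ ∑ σ : Equiv.Perm n, ∏ j, ‖A (σ j) j‖ := by
        rw [Matrix.det_apply]
        refine norm_sum_le_of_le _ fun σ _ => ?_
        rcases Int.units_eq_one_or (Equiv.Perm.sign σ) with h | h <;>
          simpa [h, Units.smul_def] using Finset.norm_prod_le Finset.univ fun j => A (σ j) j
    _ = ∑ f ∈ Finset.univ.map ⟨fun σ : Equiv.Perm n => (σ : n → n), DFunLike.coe_injective⟩,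
          ∏ j, ‖A (f j) j‖ := by
        rw [Finset.sum_map]; rfl
    _ ≤ ∑ f : n → n, ∏ j, ‖A (f j) j‖ :=
        Finset.sum_le_univ_sum_of_nonneg fun f => by positivity
    _ = ∏ j, ∑ i, ‖A i j‖ := by rw [Finset.prod_univ_sum, Fintype.piFinset_univ]

theorem norm_det_principal_le [NormedCommRing R] [NormOneClass R] [DecidableEq ι]
    {K : Matrix ι ι R} {S : Finset ι} {b : ι → ℝ} {C : ℝ} (hC : 0 ≤ C) (hb : ∀ i, 0 ≤ b i)
    (hsum : Summable b) (hK : ∀ i ∈ S, ∀ j ∈ S, ‖K i j‖ ≤ C * b i * b j) :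
    ‖(principal K S).det‖ ≤ ∏ j ∈ S, C * (∑' i, b i) * b j := by
  refine (norm_det_le_prod_sum _).trans ?_
  rw [← Finset.prod_coe_sort S]
  refine Finset.prod_le_prod (fun j _ => by positivity) fun j _ => ?_
  have := hb j
  calc ∑ i : S, ‖K i j‖ ≤ ∑ i : S, C * b i * b j :=
        Finset.sum_le_sum fun i _ => hK i i.2 j j.2
    _ = C * (∑ i ∈ S, b i) * b j := by
        rw [← Finset.sum_mul, ← Finset.mul_sum, Finset.sum_coe_sort S]
    _ ≤ C * (∑' i, b i) * b j := by
        gcongr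
        exact hsum.sum_le_tsum S fun i _ => hb i

theorem tendsto_det_one_add_principal [NormedCommRing R] [NormOneClass R] [CompleteSpace R]
    [DecidableEq ι] {α : Type*} {l : Filter α} {W : α → Finset ι} {K : α → Matrix ι ι R}
    {Klim : Matrix ι ι R} {b : ι → ℝ} {C : ℝ} (hC : 0 ≤ C) (hb : ∀ i, 0 ≤ b i) (hsum : Summable b)
    (hW : ∀ i, ∀ᶠ a in l, i ∈ W a) (hK : ∀ a, ∀ i ∈ W a, ∀ j ∈ W a, ‖K a i j‖ ≤ C * b i * b j)
    (hlim : ∀ i j, Tendsto (fun a => K a i j) l (𝓝 (Klim i j))) :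
    Tendsto (fun a => (1 + principal (K a) (W a)).det) l (𝓝 (fredholmDet Klim)) := by
  have expansion : ∀ a, (1 + principal (K a) (W a)).det
      = ∑' S : Finset ι, if S ⊆ W a then (principal (K a) S).det else 0 := fun a => by
    rw [det_one_add_principal, tsum_eq_sum (s := (W a).powerset)
      fun S hS => if_neg (by simpa using hS)]
    exact Finset.sum_congr rfl fun S hS => (if_pos (Finset.mem_powerset.mp hS)).symm
  have tsum_nonneg : 0 ≤ ∑' i, b i := tsum_nonneg hb
  have factor_nonneg : ∀ i, 0 ≤ C * (∑' i, b i) * b i := fun i =>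
    mul_nonneg (mul_nonneg hC tsum_nonneg) (hb i)
  simp only [expansion]
  refine tendsto_tsum_of_dominated_convergence
    (summable_finsetProd_of_summable_nonneg factor_nonneg (hsum.mul_left _))
    (fun S => ?_) (Eventually.of_forall fun a S => ?_)
  · have eventually_subset : ∀ᶠ a in l, S ⊆ W a :=
      (Filter.eventually_all_finset S).mpr fun i _ => hW i
    have tendsto_minor :
        Tendsto (fun a => (principal (K a) S).det) l (𝓝 (principal Klim S).det) :=
      ((Continuous.matrix_det continuous_id).tendsto _).comp
        (tendsto_pi_nhds.mpr fun i => tendsto_pi_nhds.mpr fun j => hlim i j)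
    refine tendsto_minor.congr' ?_
    filter_upwards [eventually_subset] with a ha
    rw [if_pos ha]
  · split_ifs with hS
    · exact norm_det_principal_le hC hb hsum fun i hi j hj => hK a i (hS hi) j (hS hj)
    · exact norm_zero.trans_le (Finset.prod_nonneg fun i _ => factor_nonneg i)

end FredholmDet

section DetIdentities

variable {n : Type*} [Fintype n] [DecidableEq n]

theorem det_fromBlocks_symm {R : Type*} [CommRing R] (P Q : Matrix n n R) :
    (Matrix.fromBlocks P Q Q P).det = (P + Q).det * (P - Q).det := by
  have conj_triangular :
      Matrix.fromBlocks 1 1 0 1 * Matrix.fromBlocks P Q Q P * Matrix.fromBlocks 1 (-1) 0 1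
        = Matrix.fromBlocks (P + Q) 0 Q (P - Q) := by
    simp only [Matrix.fromBlocks_multiply]
    congr 1 <;> (simp [sub_eq_add_neg, add_comm]; try abel)
  simpa using congrArg Matrix.det conj_triangular

theorem hasDerivAt_det {𝕜 R : Type*} [NontriviallyNormedField 𝕜] [NormedCommRing R]
    [NormedAlgebra 𝕜 R] {A : 𝕜 → Matrix n n R} {A' : Matrix n n R} {t : 𝕜}
    (h : ∀ i j, HasDerivAt (fun t => A t i j) (A' i j) t) :
    HasDerivAt (fun t => (A t).det) (∑ j, ((A t).updateCol j fun i => A' i j).det) t := by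
  simp only [Matrix.det_apply]
  rw [Finset.sum_comm]
  refine HasDerivAt.fun_sum fun σ _ => ?_
  simp only [← Finset.smul_sum]
  refine HasDerivAt.const_smul _ ?_
  refine (HasDerivAt.fun_finsetProd fun i (_ : i ∈ Finset.univ) => h (σ i) i).congr_deriv
    (Finset.sum_congr rfl fun j _ => ?_)
  rw [← Finset.mul_prod_erase _ _ (Finset.mem_univ j), Matrix.updateCol_self, smul_eq_mul, mul_comm]
  congr 1
  refine Finset.prod_congr rfl fun i hi => ?_
  rw [Matrix.updateCol_ne (Finset.ne_of_mem_erase hi)]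

end DetIdentities

/-! ### Linear differential equations with constant coefficients -/

section LinearODE

theorem exp_smul_mulVec_eq_of_hasDerivAt {𝕜 n : Type*} [RCLike 𝕜] [Fintype n] [DecidableEq n]
    (A : Matrix n n 𝕜) {y : ℝ → n → 𝕜} (hy : ∀ t i, HasDerivAt (fun s => y s i) ((A *ᵥ y t) i) t)
    (t : ℝ) : NormedSpace.exp (t • A) *ᵥ y 0 = y t := by
  let _ : NormedRing (Matrix n n 𝕜) := Matrix.linftyOpNormedRing
  let _ : NormedAlgebra ℝ (Matrix n n 𝕜) := Matrix.linftyOpNormedAlgebra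
  let toVec : Matrix n n 𝕜 →L[ℝ] n → 𝕜 := LinearMap.toContinuousLinearMap
    { toFun := fun B => B *ᵥ y 0
      map_add' := fun B C => Matrix.add_mulVec B C _
      map_smul' := fun c B => Matrix.smul_mulVec c B _ }
  let mulA : (n → 𝕜) →L[ℝ] n → 𝕜 := (A.mulVecLin.restrictScalars ℝ).toContinuousLinearMap
  have hasDerivAt_exp : ∀ s : ℝ, HasDerivAt (fun r : ℝ => NormedSpace.exp (r • A) *ᵥ y 0)
      (mulA (NormedSpace.exp (s • A) *ᵥ y 0)) s := fun s => by
    have := toVec.hasFDerivAt.comp_hasDerivAt s (hasDerivAt_exp_smul_const' (𝕂 := ℝ) A s)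
    exact this.congr_deriv (Matrix.mulVec_mulVec _ _ _).symm
  have solution_eq : (fun r : ℝ => NormedSpace.exp (r • A) *ᵥ y 0) = y :=
    ODE_solution_unique_univ (v := fun _ => mulA) (s := fun _ => Set.univ) (t₀ := 0)
      (fun _ => mulA.lipschitz.lipschitzOnWith)
      (fun s => ⟨hasDerivAt_exp s, Set.mem_univ _⟩)
      (fun s => ⟨hasDerivAt_pi.mpr (hy s), Set.mem_univ _⟩)
      (by simp)
  exact congrFun solution_eq t

end LinearODE

/-! ### Slater determinants -/

section Slater

variable {M : ℕ} {α R : Type*}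

theorem image_update_univ [DecidableEq α] {x : Fin M → α} (hx : Function.Injective x) (j : Fin M)
    (v : α) : Finset.univ.image (Function.update x j v)
      = insert v ((Finset.univ.image x).erase (x j)) := by
  ext k
  simp only [Finset.mem_image, Finset.mem_univ, true_and, Finset.mem_insert, Finset.mem_erase]
  constructor
  · rintro ⟨i, rfl⟩
    rcases eq_or_ne i j with rfl | hij
    · simp
    · rw [Function.update_of_ne hij]
      exact Or.inr ⟨hx.ne hij, i, rfl⟩
  · rintro (rfl | ⟨hk, i, rfl⟩)
    · exact ⟨j, Function.update_self ..⟩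
    · exact ⟨i, Function.update_of_ne (fun h => hk (congrArg x h)) ..⟩

theorem strictMono_update [Preorder α] {x : Fin M → α} (hx : StrictMono x) {j : Fin M} {v : α}
    (below : ∀ i < j, x i < v) (above : ∀ i > j, v < x i) :
    StrictMono (Function.update x j v) := by
  intro a b hab
  rcases eq_or_ne a j with rfl | ha
  · simpa [Function.update_of_ne hab.ne'] using above b hab
  · rcases eq_or_ne b j with rfl | hb
    · simpa [Function.update_of_ne ha] using below a hab
    · simpa [Function.update_of_ne ha, Function.update_of_ne hb] using hx hab

theorem strictMono_cons [Preorder α] {x : Fin M → α} (hx : StrictMono x) {v : α}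
    (hv : ∀ i, v < x i) : StrictMono (Fin.cons v x : Fin (M + 1) → α) := by
  intro a b hab
  induction b using Fin.cases with
  | zero => exact absurd hab (Fin.not_lt_zero a)
  | succ b =>
    induction a using Fin.cases with
    | zero => simpa using hv b
    | succ a => simpa using hx (Fin.succ_lt_succ_iff.mp hab)

theorem strictMono_snoc [Preorder α] {x : Fin M → α} (hx : StrictMono x) {v : α}
    (hv : ∀ i, x i < v) : StrictMono (Fin.snoc x v : Fin (M + 1) → α) := by
  intro a b hab
  induction a using Fin.lastCases with
  | last => exact absurd hab (not_lt.mpr (Fin.le_last b))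
  | cast a =>
    induction b using Fin.lastCases with
    | last => simpa using hv a
    | cast b => simpa using hx (Fin.castSucc_lt_castSucc_iff.mp hab)

theorem exists_strictMono_image_eq [LinearOrder α] {T : Finset α} (hT : T.card = M) :
    ∃ x : Fin M → α, StrictMono x ∧ Finset.univ.image x = T :=
  ⟨T.orderEmbOfFin hT, (T.orderEmbOfFin hT).strictMono, T.image_orderEmbOfFin_univ hT⟩

theorem sum_filter_image_eq [Fintype α] [DecidableEq α] [AddCommMonoid R] {x : Fin M → α}
    (hx : Function.Injective x) (g : (Fin M → α) → R) :
    ∑ f : Fin M → α with Finset.univ.image f = Finset.univ.image x, g f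
      = ∑ σ : Equiv.Perm (Fin M), g (x ∘ σ) := by
  refine (Finset.sum_bij (fun (σ : Equiv.Perm (Fin M)) _ => x ∘ σ) (fun σ _ => ?_)
    (fun σ _ τ _ h => ?_) (fun f hf => ?_) fun _ _ => rfl).symm
  · rw [Finset.mem_filter, ← Finset.image_image, Finset.image_univ_equiv]
    exact ⟨Finset.mem_univ _, rfl⟩
  · exact Equiv.ext fun i => hx (congrFun h i)
  · have image_eq : Finset.univ.image f = Finset.univ.image x := (Finset.mem_filter.mp hf).2
    have exists_preimage : ∀ i, ∃ j, x j = f i := fun i => by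
      have : f i ∈ Finset.univ.image x := image_eq ▸ Finset.mem_image_of_mem f (Finset.mem_univ i)
      simpa using this
    choose τ hτ using exists_preimage
    have surjective : Function.Surjective τ := fun j => by
      have : x j ∈ Finset.univ.image f := image_eq ▸ Finset.mem_image_of_mem x (Finset.mem_univ j)
      obtain ⟨i, -, hi⟩ := Finset.mem_image.mp this
      exact ⟨i, hx ((hτ i).trans hi)⟩
    exact ⟨Equiv.ofBijective τ (Finite.surjective_iff_bijective.mp surjective), Finset.mem_univ _,
      funext hτ⟩

variable [CommRing R]

/-- The determinant of the orbitals `φ` at the positions `x`. -/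
def slaterDet (φ : Fin M → α → R) (x : Fin M → α) : R := (Matrix.of fun i j => φ i (x j)).det

theorem slaterDet_comp_perm (φ : Fin M → α → R) (x : Fin M → α) (σ : Equiv.Perm (Fin M)) :
    slaterDet φ (x ∘ σ) = Equiv.Perm.sign σ * slaterDet φ x :=
  Matrix.det_permute' σ (Matrix.of fun i j => φ i (x j))

theorem slaterDet_eq_zero_of_eq (φ : Fin M → α → R) {x : Fin M → α} {i j : Fin M} (hij : i ≠ j)
    (h : x i = x j) : slaterDet φ x = 0 :=
  Matrix.det_zero_of_column_eq hij fun k => by simp [h]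

theorem slaterDet_update (φ : Fin M → α → R) (x : Fin M → α) (j : Fin M) (v : α) :
    slaterDet φ (Function.update x j v)
      = ((Matrix.of fun i k => φ i (x k)).updateCol j fun i => φ i v).det := by
  unfold slaterDet
  congr 1
  ext i k
  rcases eq_or_ne k j with rfl | hk
  · simp
  · simp [Function.update_of_ne hk, Matrix.updateCol_ne hk]

theorem slaterDet_update_smul (φ : Fin M → α → R) (x : Fin M → α) (j : Fin M) {a b : α} {c : R}
    (h : ∀ i, φ i a = c * φ i b) :
    slaterDet φ (Function.update x j a) = c * slaterDet φ (Function.update x j b) := by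
  rw [slaterDet_update, slaterDet_update, ← Matrix.det_updateCol_smul]
  exact congrArg (fun u => (Matrix.updateCol _ j u).det) (funext h)

theorem slaterDet_snoc (φ : Fin (M + 1) → α → R) (x : Fin M → α) (v : α) :
    slaterDet φ (Fin.snoc x v) = (-1) ^ M * slaterDet φ (Fin.cons v x) := by
  rw [Fin.snoc_eq_cons_rotate, ← Function.comp_def, slaterDet_comp_perm, sign_finRotate]
  push_cast
  rfl

theorem slaterDet_snoc_of_eq_smul (φ : Fin (M + 1) → α → R) (x : Fin M → α) {a b : α} {c : R}
    (h : ∀ i, φ i a = c * φ i b) :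
    slaterDet φ (Fin.snoc x a) = c * (-1) ^ M * slaterDet φ (Fin.cons b x) := by
  have snoc_eq : ∀ v : α, (Fin.snoc x v : Fin (M + 1) → α)
      = Function.update (Fin.snoc x b) (Fin.last M) v := fun _ => (Fin.update_snoc_last ..).symm
  rw [snoc_eq, slaterDet_update_smul φ _ _ h, ← snoc_eq, slaterDet_snoc, mul_assoc]

theorem hasDerivAt_slaterDet {φ : ℝ → Fin M → α → ℂ} {x a b : Fin M → α} {c : ℂ} {t : ℝ}
    (h : ∀ i j, HasDerivAt (fun s => φ s i (x j)) (c * (φ t i (a j) - φ t i (b j))) t) :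
    HasDerivAt (fun s => slaterDet (φ s) x)
      (∑ j, c * (slaterDet (φ t) (Function.update x j (a j))
        - slaterDet (φ t) (Function.update x j (b j)))) t := by
  refine (hasDerivAt_det (A := fun s => Matrix.of fun i j => φ s i (x j))
    (A' := Matrix.of fun i j => c * (φ t i (a j) - φ t i (b j))) h).congr_deriv ?_
  refine Finset.sum_congr rfl fun j _ => ?_
  have col_eq : (fun i => c * (φ t i (a j) - φ t i (b j)))
      = c • ((fun i => φ t i (a j)) + (-1 : ℂ) • fun i => φ t i (b j)) := by
    funext i
    simp [sub_eq_add_neg]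
  simp only [Matrix.of_apply]
  rw [col_eq, Matrix.det_updateCol_smul, Matrix.det_updateCol_add, Matrix.det_updateCol_smul,
    slaterDet_update, slaterDet_update, neg_one_mul, sub_eq_add_neg]

theorem det_sum_mul_eq_sum_slaterDet [Fintype α] (φ χ : Fin M → α → R) :
    (Matrix.of fun i j => ∑ k, φ i k * χ j k).det
      = ∑ f : Fin M → α, (∏ i, φ i (f i)) * slaterDet χ f := by
  have rows_eq : (Matrix.of fun i j => ∑ k, φ i k * χ j k)
      = fun i => ∑ k, φ i k • fun j => χ j k := by
    ext i j
    simp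
  rw [rows_eq]
  refine ((Matrix.detRowAlternating (n := Fin M) (R := R)).toMultilinearMap.map_sum
    fun i k => φ i k • fun j => χ j k).trans (Finset.sum_congr rfl fun f _ => ?_)
  rw [MultilinearMap.map_smul_univ, smul_eq_mul, slaterDet, ← Matrix.det_transpose]
  rfl

theorem sum_prod_comp_perm_mul_slaterDet (φ χ : Fin M → α → R) (x : Fin M → α) :
    ∑ σ : Equiv.Perm (Fin M), (∏ i, φ i ((x ∘ σ) i)) * slaterDet χ (x ∘ σ)
      = slaterDet φ x * slaterDet χ x := by
  have expand : slaterDet φ x = ∑ σ : Equiv.Perm (Fin M),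
      Equiv.Perm.sign σ • ∏ i, φ i ((x ∘ σ) i) := by
    rw [slaterDet, ← Matrix.det_transpose, Matrix.det_apply]
    rfl
  rw [expand, Finset.sum_mul]
  refine Finset.sum_congr rfl fun σ _ => ?_
  rw [slaterDet_comp_perm, Units.smul_def, zsmul_eq_mul]
  ring

variable [LinearOrder α]

/-- The Slater determinant as a function of the set `T` of occupied positions, taken in increasing
order; it vanishes when the number of positions is not the number of orbitals. -/
def slaterAmp (φ : Fin M → α → R) (T : Finset α) : R :=
  if h : T.card = M then slaterDet φ (T.orderEmbOfFin h) else 0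

theorem slaterAmp_of_card_ne (φ : Fin M → α → R) {T : Finset α} (h : T.card ≠ M) :
    slaterAmp φ T = 0 := dif_neg h

theorem slaterAmp_image (φ : Fin M → α → R) {x : Fin M → α} (hx : StrictMono x) :
    slaterAmp φ (Finset.univ.image x) = slaterDet φ x := by
  have card_eq : (Finset.univ.image x).card = M := by
    rw [Finset.card_image_of_injective _ hx.injective, Finset.card_univ, Fintype.card_fin]
  rw [slaterAmp, dif_pos card_eq, ← Finset.orderEmbOfFin_unique card_eq
    (fun i => Finset.mem_image_of_mem x (Finset.mem_univ i)) hx]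

theorem map_slaterAmp {S : Type*} [CommRing S] (f : R →+* S) (φ : Fin M → α → R) (T : Finset α) :
    f (slaterAmp φ T) = slaterAmp (fun i k => f (φ i k)) T := by
  unfold slaterAmp slaterDet
  split_ifs
  · exact f.map_det _
  · exact map_zero f

/-- The Cauchy–Binet formula: maps `f : Fin M → α` are sorted by their image, and the ones that are
not injective contribute zero. -/
theorem sum_slaterAmp_mul_slaterAmp [Fintype α] (φ χ : Fin M → α → R) :
    ∑ T, slaterAmp φ T * slaterAmp χ T = (Matrix.of fun i j => ∑ k, φ i k * χ j k).det := by
  rw [det_sum_mul_eq_sum_slaterDet,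
    ← Finset.sum_fiberwise Finset.univ fun f : Fin M → α => Finset.univ.image f]
  refine Finset.sum_congr rfl fun T _ => ?_
  by_cases hT : T.card = M
  · obtain ⟨x, hx, rfl⟩ := exists_strictMono_image_eq hT
    rw [slaterAmp_image φ hx, slaterAmp_image χ hx, sum_filter_image_eq hx.injective,
      sum_prod_comp_perm_mul_slaterDet]
  · rw [slaterAmp_of_card_ne φ hT, zero_mul]
    refine (Finset.sum_eq_zero fun f hf => ?_).symm
    have not_injective : ¬ Function.Injective f := fun hinj => hT <| by
      rw [← (Finset.mem_filter.mp hf).2, Finset.card_image_of_injective _ hinj, Finset.card_univ,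
        Fintype.card_fin]
    obtain ⟨i, j, hij, hne⟩ := Function.not_injective_iff.mp not_injective
    rw [slaterDet_eq_zero_of_eq χ hne hij, mul_zero]

end Slater

/-! ### Bessel functions of integer order -/

section Bessel

theorem two_pi_mul_besselJ (k : ℤ) (x : ℝ) :
    2 * π * besselJ k x = ∫ θ in (-π)..π, Real.cos (k * θ - x * Real.sin θ) := by
  unfold besselJ
  field_simp [Real.pi_ne_zero]

theorem abs_besselJ_le_one (k : ℤ) (x : ℝ) : |besselJ k x| ≤ 1 := by
  have integral_le : ‖∫ θ in (-π)..π, Real.cos (k * θ - x * Real.sin θ)‖ ≤ 1 * |π - -π| :=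
    intervalIntegral.norm_integral_le_of_norm_le_const fun θ _ => Real.abs_cos_le_one _
  rw [← two_pi_mul_besselJ, Real.norm_eq_abs, abs_mul, abs_of_pos Real.two_pi_pos, one_mul,
    sub_neg_eq_add, ← two_mul, abs_of_pos Real.two_pi_pos] at integral_le
  exact le_of_mul_le_mul_left (by linarith) Real.two_pi_pos

theorem besselJ_neg (k : ℤ) (x : ℝ) : besselJ (-k) x = (-1) ^ k * besselJ k x := by
  let f : ℝ → ℝ := fun θ => Real.cos (((-k : ℤ) : ℝ) * θ - x * Real.sin θ)
  have periodic : Function.Periodic f (2 * π) := fun θ => by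
    simp only [f, Real.sin_add_two_pi]
    rw [mul_add, add_sub_right_comm, Real.cos_add_int_mul_two_pi]
  have shift : ∫ θ in (-π)..π, f θ = ∫ θ in (-π)..π, f (θ + π) := by
    have := periodic.intervalIntegral_add_eq (-π) 0
    rw [intervalIntegral.integral_comp_add_right]
    convert this using 2 <;> ring
  have f_add_pi : ∀ θ, f (θ + π) = (-1) ^ k * Real.cos (k * θ - x * Real.sin θ) := fun θ => by
    simp only [f, Real.sin_add_pi]
    rw [← Real.cos_add_int_mul_pi, ← Real.cos_neg]
    congr 1
    push_cast
    ring
  calc besselJ (-k) x = 1 / (2 * π) * ∫ θ in (-π)..π, f (θ + π) := by rw [← shift, besselJ]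
    _ = (-1) ^ k * besselJ k x := by
        simp only [f_add_pi, intervalIntegral.integral_const_mul, besselJ]
        ring

theorem besselJ_sub_one_add_besselJ_add_one (k : ℤ) (x : ℝ) :
    besselJ (k - 1) x + besselJ (k + 1) x
      = 1 / π * ∫ θ in (-π)..π, Real.cos (k * θ - x * Real.sin θ) * Real.cos θ := by
  unfold besselJ
  rw [← mul_add, ← intervalIntegral.integral_add
    (Continuous.intervalIntegrable (by fun_prop) _ _)
    (Continuous.intervalIntegrable (by fun_prop) _ _),
    show 1 / π = 1 / (2 * π) * 2 by field_simp, mul_assoc,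
    ← intervalIntegral.integral_const_mul (2 : ℝ)]
  congr 1
  refine intervalIntegral.integral_congr fun θ _ => ?_
  push_cast
  rw [sub_mul, add_mul, one_mul, sub_right_comm, add_sub_right_comm, Real.cos_sub _ θ,
    Real.cos_add _ θ]
  ring

theorem besselJ_sub_one_sub_besselJ_add_one (k : ℤ) (x : ℝ) :
    besselJ (k - 1) x - besselJ (k + 1) x
      = 1 / π * ∫ θ in (-π)..π, Real.sin (k * θ - x * Real.sin θ) * Real.sin θ := by
  unfold besselJ
  rw [← mul_sub, ← intervalIntegral.integral_sub
    (Continuous.intervalIntegrable (by fun_prop) _ _)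
    (Continuous.intervalIntegrable (by fun_prop) _ _),
    show 1 / π = 1 / (2 * π) * 2 by field_simp, mul_assoc,
    ← intervalIntegral.integral_const_mul (2 : ℝ)]
  congr 1
  refine intervalIntegral.integral_congr fun θ _ => ?_
  push_cast
  rw [sub_mul, add_mul, one_mul, sub_right_comm, add_sub_right_comm, Real.cos_sub _ θ,
    Real.cos_add _ θ]
  ring

theorem besselJ_recurrence (k : ℤ) (x : ℝ) :
    2 * k * besselJ k x = x * (besselJ (k - 1) x + besselJ (k + 1) x) := by
  have integral_deriv_eq_zero :
      ∫ θ in (-π)..π, Real.cos (k * θ - x * Real.sin θ) * (k - x * Real.cos θ) = 0 := by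
    rw [intervalIntegral.integral_eq_sub_of_hasDerivAt
      (f := fun θ : ℝ => Real.sin (k * θ - x * Real.sin θ)) (fun θ _ => ?_)
      (Continuous.intervalIntegrable (by fun_prop) _ _)]
    · simp [Real.sin_int_mul_pi]
    · simpa using
        (((hasDerivAt_id θ).const_mul (k : ℝ)).sub ((Real.hasDerivAt_sin θ).const_mul x)).sin
  have expand : ∫ θ in (-π)..π, Real.cos (k * θ - x * Real.sin θ) * (k - x * Real.cos θ)
      = k * (2 * π * besselJ k x)
        - x * ∫ θ in (-π)..π, Real.cos (k * θ - x * Real.sin θ) * Real.cos θ := by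
    rw [two_pi_mul_besselJ, ← intervalIntegral.integral_const_mul,
      ← intervalIntegral.integral_const_mul, ← intervalIntegral.integral_sub
        (Continuous.intervalIntegrable (by fun_prop) _ _)
        (Continuous.intervalIntegrable (by fun_prop) _ _)]
    refine intervalIntegral.integral_congr fun θ _ => ?_
    ring
  rw [besselJ_sub_one_add_besselJ_add_one]
  field_simp [Real.pi_ne_zero]
  linarith

theorem hasDerivAt_besselJ (k : ℤ) (x : ℝ) :
    HasDerivAt (besselJ k) ((besselJ (k - 1) x - besselJ (k + 1) x) / 2) x := by
  have hasDerivAt_integral := (intervalIntegral.hasDerivAt_integral_of_dominated_loc_of_deriv_le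
    (μ := MeasureTheory.volume) (a := -π) (b := π) (x₀ := x) (s := Set.univ)
    (F := fun x θ : ℝ => Real.cos (k * θ - x * Real.sin θ))
    (F' := fun x θ : ℝ => Real.sin (k * θ - x * Real.sin θ) * Real.sin θ)
    (bound := fun _ => 1) Filter.univ_mem
    (Filter.Eventually.of_forall fun y => Continuous.aestronglyMeasurable (by fun_prop))
    (Continuous.intervalIntegrable (by fun_prop) _ _)
    (Continuous.aestronglyMeasurable (by fun_prop))
    (Filter.Eventually.of_forall fun θ _ y _ => ?_) (by simp)
    (Filter.Eventually.of_forall fun θ _ y _ => ?_)).2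
  · refine (hasDerivAt_integral.const_mul (1 / (2 * π))).congr_deriv ?_
    rw [besselJ_sub_one_sub_besselJ_add_one]
    ring
  · rw [norm_mul]
    exact mul_le_one₀ (Real.abs_sin_le_one _) (norm_nonneg _) (Real.abs_sin_le_one _)
  · simpa using (((hasDerivAt_id y).mul_const (Real.sin θ)).const_sub (k * θ)).cos

theorem besselJ_zero_right (k : ℤ) : besselJ k 0 = if k = 0 then 1 else 0 := by
  split_ifs with hk
  · simp only [hk, besselJ, Int.cast_zero, zero_mul, sub_zero, Real.cos_zero,
      intervalIntegral.integral_const, smul_eq_mul]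
    field_simp
    ring
  · have hk' : (k : ℝ) ≠ 0 := mod_cast hk
    simpa [hk'] using besselJ_recurrence k 0

/-- The summable weight `(1 + |k|)⁻²`, against which all decay in the position `k` is measured. -/
def decay (k : ℤ) : ℝ := ((1 + |(k : ℝ)|) ^ 2)⁻¹

theorem decay_pos (k : ℤ) : 0 < decay k := by unfold decay; positivity

theorem decay_le_one (k : ℤ) : decay k ≤ 1 :=
  inv_le_one_of_one_le₀ (one_le_pow₀ (le_add_of_nonneg_right (abs_nonneg _)))

theorem summable_decay : Summable decay := by
  have summable_nat : Summable fun n : ℕ => ((1 + (n : ℝ)) ^ 2)⁻¹ := by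
    simpa [add_comm] using (summable_nat_add_iff 1).mpr (Real.summable_nat_pow_inv.mpr one_lt_two)
  exact Summable.of_nat_of_neg (by simpa [decay] using summable_nat)
    (by simpa [decay] using summable_nat)

theorem decay_le_mul_decay {a b : ℤ} {c : ℝ} (h : 1 + |(b : ℝ)| ≤ c * (1 + |(a : ℝ)|)) :
    decay a ≤ c ^ 2 * decay b := by
  unfold decay
  rw [← div_eq_mul_inv, inv_eq_one_div, div_le_div_iff₀ (by positivity) (by positivity), one_mul,
    ← mul_pow]
  gcongr

theorem decay_le_decay {a b : ℤ} (h : |b| ≤ |a|) : decay a ≤ decay b := by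
  have h' : |(b : ℝ)| ≤ |(a : ℝ)| := mod_cast h
  simpa using decay_le_mul_decay (c := 1) (by linarith)

theorem decay_add_le (a b : ℤ) : decay (a + b) ≤ (1 + |(b : ℝ)|) ^ 2 * decay a := by
  refine decay_le_mul_decay ?_
  have : |(a : ℝ)| ≤ |((a + b : ℤ) : ℝ)| + |(b : ℝ)| := by
    push_cast
    simpa using abs_sub ((a : ℝ) + b) b
  nlinarith [abs_nonneg ((a + b : ℤ) : ℝ), abs_nonneg (b : ℝ)]

theorem abs_mul_abs_besselJ_le {X x : ℝ} (hx : |x| ≤ X) (k : ℤ) :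
    |(k : ℝ)| * |besselJ k x| ≤ X / 2 * (|besselJ (k - 1) x| + |besselJ (k + 1) x|) := by
  have abs_recurrence := congrArg abs (besselJ_recurrence k x)
  rw [abs_mul, abs_mul, abs_mul, abs_two] at abs_recurrence
  have : |x| * |besselJ (k - 1) x + besselJ (k + 1) x|
      ≤ X * (|besselJ (k - 1) x| + |besselJ (k + 1) x|) :=
    mul_le_mul hx (abs_add_le _ _) (abs_nonneg _) ((abs_nonneg x).trans hx)
  linarith

/-- Each use of the three-term recurrence gains one power of `k`. -/
theorem exists_pow_mul_abs_besselJ_le (X : ℝ) (p : ℕ) : ∃ C : ℝ, 0 ≤ C ∧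
    ∀ (k : ℤ) (x : ℝ), |x| ≤ X → (1 + |(k : ℝ)|) ^ p * |besselJ k x| ≤ C := by
  induction p with
  | zero => exact ⟨1, zero_le_one, fun k x _ => by simpa using abs_besselJ_le_one k x⟩
  | succ p ih =>
    obtain ⟨C, hC, bound⟩ := ih
    refine ⟨C + |X| * (2 ^ p * C), by positivity, fun k x hx => ?_⟩
    have neighbour_bound : ∀ l : ℤ, 1 + |(k : ℝ)| ≤ 2 * (1 + |(l : ℝ)|) →
        (1 + |(k : ℝ)|) ^ p * |besselJ l x| ≤ 2 ^ p * C := fun l hl => by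
      calc (1 + |(k : ℝ)|) ^ p * |besselJ l x|
          ≤ (2 * (1 + |(l : ℝ)|)) ^ p * |besselJ l x| := by gcongr
        _ = 2 ^ p * ((1 + |(l : ℝ)|) ^ p * |besselJ l x|) := by rw [mul_pow]; ring
        _ ≤ 2 ^ p * C := by gcongr; exact bound l x hx
    have bound_sub_one := neighbour_bound (k - 1) (by
      have : |(k : ℝ)| ≤ |((k - 1 : ℤ) : ℝ)| + 1 := by
        push_cast; simpa using abs_add_le ((k : ℝ) - 1) 1
      linarith [abs_nonneg ((k - 1 : ℤ) : ℝ)])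
    have bound_add_one := neighbour_bound (k + 1) (by
      have : |(k : ℝ)| ≤ |((k + 1 : ℤ) : ℝ)| + 1 := by
        push_cast; simpa using abs_sub ((k : ℝ) + 1) 1
      linarith [abs_nonneg ((k + 1 : ℤ) : ℝ)])
    calc (1 + |(k : ℝ)|) ^ (p + 1) * |besselJ k x|
        = (1 + |(k : ℝ)|) ^ p * |besselJ k x|
          + (1 + |(k : ℝ)|) ^ p * (|(k : ℝ)| * |besselJ k x|) := by ring
      _ ≤ C + (1 + |(k : ℝ)|) ^ p * (|X| / 2 * (|besselJ (k - 1) x| + |besselJ (k + 1) x|)) := by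
          refine add_le_add (bound k x hx) (mul_le_mul_of_nonneg_left ?_ (by positivity))
          exact abs_mul_abs_besselJ_le (hx.trans (le_abs_self X)) k
      _ = C + |X| / 2 * ((1 + |(k : ℝ)|) ^ p * |besselJ (k - 1) x|
          + (1 + |(k : ℝ)|) ^ p * |besselJ (k + 1) x|) := by ring
      _ ≤ C + |X| / 2 * (2 ^ p * C + 2 ^ p * C) := by gcongr
      _ = C + |X| * (2 ^ p * C) := by ring

theorem exists_besselJ_le_decay_sq (X : ℝ) : ∃ C : ℝ, 0 ≤ C ∧
    ∀ (k : ℤ) (x : ℝ), |x| ≤ X → |besselJ k x| ≤ C * decay k ^ 2 := by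
  obtain ⟨C, hC, bound⟩ := exists_pow_mul_abs_besselJ_le X 4
  refine ⟨C, hC, fun k x hx => ?_⟩
  rw [decay, inv_pow, ← pow_mul, ← div_eq_mul_inv, le_div_iff₀ (by positivity), mul_comm]
  exact bound k x hx

theorem exists_besselJ_le_decay (X : ℝ) : ∃ C : ℝ, 0 ≤ C ∧
    ∀ (k : ℤ) (x : ℝ), |x| ≤ X → |besselJ k x| ≤ C * decay k := by
  obtain ⟨C, hC, bound⟩ := exists_besselJ_le_decay_sq X
  refine ⟨C, hC, fun k x hx => (bound k x hx).trans ?_⟩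
  gcongr
  exact pow_le_of_le_one (decay_pos k).le (decay_le_one k) two_ne_zero

theorem summable_besselJ (x : ℝ) : Summable fun k : ℤ => besselJ k x := by
  obtain ⟨C, -, bound⟩ := exists_besselJ_le_decay |x|
  exact Summable.of_norm_bounded (summable_decay.mul_left C) fun k => bound k x le_rfl

theorem integral_sin_sub_mul_sin_eq_zero (k : ℤ) (x : ℝ) :
    ∫ θ in (-π)..π, Real.sin (k * θ - x * Real.sin θ) = 0 := by
  have integral_comp_neg := intervalIntegral.integral_comp_neg (a := -π) (b := π)
    (fun θ : ℝ => Real.sin (k * θ - x * Real.sin θ))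
  have odd : ∀ θ : ℝ, Real.sin (k * -θ - x * Real.sin (-θ))
      = -Real.sin (k * θ - x * Real.sin θ) := fun θ => by
    rw [← Real.sin_neg, Real.sin_neg θ]
    congr 1
    ring
  simp only [odd, intervalIntegral.integral_neg, neg_neg] at integral_comp_neg
  linarith

/-- The generating function `θ ↦ exp (i x sin θ)` of the Bessel functions, on the circle. -/
def besselGen (x : ℝ) : C(AddCircle (2 * π), ℂ) where
  toFun θ := Complex.exp (I * (x * Real.Angle.sin θ : ℝ))
  continuous_toFun := by
    have : Continuous fun θ : Real.Angle => Complex.exp (I * (x * Real.Angle.sin θ : ℝ)) := by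
      have := Real.Angle.continuous_sin
      fun_prop
    exact this

theorem besselGen_coe (x θ : ℝ) :
    besselGen x (θ : AddCircle (2 * π)) = Complex.exp (I * (x * Real.sin θ)) := by
  change Complex.exp (I * (x * Real.Angle.sin (θ : Real.Angle) : ℝ)) = _
  rw [Real.Angle.sin_coe]
  push_cast
  rfl

local instance fact_two_pi_pos : Fact (0 < 2 * π) := ⟨Real.two_pi_pos⟩

theorem fourier_neg_smul_besselGen (x θ : ℝ) (k : ℤ) :
    fourier (-k) (θ : AddCircle (2 * π)) • besselGen x (θ : AddCircle (2 * π))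
      = (Real.cos (k * θ - x * Real.sin θ) : ℂ)
        - I * (Real.sin (k * θ - x * Real.sin θ) : ℝ) := by
  have pi_ne_zero : (π : ℂ) ≠ 0 := mod_cast Real.pi_ne_zero
  have exponent_eq : (2 * π * I * (-k : ℤ) * θ / (2 * π : ℝ) + I * (x * Real.sin θ) : ℂ)
      = ((-(k * θ - x * Real.sin θ) : ℝ) : ℂ) * I := by
    push_cast
    field_simp
    ring
  rw [besselGen_coe, fourier_coe_apply, smul_eq_mul, ← Complex.exp_add, exponent_eq,
    Complex.exp_mul_I, ← Complex.ofReal_cos, ← Complex.ofReal_sin, Real.cos_neg, Real.sin_neg]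
  push_cast
  ring

theorem fourierCoeff_besselGen (x : ℝ) (k : ℤ) :
    fourierCoeff (besselGen x) k = (besselJ k x : ℂ) := by
  rw [fourierCoeff_eq_intervalIntegral _ _ (-π), show -π + 2 * π = π by ring]
  simp only [fourier_neg_smul_besselGen]
  rw [intervalIntegral.integral_sub (Continuous.intervalIntegrable (by fun_prop) _ _)
    (Continuous.intervalIntegrable (by fun_prop) _ _), intervalIntegral.integral_const_mul,
    intervalIntegral.integral_ofReal, intervalIntegral.integral_ofReal,
    integral_sin_sub_mul_sin_eq_zero, besselJ, Complex.real_smul]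
  push_cast
  ring

/-- The Jacobi–Anger expansion, as the Fourier series of `besselGen`. -/
theorem hasSum_besselJ_mul_exp (x θ : ℝ) :
    HasSum (fun k : ℤ => (besselJ k x : ℂ) * Complex.exp (I * (k * θ)))
      (Complex.exp (I * (x * Real.sin θ))) := by
  have summable_coeff : Summable (fourierCoeff (besselGen x)) := by
    rw [show fourierCoeff (besselGen x) = fun k => (besselJ k x : ℂ) from
      funext (fourierCoeff_besselGen x)]
    exact Complex.summable_ofReal.mpr (summable_besselJ x)
  have hasSum_fourier :=
    has_pointwise_sum_fourier_series_of_summable summable_coeff (θ : AddCircle (2 * π))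
  rw [besselGen_coe] at hasSum_fourier
  refine hasSum_fourier.congr_fun fun k => ?_
  rw [fourierCoeff_besselGen, fourier_coe_apply, smul_eq_mul]
  congr 2
  have pi_ne_zero : (π : ℂ) ≠ 0 := mod_cast Real.pi_ne_zero
  push_cast
  field_simp

theorem hasSum_besselJ_sq (x : ℝ) : HasSum (fun k : ℤ => besselJ k x ^ 2) 1 := by
  have parseval := hasSum_sq_fourierCoeff
    (ContinuousMap.toLp (E := ℂ) 2 AddCircle.haarAddCircle ℂ (besselGen x))
  simp_rw [fourierCoeff_toLp, fourierCoeff_besselGen] at parseval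
  have integral_eq_one : ∫ θ : AddCircle (2 * π),
      ‖(ContinuousMap.toLp (E := ℂ) 2 AddCircle.haarAddCircle ℂ (besselGen x)) θ‖ ^ 2
        ∂AddCircle.haarAddCircle = 1 := by
    rw [MeasureTheory.integral_congr_ae (g := fun _ => (1 : ℝ))]
    · simp
    · filter_upwards [ContinuousMap.coeFn_toLp (p := 2) (𝕜 := ℂ) AddCircle.haarAddCircle
        (besselGen x)] with θ hθ
      rw [hθ]
      change ‖Complex.exp (I * (x * Real.Angle.sin θ : ℝ))‖ ^ 2 = 1
      rw [mul_comm, Complex.norm_exp_ofReal_mul_I, one_pow]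
  rw [integral_eq_one] at parseval
  refine parseval.congr_fun fun k => ?_
  rw [Complex.norm_real, Real.norm_eq_abs, sq_abs]

end Bessel

/-! ### The kernel of the infinite chain -/

section LimitKernel

theorem summable_besselJ_mul_besselJ (x : ℝ) (a b : ℤ) {ι : Type*} {f : ι → ℤ}
    (hf : Function.Injective f) :
    Summable fun k => besselJ (a + f k) x * besselJ (b + f k) x := by
  have summable_left : Summable fun k => besselJ (a + f k) x :=
    (summable_besselJ x).comp_injective ((add_right_injective a).comp hf)
  refine Summable.of_norm_bounded summable_left.norm fun k => ?_
  rw [norm_mul]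
  exact mul_le_of_le_one_right (norm_nonneg _) (abs_besselJ_le_one _ _)

/-- The Wronskian-type bilinear form in the Christoffel–Darboux identity for Bessel functions. -/
def besselWronskian (x : ℝ) (a b : ℤ) : ℝ :=
  besselJ (a - 1) x * besselJ b x - besselJ a x * besselJ (b - 1) x

theorem summable_besselWronskian (x : ℝ) (a b : ℤ) :
    Summable fun k : ℤ => besselWronskian x (a + k) (b + k) := by
  refine ((summable_besselJ_mul_besselJ x (a - 1) b Function.injective_id).sub
    (summable_besselJ_mul_besselJ x a (b - 1) Function.injective_id)).congr fun k => ?_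
  simp only [besselWronskian, id_eq, sub_add_eq_add_sub]

theorem sub_mul_besselJ_mul_besselJ (x : ℝ) (a b k : ℤ) :
    ((a - b : ℤ) : ℝ) * (besselJ (a + k) x * besselJ (b + k) x)
      = x / 2 * (besselWronskian x (a + k) (b + k)
        - besselWronskian x (a + (k + 1)) (b + (k + 1))) := by
  have recurrence_left := besselJ_recurrence (a + k) x
  have recurrence_right := besselJ_recurrence (b + k) x
  simp only [besselWronskian, ← add_assoc, add_sub_cancel_right]
  push_cast at recurrence_left recurrence_right ⊢
  linear_combination
    besselJ (b + k) x / 2 * recurrence_left - besselJ (a + k) x / 2 * recurrence_right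

/-- The half-line sum `∑_{k ≥ 0} J_{a+k}(x) J_{b+k}(x)`, the building block of the overlaps of
one-particle orbitals. -/
def besselTail (x : ℝ) (a b : ℤ) : ℝ := ∑' k : ℕ, besselJ (a + k) x * besselJ (b + k) x

theorem besselTail_comm (x : ℝ) (a b : ℤ) : besselTail x a b = besselTail x b a := by
  simp only [besselTail, mul_comm]

/-- The Christoffel–Darboux identity: the sum telescopes by the three-term recurrence. -/
theorem sub_mul_besselTail (x : ℝ) (a b : ℤ) :
    ((a - b : ℤ) : ℝ) * besselTail x a b = x / 2 * besselWronskian x a b := by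
  have summable : Summable fun k : ℕ => besselWronskian x (a + k) (b + k) :=
    (summable_besselWronskian x a b).comp_injective Nat.cast_injective
  have summable_succ : Summable fun k : ℕ =>
      besselWronskian x (a + ((k : ℤ) + 1)) (b + ((k : ℤ) + 1)) := by
    simpa only [Nat.cast_add, Nat.cast_one] using (summable_nat_add_iff 1).mpr summable
  have split_first := summable.tsum_eq_zero_add
  push_cast at split_first
  simp_rw [besselTail, ← tsum_mul_left, sub_mul_besselJ_mul_besselJ]
  rw [tsum_mul_left, summable.tsum_sub summable_succ, split_first, add_sub_cancel_right,
    add_zero, add_zero]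

theorem besselTail_eq_div (x : ℝ) {a b : ℤ} (h : a ≠ b) :
    besselTail x a b = x / 2 / ((a - b : ℤ) : ℝ) * besselWronskian x a b := by
  have : ((a - b : ℤ) : ℝ) ≠ 0 := mod_cast sub_ne_zero.mpr h
  rw [div_mul_eq_mul_div, eq_div_iff this, mul_comm, sub_mul_besselTail]

theorem tsum_besselJ_mul_besselJ_of_ne (x : ℝ) {a b : ℤ} (hab : a ≠ b) :
    ∑' k : ℤ, besselJ (a + k) x * besselJ (b + k) x = 0 := by
  have summable := summable_besselWronskian x a b
  have summable_succ : Summable fun k : ℤ => besselWronskian x (a + (k + 1)) (b + (k + 1)) :=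
    (Equiv.addRight (1 : ℤ)).summable_iff.mpr summable
  have tsum_succ : ∑' k : ℤ, besselWronskian x (a + (k + 1)) (b + (k + 1))
      = ∑' k : ℤ, besselWronskian x (a + k) (b + k) :=
    (Equiv.addRight (1 : ℤ)).tsum_eq fun k => besselWronskian x (a + k) (b + k)
  have sub_mul_tsum :
      ((a - b : ℤ) : ℝ) * ∑' k : ℤ, besselJ (a + k) x * besselJ (b + k) x = 0 := by
    simp_rw [← tsum_mul_left, sub_mul_besselJ_mul_besselJ]
    rw [tsum_mul_left, summable.tsum_sub summable_succ, tsum_succ, sub_self, mul_zero]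
  exact (mul_eq_zero.mp sub_mul_tsum).resolve_left (mod_cast sub_ne_zero.mpr hab)

theorem tsum_besselJ_mul_besselJ (x : ℝ) (a b : ℤ) :
    ∑' k : ℤ, besselJ (a + k) x * besselJ (b + k) x = if a = b then 1 else 0 := by
  split_ifs with h
  · rw [← (hasSum_besselJ_sq x).tsum_eq,
      ← (Equiv.addLeft a).tsum_eq fun k : ℤ => besselJ k x ^ 2]
    simp only [h, Equiv.coe_addLeft, sq]
  · exact tsum_besselJ_mul_besselJ_of_ne x h

theorem besselTail_self_nat (x : ℝ) (c : ℕ) :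
    besselTail x c c = besselTail x 0 0 - ∑ j ∈ Finset.range c, besselJ j x ^ 2 := by
  have split := (summable_besselJ_mul_besselJ x 0 0 Nat.cast_injective).sum_add_tsum_nat_add c
  simp only [besselTail, zero_add] at split ⊢
  simp only [← split, sq, add_sub_cancel_left, Nat.cast_add, add_comm]

/-- By `J_{-k} = ± J_k`, the normalization `∑ J_k² = 1` counts the half line twice, up to the
term at `k = 0`. -/
theorem two_mul_besselTail_zero_zero (x : ℝ) : 2 * besselTail x 0 0 = 1 + besselJ 0 x ^ 2 := by
  have besselJ_neg_sq : ∀ k : ℤ, besselJ (-k) x ^ 2 = besselJ k x ^ 2 := fun k => by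
    rw [besselJ_neg, mul_pow, ← zpow_natCast, zpow_comm]
    simp
  have summable_sq : Summable fun k : ℤ => besselJ k x ^ 2 := (hasSum_besselJ_sq x).summable
  have tsum_eq_one := (hasSum_besselJ_sq x).tsum_eq
  rw [tsum_of_add_one_of_neg_add_one (f := fun k : ℤ => besselJ k x ^ 2)
    (summable_sq.comp_injective (i := fun n : ℕ => (n : ℤ) + 1) fun a b h => by simpa using h)
    (summable_sq.comp_injective (i := fun n : ℕ => -((n : ℤ) + 1)) fun a b h => by
      simpa using h)] at tsum_eq_one
  simp only [besselJ_neg_sq] at tsum_eq_one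
  have tail_one := besselTail_self_nat x 1
  simp only [besselTail, ← sq, Nat.cast_one, zero_add, Finset.range_one, Finset.sum_singleton,
    Nat.cast_zero, add_comm (1 : ℤ)] at tail_one ⊢
  linarith

/-- The one-particle wave function `J_y - i J_{y-1}`: a particle launched in superposition on two
adjacent bonds, up to phases. -/
def wave (x : ℝ) (y : ℤ) : ℂ := besselJ y x - I * besselJ (y - 1) x

theorem norm_wave_le (x : ℝ) (y : ℤ) : ‖wave x y‖ ≤ |besselJ y x| + |besselJ (y - 1) x| := by
  refine (norm_sub_le _ _).trans ?_
  simp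

theorem summable_wave_mul_conj (x : ℝ) (a b : ℤ) {ι : Type*} {f : ι → ℤ}
    (hf : Function.Injective f) :
    Summable fun k => wave x (a + f k) * conj (wave x (b + f k)) := by
  have summable_abs : ∀ c : ℤ, Summable fun k => |besselJ (c + f k) x| := fun c =>
    (summable_besselJ x).abs.comp_injective ((add_right_injective c).comp hf)
  refine Summable.of_norm_bounded
    (((summable_abs a).add (summable_abs (a - 1))).mul_right 2) fun k => ?_
  have norm_right_le : ‖wave x (b + f k)‖ ≤ 2 := (norm_wave_le x _).trans <| by
    linarith [abs_besselJ_le_one (b + f k) x, abs_besselJ_le_one (b + f k - 1) x]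
  rw [norm_mul, RCLike.norm_conj, sub_add_eq_add_sub]
  exact mul_le_mul (norm_wave_le x _) norm_right_le (norm_nonneg _) (by positivity)

theorem wave_mul_conj (x : ℝ) (a b : ℤ) :
    wave x a * conj (wave x b)
      = ((besselJ a x * besselJ b x + besselJ (a - 1) x * besselJ (b - 1) x : ℝ) : ℂ)
        + I * ((besselJ a x * besselJ (b - 1) x - besselJ (a - 1) x * besselJ b x : ℝ) : ℂ) := by
  simp only [wave, map_sub, map_mul, Complex.conj_ofReal, Complex.conj_I]
  push_cast
  linear_combination (-(besselJ (a - 1) x * besselJ (b - 1) x) : ℂ) * Complex.I_sq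

theorem tsum_wave_mul_conj (x : ℝ) (a b : ℤ) {ι : Type*} {f : ι → ℤ}
    (hf : Function.Injective f) :
    ∑' k, wave x (a + f k) * conj (wave x (b + f k))
      = ((∑' k, besselJ (a + f k) x * besselJ (b + f k) x
          + ∑' k, besselJ (a - 1 + f k) x * besselJ (b - 1 + f k) x : ℝ) : ℂ)
        + I * ((∑' k, besselJ (a + f k) x * besselJ (b - 1 + f k) x
          - ∑' k, besselJ (a - 1 + f k) x * besselJ (b + f k) x : ℝ) : ℂ) := by
  have summable_mul := fun a b => summable_besselJ_mul_besselJ x a b hf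
  have summable_re := (summable_mul a b).add (summable_mul (a - 1) (b - 1))
  have summable_im := (summable_mul a (b - 1)).sub (summable_mul (a - 1) b)
  rw [← (summable_mul _ _).tsum_add (summable_mul _ _),
    ← (summable_mul _ _).tsum_sub (summable_mul _ _), Complex.ofReal_tsum, Complex.ofReal_tsum,
    ← tsum_mul_left, ← Summable.tsum_add (Complex.summable_ofReal.mpr summable_re)
      ((Complex.summable_ofReal.mpr summable_im).mul_left I)]
  exact tsum_congr fun k => by simp only [wave_mul_conj, sub_add_eq_add_sub]

/-- The overlap of the wave functions `m` and `n` on the right half line, where bond `k ≥ 0`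
carries the amplitude `wave x (2 * m - 1 - k)`. -/
def rightOverlap (x : ℝ) (m n : ℤ) : ℂ :=
  ∑' k : ℕ, wave x (2 * m - 1 - k) * conj (wave x (2 * n - 1 - k))

/-- The overlap of the wave functions `m` and `n` on the left half line, the complement of the
one in `rightOverlap`. -/
def leftOverlap (x : ℝ) (m n : ℤ) : ℂ :=
  ∑' k : ℕ, wave x (2 * m + k) * conj (wave x (2 * n + k))

/-- The limit of the finite-size overlaps: the expectation of the sign of the bond in the
infinite chain. At `x = 4t` it is `δ_{m,n} + K_{m,n}(t)` for `n ≥ 1`. -/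
def limitKernel (x : ℝ) (m n : ℤ) : ℂ := (rightOverlap x m n - leftOverlap x m n) / 2

theorem rightOverlap_add_leftOverlap (x : ℝ) (m n : ℤ) :
    rightOverlap x m n + leftOverlap x m n = 2 * kronecker m n := by
  have tsum_eq_halves := tsum_of_nat_of_neg_add_one
    (f := fun k : ℤ => wave x (2 * m + k) * conj (wave x (2 * n + k)))
    (summable_wave_mul_conj x _ _ Nat.cast_injective)
    (summable_wave_mul_conj x _ _ (f := fun n : ℕ => -((n : ℤ) + 1)) fun a b h => by
      simpa using h)
  have right_eq : rightOverlap x m n = ∑' k : ℕ, wave x (2 * m + -((k : ℤ) + 1))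
      * conj (wave x (2 * n + -((k : ℤ) + 1))) :=
    tsum_congr fun k => by ring_nf
  have tsum_eq := tsum_wave_mul_conj x (2 * m) (2 * n) Function.injective_id
  simp only [id_eq, tsum_besselJ_mul_besselJ, show (2 * m = 2 * n) ↔ m = n by omega,
    show (2 * m - 1 = 2 * n - 1) ↔ m = n by omega, show ¬ (2 * m = 2 * n - 1) by omega,
    show ¬ (2 * m - 1 = 2 * n) by omega, if_false, sub_self, Complex.ofReal_zero, mul_zero,
    add_zero] at tsum_eq
  rw [right_eq, add_comm, leftOverlap, ← tsum_eq_halves, tsum_eq, kronecker]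
  split_ifs <;> norm_num

theorem limitKernel_eq_kronecker_sub (x : ℝ) (m n : ℤ) :
    limitKernel x m n = kronecker m n - leftOverlap x m n := by
  unfold limitKernel
  linear_combination rightOverlap_add_leftOverlap x m n / 2

theorem leftOverlap_eq_besselTail (x : ℝ) (m n : ℤ) :
    leftOverlap x m n
      = ((besselTail x (2 * m) (2 * n) + besselTail x (2 * m - 1) (2 * n - 1) : ℝ) : ℂ)
        + I * ((besselTail x (2 * m) (2 * n - 1) - besselTail x (2 * m - 1) (2 * n) : ℝ) : ℂ) :=
  tsum_wave_mul_conj x (2 * m) (2 * n) Nat.cast_injective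

theorem leftOverlap_eq_neg_kernelK_of_ne (t : ℝ) {m n : ℤ} (h : m ≠ n) :
    leftOverlap (4 * t) m n = -kernelK m n t := by
  have coeff_even : 4 * t / 2 / ((2 * m - 2 * n : ℤ) : ℝ) = t / (m - n) := by
    push_cast
    rw [show 4 * t / 2 = 2 * t by ring, ← mul_sub, mul_div_mul_left _ _ two_ne_zero]
  have coeff_odd : 4 * t / 2 / ((2 * m - 1 - (2 * n - 1) : ℤ) : ℝ) = t / (m - n) := by
    rw [sub_sub_sub_cancel_right, coeff_even]
  have coeff_even_odd : 4 * t / 2 / ((2 * m - (2 * n - 1) : ℤ) : ℝ) = t / (m - n + 1 / 2) := by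
    push_cast
    rw [show 4 * t / 2 = 2 * t by ring,
      show (2 * m - (2 * n - 1) : ℝ) = 2 * (m - n + 1 / 2) by ring,
      mul_div_mul_left _ _ two_ne_zero]
  have coeff_odd_even : 4 * t / 2 / ((2 * m - 1 - 2 * n : ℤ) : ℝ) = t / (m - n - 1 / 2) := by
    push_cast
    rw [show 4 * t / 2 = 2 * t by ring,
      show (2 * m - 1 - 2 * n : ℝ) = 2 * (m - n - 1 / 2) by ring,
      mul_div_mul_left _ _ two_ne_zero]
  rw [leftOverlap_eq_besselTail, besselTail_eq_div _ (show 2 * m ≠ 2 * n by omega),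
    besselTail_eq_div _ (show 2 * m - 1 ≠ 2 * n - 1 by omega),
    besselTail_eq_div _ (show 2 * m ≠ 2 * n - 1 by omega),
    besselTail_eq_div _ (show 2 * m - 1 ≠ 2 * n by omega),
    coeff_even, coeff_odd, coeff_even_odd, coeff_odd_even]
  simp only [besselWronskian, kernelK, h, if_false, show ∀ k : ℤ, k - 1 - 1 = k - 2 by omega]
  push_cast
  ring

theorem leftOverlap_self (t : ℝ) {n : ℤ} (hn : 1 ≤ n) :
    leftOverlap (4 * t) n n = -kernelK n n t := by
  obtain ⟨c, hc⟩ : ∃ c : ℕ, (c : ℤ) = 2 * n - 1 := ⟨(2 * n - 1).toNat, by omega⟩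
  have tail_odd := besselTail_self_nat (4 * t) c
  have tail_even := besselTail_self_nat (4 * t) (c + 1)
  rw [Finset.sum_range_succ, Nat.cast_succ, hc, sub_add_cancel] at tail_even
  rw [hc] at tail_odd
  have tails_eq : besselTail (4 * t) (2 * n) (2 * n) + besselTail (4 * t) (2 * n - 1) (2 * n - 1)
      = -(-1 - besselJ 0 (4 * t) ^ 2 + besselJ (2 * n - 1) (4 * t) ^ 2
        + 2 * ∑ j ∈ Finset.range c, besselJ j (4 * t) ^ 2) := by
    linarith [two_mul_besselTail_zero_zero (4 * t)]
  rw [leftOverlap_eq_besselTail, besselTail_comm _ (2 * n - 1) (2 * n), sub_self, tails_eq]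
  simp only [kernelK, if_true, ← hc, Int.toNat_natCast]
  push_cast
  ring

theorem limitKernel_of_ne (t : ℝ) {m n : ℤ} (h : m ≠ n) :
    limitKernel (4 * t) m n = kernelK m n t := by
  simp [limitKernel_eq_kronecker_sub, leftOverlap_eq_neg_kernelK_of_ne t h, kronecker, h]

theorem limitKernel_eq_kronecker_add_kernelK (t : ℝ) (m : ℤ) {n : ℤ} (hn : 1 ≤ n) :
    limitKernel (4 * t) m n = kronecker m n + kernelK m n t := by
  rcases eq_or_ne m n with rfl | h
  · rw [limitKernel_eq_kronecker_sub, leftOverlap_self t hn, sub_neg_eq_add]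
  · simp [limitKernel_of_ne t h, kronecker, h]

theorem conj_limitKernel (x : ℝ) (m n : ℤ) : conj (limitKernel x m n) = limitKernel x n m := by
  have conj_mul_conj : ∀ z w : ℂ, conj (z * conj w) = w * conj z := fun z w => by
    rw [map_mul, Complex.conj_conj, mul_comm]
  simp only [limitKernel, rightOverlap, leftOverlap, map_div₀, map_sub, map_ofNat,
    Complex.conj_tsum, conj_mul_conj]

theorem wave_one_sub (x : ℝ) (y : ℤ) : wave x (1 - y) = -I * (-1) ^ y * wave x y := by
  have reflect_first : besselJ (1 - y) x = -((-1) ^ y * besselJ (y - 1) x) := by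
    rw [show 1 - y = -(y - 1) by ring, besselJ_neg, zpow_sub_one₀ (by norm_num)]
    norm_num
  have reflect_second : besselJ (1 - y - 1) x = (-1) ^ y * besselJ y x := by
    rw [show 1 - y - 1 = -y by ring, besselJ_neg]
  simp only [wave, reflect_first, reflect_second]
  push_cast
  linear_combination (-((-1) ^ y * besselJ (y - 1) x) : ℂ) * Complex.I_sq

theorem wave_one_sub_mul_conj (x : ℝ) (a b k : ℤ) :
    wave x (1 - (2 * a + k)) * conj (wave x (1 - (2 * b + k)))
      = wave x (2 * a + k) * conj (wave x (2 * b + k)) := by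
  have parity : ∀ a : ℤ, ((-1 : ℂ)) ^ (2 * a + k) = (-1) ^ k := fun a => by
    rw [zpow_add₀ (by norm_num), zpow_mul]
    norm_num
  have sign_mul_sign : ((-1 : ℂ)) ^ k * (-1) ^ k = 1 := by
    rw [← mul_zpow]
    norm_num
  simp only [wave_one_sub, parity, map_mul, map_neg, map_zpow₀, map_one, Complex.conj_I]
  linear_combination (-(wave x (2 * a + k) * conj (wave x (2 * b + k)))
    * ((-1 : ℂ) ^ k * (-1) ^ k)) * Complex.I_sq
    + (wave x (2 * a + k) * conj (wave x (2 * b + k))) * sign_mul_sign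

theorem rightOverlap_one_sub (x : ℝ) (m n : ℤ) :
    rightOverlap x (1 - m) (1 - n) = leftOverlap x m n :=
  tsum_congr fun k => by
    rw [← wave_one_sub_mul_conj x m n k]
    ring_nf

/-- The reflection of the chain exchanges the two half lines. -/
theorem limitKernel_one_sub (x : ℝ) (m n : ℤ) :
    limitKernel x (1 - m) (1 - n) = -limitKernel x m n := by
  have left_eq : leftOverlap x (1 - m) (1 - n) = rightOverlap x m n := by
    simpa only [sub_sub_cancel] using (rightOverlap_one_sub x (1 - m) (1 - n)).symm
  rw [limitKernel, rightOverlap_one_sub, left_eq, limitKernel]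
  ring

end LimitKernel

/-! ### Wave functions on a twisted ring -/

section TwistedRing

/-- The Bessel functions folded onto a ring of `N` bonds by the method of images, a turn around
the ring contributing the twist `ζ`. -/
def ringBessel (N : ℕ) (ζ x : ℝ) (y : ℤ) : ℝ := ∑' l : ℤ, ζ ^ l * besselJ (y + l * N) x

theorem abs_zpow_eq_one {ζ : ℝ} (hζ : ζ ^ 2 = 1) (l : ℤ) : |ζ ^ l| = 1 := by
  rcases mul_self_eq_one_iff.mp (sq ζ ▸ hζ) with rfl | rfl <;> simp [abs_zpow]

theorem injective_add_mul {N : ℕ} (hN : 0 < N) (y : ℤ) :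
    Function.Injective fun l : ℤ => y + l * N := fun a b h => by
  simpa [hN.ne'] using h

theorem norm_zpow_mul_besselJ {ζ : ℝ} (hζ : ζ ^ 2 = 1) (l k : ℤ) (x : ℝ) :
    ‖ζ ^ l * besselJ k x‖ = |besselJ k x| := by
  rw [norm_mul, Real.norm_eq_abs, abs_zpow_eq_one hζ, one_mul, Real.norm_eq_abs]

theorem summable_ringBessel {N : ℕ} (hN : 0 < N) {ζ : ℝ} (hζ : ζ ^ 2 = 1) (x : ℝ) (y : ℤ) :
    Summable fun l : ℤ => ζ ^ l * besselJ (y + l * N) x :=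
  Summable.of_norm_bounded ((summable_besselJ x).abs.comp_injective (injective_add_mul hN y))
    fun l => (norm_zpow_mul_besselJ hζ l _ x).le

theorem ringBessel_sub_period (N : ℕ) {ζ : ℝ} (hζ : ζ ≠ 0) (x : ℝ) (y : ℤ) :
    ringBessel N ζ x (y - N) = ζ * ringBessel N ζ x y := by
  unfold ringBessel
  rw [← tsum_mul_left, ← (Equiv.addRight (1 : ℤ)).tsum_eq]
  refine tsum_congr fun l => ?_
  rw [Equiv.coe_addRight, zpow_add_one₀ hζ, show y - N + (l + 1) * (N : ℤ) = y + l * N by ring]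
  ring

theorem ringBessel_zero_right {N : ℕ} {ζ : ℝ} {y : ℤ} (hy : |y| < N) :
    ringBessel N ζ 0 y = if y = 0 then 1 else 0 := by
  unfold ringBessel
  rw [tsum_eq_single 0 fun l hl => ?_]
  · simp [besselJ_zero_right]
  · rw [besselJ_zero_right, if_neg, mul_zero]
    intro image_eq_zero
    have abs_y : |y| = |l| * N := by
      rw [eq_neg_of_add_eq_zero_left image_eq_zero, abs_neg, abs_mul, Nat.abs_cast]
    nlinarith [Int.one_le_abs hl]

theorem hasDerivAt_ringBessel {N : ℕ} (hN : 0 < N) {ζ : ℝ} (hζ : ζ ^ 2 = 1) (x : ℝ) (y : ℤ) :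
    HasDerivAt (fun x => ringBessel N ζ x y)
      ((ringBessel N ζ x (y - 1) - ringBessel N ζ x (y + 1)) / 2) x := by
  obtain ⟨C, -, bound⟩ := exists_besselJ_le_decay (|x| + 1)
  have summable_bound : ∀ a : ℤ, Summable fun l : ℤ => C * decay (a + l * N) := fun a =>
    (summable_decay.comp_injective (injective_add_mul hN a)).mul_left C
  have shift : ∀ l : ℤ, y + l * N - 1 = y - 1 + l * N ∧ y + l * N + 1 = y + 1 + l * N :=
    fun l => ⟨by ring, by ring⟩
  have hasDerivAt_tsum := hasDerivAt_tsum_of_isPreconnected (t := Metric.ball x 1)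
    (g := fun (l : ℤ) x => ζ ^ l * besselJ (y + l * N) x)
    (g' := fun (l : ℤ) x => ζ ^ l * ((besselJ (y + l * N - 1) x - besselJ (y + l * N + 1) x) / 2))
    (((summable_bound (y - 1)).add (summable_bound (y + 1))).mul_right 2⁻¹) Metric.isOpen_ball
    (convex_ball x 1).isPreconnected
    (fun l s _ => (hasDerivAt_besselJ _ s).const_mul _) (fun l s hs => ?_)
    (Metric.mem_ball_self one_pos) (summable_ringBessel hN hζ x y) (Metric.mem_ball_self one_pos)
  · refine hasDerivAt_tsum.congr_deriv ?_
    unfold ringBessel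
    rw [← (summable_ringBessel hN hζ x (y - 1)).tsum_sub (summable_ringBessel hN hζ x (y + 1)),
      ← tsum_div_const]
    refine tsum_congr fun l => ?_
    rw [(shift l).1, (shift l).2]
    ring
  · have abs_s_le : |s| ≤ |x| + 1 := by
      have : |s - x| < 1 := by simpa [Real.dist_eq] using hs
      linarith [abs_sub_abs_le_abs_sub s x]
    rw [norm_mul, Real.norm_eq_abs, abs_zpow_eq_one hζ, one_mul, norm_div, Real.norm_ofNat,
      div_eq_mul_inv, (shift l).1, (shift l).2]
    gcongr
    exact (norm_sub_le _ _).trans (add_le_add (bound _ _ abs_s_le) (bound _ _ abs_s_le))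

/-- Up to `c`, a point of the fundamental domain of the ring is the closest to the origin among
its images. -/
theorem decay_image_le {N c : ℕ} {y : ℤ} (hy : 2 * |y| ≤ N + 2 * c) (l : ℤ) :
    decay (y + l * N) ≤ (1 + 2 * c) ^ 2 * decay y := by
  have abs_le_image : |y| ≤ |y + l * N| + 2 * c := by
    rcases eq_or_ne l 0 with rfl | hl
    · simp
    · have period_le : (N : ℤ) ≤ |l * N| := by
        rw [abs_mul, Nat.abs_cast]
        nlinarith [Int.one_le_abs hl]
      have : |l * (N : ℤ)| ≤ |y + l * N| + |y| := by simpa using abs_sub (y + l * (N : ℤ)) y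
      omega
  have abs_le_image' : |(y : ℝ)| ≤ |((y + l * N : ℤ) : ℝ)| + 2 * c := mod_cast abs_le_image
  have : (0 : ℝ) ≤ (c : ℝ) * |((y + l * N : ℤ) : ℝ)| := by positivity
  exact decay_le_mul_decay (by linarith)

theorem exists_ringBessel_le_decay (X : ℝ) : ∃ C : ℝ, 0 ≤ C ∧
    ∀ (N : ℕ) (ζ x : ℝ) (y : ℤ) (c : ℕ), 0 < N → ζ ^ 2 = 1 → |x| ≤ X → 2 * |y| ≤ N + 2 * c →
      |ringBessel N ζ x y| ≤ C * (1 + 2 * c) ^ 2 * decay y := by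
  obtain ⟨C, hC, bound⟩ := exists_besselJ_le_decay_sq X
  have tsum_decay_nonneg : 0 ≤ ∑' k, decay k := tsum_nonneg fun k => (decay_pos k).le
  refine ⟨C * ∑' k, decay k, by positivity, fun N ζ x y c hN hζ hx hy => ?_⟩
  have tsum_images_le : ∑' l : ℤ, decay (y + l * N) ≤ ∑' k, decay k :=
    tsum_comp_le_tsum_of_inj summable_decay (fun k => (decay_pos k).le) (injective_add_mul hN y)
  have term_le : ∀ l : ℤ, ‖ζ ^ l * besselJ (y + l * N) x‖
      ≤ C * (1 + 2 * c) ^ 2 * decay y * decay (y + l * N) := fun l => by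
    have decay_nonneg := (decay_pos (y + l * N)).le
    calc ‖ζ ^ l * besselJ (y + l * N) x‖ ≤ C * decay (y + l * N) ^ 2 :=
          (norm_zpow_mul_besselJ hζ l _ x).trans_le (bound _ _ hx)
      _ = C * decay (y + l * N) * decay (y + l * N) := by ring
      _ ≤ C * ((1 + 2 * c) ^ 2 * decay y) * decay (y + l * N) := by
          gcongr
          exact decay_image_le hy l
      _ = C * (1 + 2 * c) ^ 2 * decay y * decay (y + l * N) := by ring
  have decay_nonneg := (decay_pos y).le
  calc |ringBessel N ζ x y|
      ≤ ∑' l : ℤ, C * (1 + 2 * c) ^ 2 * decay y * decay (y + l * N) :=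
        tsum_of_norm_bounded
          ((summable_decay.comp_injective (injective_add_mul hN y)).mul_left _).hasSum term_le
    _ = C * (1 + 2 * c) ^ 2 * decay y * ∑' l : ℤ, decay (y + l * N) := tsum_mul_left
    _ ≤ C * (1 + 2 * c) ^ 2 * decay y * ∑' k, decay k := by gcongr
    _ = C * (∑' k, decay k) * (1 + 2 * c) ^ 2 * decay y := by ring

theorem tendsto_ringBessel {ζ : ℕ → ℝ} (hζ : ∀ N, ζ N ^ 2 = 1) (x : ℝ) (y : ℤ) :
    Tendsto (fun N => ringBessel N (ζ N) x y) atTop (𝓝 (besselJ y x)) := by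
  obtain ⟨C, hC, bound⟩ := exists_besselJ_le_decay |x|
  rw [show besselJ y x = ∑' l : ℤ, if l = 0 then besselJ y x else 0 by simp]
  refine tendsto_tsum_of_dominated_convergence
    (bound := fun l => C * ((1 + |(y : ℝ)|) ^ 2 * decay l))
    ((summable_decay.mul_left _).mul_left _) (fun l => ?_) ?_
  · rcases eq_or_ne l 0 with rfl | hl
    · simp
    · have image_tendsto : Tendsto (fun N : ℕ => y + l * (N : ℤ)) atTop cofinite := by
        rw [← Nat.cofinite_eq_atTop]
        refine Function.Injective.tendsto_cofinite fun a b hab => ?_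
        simpa [hl] using hab
      rw [if_neg hl, tendsto_zero_iff_norm_tendsto_zero]
      simpa only [Function.comp_def, norm_zpow_mul_besselJ (hζ _), abs_zero] using
        ((summable_besselJ x).tendsto_cofinite_zero.comp image_tendsto).abs
  · filter_upwards [eventually_ge_atTop 1] with N hN l
    refine (norm_zpow_mul_besselJ (hζ N) l _ x).trans_le ((bound _ _ le_rfl).trans ?_)
    gcongr
    rw [add_comm]
    refine (decay_add_le _ _).trans ?_
    gcongr
    refine decay_le_decay ?_
    rw [abs_mul, Nat.abs_cast]
    exact le_mul_of_one_le_right (abs_nonneg _) (mod_cast hN)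

/-- The wave function `wave` on a ring of `N` bonds with twist `ζ`. -/
def ringWave (N : ℕ) (ζ x : ℝ) (y : ℤ) : ℂ :=
  ringBessel N ζ x y - I * ringBessel N ζ x (y - 1)

theorem norm_ringWave_le (N : ℕ) (ζ x : ℝ) (y : ℤ) :
    ‖ringWave N ζ x y‖ ≤ |ringBessel N ζ x y| + |ringBessel N ζ x (y - 1)| := by
  refine (norm_sub_le _ _).trans ?_
  simp

theorem ringWave_sub_period (N : ℕ) {ζ : ℝ} (hζ : ζ ≠ 0) (x : ℝ) (y : ℤ) :
    ringWave N ζ x (y - N) = ζ * ringWave N ζ x y := by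
  unfold ringWave
  rw [sub_right_comm, ringBessel_sub_period N hζ, ringBessel_sub_period N hζ]
  push_cast
  ring

theorem hasDerivAt_ringWave {N : ℕ} (hN : 0 < N) {ζ : ℝ} (hζ : ζ ^ 2 = 1) (x : ℝ) (y : ℤ) :
    HasDerivAt (fun x => ringWave N ζ x y)
      ((ringWave N ζ x (y - 1) - ringWave N ζ x (y + 1)) / 2) x := by
  refine ((hasDerivAt_ringBessel hN hζ x y).ofReal_comp.sub
    ((hasDerivAt_ringBessel hN hζ x (y - 1)).ofReal_comp.const_mul I)).congr_deriv ?_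
  unfold ringWave
  rw [add_sub_cancel_right, sub_add_cancel]
  push_cast
  ring

theorem ringWave_zero_right {N : ℕ} {ζ : ℝ} {y : ℤ} (hy : -N + 1 < y) (hyN : y < N) :
    ringWave N ζ 0 y = if y = 0 then 1 else if y = 1 then -I else 0 := by
  unfold ringWave
  rw [ringBessel_zero_right (abs_lt.mpr ⟨by linarith, hyN⟩),
    ringBessel_zero_right (abs_lt.mpr ⟨by linarith, by linarith⟩)]
  simp only [sub_eq_zero]
  split_ifs <;> first | omega | simp

theorem exists_ringWave_le_decay (X : ℝ) : ∃ C : ℝ, 0 ≤ C ∧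
    ∀ (N : ℕ) (ζ x : ℝ) (y : ℤ) (c : ℕ), 0 < N → ζ ^ 2 = 1 → |x| ≤ X → 2 * |y| ≤ N + 2 * c →
      ‖ringWave N ζ x y‖ ≤ C * (3 + 2 * c) ^ 2 * decay y := by
  obtain ⟨C, hC, bound⟩ := exists_ringBessel_le_decay X
  refine ⟨5 * C, by positivity, fun N ζ x y c hN hζ hx hy => ?_⟩
  have bound_y := bound N ζ x y (c + 1) hN hζ hx (by push_cast; linarith)
  have bound_y_sub_one := bound N ζ x (y - 1) (c + 1) hN hζ hx (by
    have := abs_sub y 1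
    rw [abs_one] at this
    push_cast
    linarith)
  have decay_sub_one_le : decay (y - 1) ≤ 4 * decay y := by
    have := decay_add_le y (-1)
    norm_num at this
    exact this
  have constant_eq : 1 + 2 * ((c + 1 : ℕ) : ℝ) = 3 + 2 * c := by push_cast; ring
  rw [constant_eq] at bound_y bound_y_sub_one
  calc ‖ringWave N ζ x y‖
      ≤ |ringBessel N ζ x y| + |ringBessel N ζ x (y - 1)| := norm_ringWave_le _ _ _ _
    _ ≤ C * (3 + 2 * c) ^ 2 * decay y + C * (3 + 2 * c) ^ 2 * (4 * decay y) :=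
        add_le_add bound_y (bound_y_sub_one.trans (by gcongr))
    _ = 5 * C * (3 + 2 * c) ^ 2 * decay y := by ring

theorem tendsto_ringWave {ζ : ℕ → ℝ} (hζ : ∀ N, ζ N ^ 2 = 1) (x : ℝ) (y : ℤ) :
    Tendsto (fun N => ringWave N (ζ N) x y) atTop (𝓝 (wave x y)) :=
  ((Complex.continuous_ofReal.tendsto _).comp (tendsto_ringBessel hζ x y)).sub
    (((Complex.continuous_ofReal.tendsto _).comp (tendsto_ringBessel hζ x (y - 1))).const_mul I)

end TwistedRing

/-! ### Overlaps of wave functions with opposite twists -/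

section Overlap

theorem ne_zero_of_sq_eq_one {ζ : ℝ} (hζ : ζ ^ 2 = 1) : ζ ≠ 0 := by
  rintro rfl
  norm_num at hζ

/-- The overlaps on a ring of `N` bonds between wave functions of twists `-ζ` and `ζ`; the limit
`N → ∞` is `limitKernel`. -/
def overlapN (N : ℕ) (ζ x : ℝ) (m n : ℤ) : ℂ :=
  (∑ k ∈ Finset.range N, ringWave N (-ζ) x (2 * m - 1 - k)
    * conj (ringWave N ζ x (2 * n - 1 - k))) / 2

theorem overlapN_sub_left {M : ℕ} {ζ : ℝ} (hζ : ζ ≠ 0) (x : ℝ) (m n : ℤ) :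
    overlapN (2 * M) ζ x (m - M) n = -ζ * overlapN (2 * M) ζ x m n := by
  unfold overlapN
  rw [← mul_div_assoc, Finset.mul_sum]
  congr 1
  refine Finset.sum_congr rfl fun k _ => ?_
  rw [show 2 * (m - M) - 1 - (k : ℤ) = 2 * m - 1 - k - (2 * M : ℕ) by push_cast; ring,
    ringWave_sub_period (2 * M) (neg_ne_zero.mpr hζ)]
  push_cast
  ring

theorem overlapN_sub_right {M : ℕ} {ζ : ℝ} (hζ : ζ ≠ 0) (x : ℝ) (m n : ℤ) :
    overlapN (2 * M) ζ x m (n - M) = ζ * overlapN (2 * M) ζ x m n := by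
  unfold overlapN
  rw [← mul_div_assoc, Finset.mul_sum]
  congr 1
  refine Finset.sum_congr rfl fun k _ => ?_
  rw [show 2 * (n - M) - 1 - (k : ℤ) = 2 * n - 1 - k - (2 * M : ℕ) by push_cast; ring,
    ringWave_sub_period (2 * M) hζ, map_mul, Complex.conj_ofReal]
  ring

theorem ringWave_mul_conj_sub_period (N : ℕ) {ζ : ℝ} (hζ : ζ ^ 2 = 1) (x : ℝ) (a b : ℤ) :
    ringWave N (-ζ) x (a - N) * conj (ringWave N ζ x (b - N))
      = -(ringWave N (-ζ) x a * conj (ringWave N ζ x b)) := by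
  have ζ_ne_zero := ne_zero_of_sq_eq_one hζ
  have ζ_sq : (ζ : ℂ) ^ 2 = 1 := mod_cast hζ
  rw [ringWave_sub_period N (neg_ne_zero.mpr ζ_ne_zero), ringWave_sub_period N ζ_ne_zero, map_mul,
    Complex.conj_ofReal]
  push_cast
  linear_combination (-(ringWave N (-ζ) x a * conj (ringWave N ζ x b))) * ζ_sq

/-- Transporting the far half of the ring across the twist turns it into the left half line, with
a sign because the two twists are opposite. -/
theorem overlapN_eq_sub (M : ℕ) {ζ : ℝ} (hζ : ζ ^ 2 = 1) (x : ℝ) (m n : ℤ) :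
    overlapN (2 * M) ζ x m n
      = (∑ k ∈ Finset.range M, ringWave (2 * M) (-ζ) x (2 * m - 1 - k)
          * conj (ringWave (2 * M) ζ x (2 * n - 1 - k))
        - ∑ k ∈ Finset.range M, ringWave (2 * M) (-ζ) x (2 * m + k)
          * conj (ringWave (2 * M) ζ x (2 * n + k))) / 2 := by
  unfold overlapN
  congr 1
  nth_rewrite 1 [two_mul]
  rw [Finset.sum_range_add, sub_eq_add_neg (∑ k ∈ Finset.range M, _), ← Finset.sum_neg_distrib,
    ← Finset.sum_range_reflect (fun k : ℕ => ringWave (2 * M) (-ζ) x (2 * m - 1 - (M + k : ℕ))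
          * conj (ringWave (2 * M) ζ x (2 * n - 1 - (M + k : ℕ))))]
  congr 1
  refine Finset.sum_congr rfl fun k hk => ?_
  have reflected : ((M + (M - 1 - k) : ℕ) : ℤ) = 2 * M - 1 - k := by
    have := Finset.mem_range.mp hk
    omega
  rw [← ringWave_mul_conj_sub_period (2 * M) hζ, reflected,
    show 2 * m - 1 - (2 * M - 1 - k : ℤ) = 2 * m + k - (2 * M : ℕ) by push_cast; ring,
    show 2 * n - 1 - (2 * M - 1 - k : ℤ) = 2 * n + k - (2 * M : ℕ) by push_cast; ring]

theorem exists_ringWave_mul_conj_le (x : ℝ) (a b : ℤ) {ε : ℤ} (hε : |ε| = 1) :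
    ∃ C : ℝ, 0 ≤ C ∧ ∀ (M k : ℕ) (ζ : ℝ), ζ ^ 2 = 1 → k < M →
      ‖ringWave (2 * M) (-ζ) x (a + ε * k) * conj (ringWave (2 * M) ζ x (b + ε * k))‖
        ≤ C * decay (a + ε * k) := by
  obtain ⟨C, hC, bound⟩ := exists_ringWave_le_decay |x|
  refine ⟨C * (3 + 2 * (a.natAbs : ℝ)) ^ 2 * (C * (3 + 2 * (b.natAbs : ℝ)) ^ 2), by positivity,
    fun M k ζ hζ hk => ?_⟩
  have two_mul_abs_le : ∀ y : ℤ, 2 * |y + ε * k| ≤ (2 * M : ℕ) + 2 * (y.natAbs : ℤ) := fun y => by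
    have := abs_add_le y (ε * k)
    rw [abs_mul, hε, one_mul, Nat.abs_cast] at this
    push_cast
    omega
  have bound_left := bound (2 * M) (-ζ) x (a + ε * k) a.natAbs (by omega) (by rwa [neg_sq])
    le_rfl (two_mul_abs_le a)
  have bound_right := (bound (2 * M) ζ x (b + ε * k) b.natAbs (by omega) hζ le_rfl
    (two_mul_abs_le b)).trans (mul_le_of_le_one_right (by positivity) (decay_le_one _))
  rw [norm_mul, RCLike.norm_conj]
  have decay_nonneg := (decay_pos (a + ε * k)).le
  refine (mul_le_mul bound_left bound_right (norm_nonneg _) (by positivity)).trans_eq ?_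
  ring

theorem tendsto_sum_ringWave_mul_conj {ζ : ℕ → ℝ} (hζ : ∀ N, ζ N ^ 2 = 1) (x : ℝ) (a b : ℤ)
    {ε : ℤ} (hε : |ε| = 1) :
    Tendsto (fun M : ℕ => ∑ k ∈ Finset.range M, ringWave (2 * M) (-ζ (2 * M)) x (a + ε * k)
        * conj (ringWave (2 * M) (ζ (2 * M)) x (b + ε * k))) atTop
      (𝓝 (∑' k : ℕ, wave x (a + ε * k) * conj (wave x (b + ε * k)))) := by
  obtain ⟨C, hC, bound⟩ := exists_ringWave_mul_conj_le x a b hε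
  have two_mul_tendsto : Tendsto (fun M : ℕ => 2 * M) atTop atTop :=
    tendsto_id.const_mul_atTop' two_pos
  have ε_ne_zero : ε ≠ 0 := by rintro rfl; simp at hε
  have sum_eq_tsum : ∀ (M : ℕ) (f : ℕ → ℂ),
      ∑ k ∈ Finset.range M, f k = ∑' k, if k < M then f k else 0 := fun M f => by
    rw [tsum_eq_sum (s := Finset.range M) fun k hk => if_neg (by simpa using hk)]
    exact Finset.sum_congr rfl fun k hk => (if_pos (Finset.mem_range.mp hk)).symm
  simp only [sum_eq_tsum]
  refine tendsto_tsum_of_dominated_convergence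
    (bound := fun k : ℕ => C * decay (a + ε * k)) ?_ (fun k => ?_) ?_
  · exact (summable_decay.comp_injective (i := fun k : ℕ => a + ε * (k : ℤ)) fun j k h => by
      simpa [ε_ne_zero] using h).mul_left C
  · have left_tendsto := (tendsto_ringWave (ζ := fun N => -ζ N) (fun N => by rw [neg_sq, hζ]) x
      (a + ε * k)).comp two_mul_tendsto
    have right_tendsto := (Complex.continuous_conj.tendsto _).comp
      ((tendsto_ringWave hζ x (b + ε * k)).comp two_mul_tendsto)
    refine (left_tendsto.mul right_tendsto).congr' ?_
    filter_upwards [eventually_gt_atTop k] with M hM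
    simp [hM]
  · refine Eventually.of_forall fun M k => ?_
    split_ifs with hk
    · exact bound M k _ (hζ _) hk
    · rw [norm_zero]
      exact mul_nonneg hC (decay_pos _).le

theorem tendsto_overlapN {ζ : ℕ → ℝ} (hζ : ∀ N, ζ N ^ 2 = 1) (x : ℝ) (m n : ℤ) :
    Tendsto (fun M : ℕ => overlapN (2 * M) (ζ (2 * M)) x m n) atTop
      (𝓝 (limitKernel x m n)) := by
  have right_tendsto := tendsto_sum_ringWave_mul_conj hζ x (2 * m - 1) (2 * n - 1)
    (show |(-1 : ℤ)| = 1 by simp)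
  have left_tendsto := tendsto_sum_ringWave_mul_conj hζ x (2 * m) (2 * n) (abs_one (α := ℤ))
  simp only [neg_one_mul, one_mul, ← sub_eq_add_neg] at right_tendsto left_tendsto
  exact ((right_tendsto.sub left_tendsto).div_const 2).congr fun M =>
    (overlapN_eq_sub M (hζ _) x m n).symm

/-- Under the flow the overlap density obeys a continuity equation, and the current across the
cut is all that is left after summing over the ring. -/
theorem hasDerivAt_overlapN {N : ℕ} (hN : 0 < N) {ζ : ℝ} (hζ : ζ ^ 2 = 1) (x : ℝ) (m n : ℤ) :
    HasDerivAt (fun x => overlapN N ζ x m n)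
      (-(ringWave N (-ζ) x (2 * m - 1) * conj (ringWave N ζ x (2 * n))
        + ringWave N (-ζ) x (2 * m) * conj (ringWave N ζ x (2 * n - 1))) / 2) x := by
  let current : ℤ → ℂ := fun k =>
    ringWave N (-ζ) x (2 * m - 1 - k) * conj (ringWave N ζ x (2 * n - k))
      + ringWave N (-ζ) x (2 * m - k) * conj (ringWave N ζ x (2 * n - 1 - k))
  have current_period : current N = -current 0 := by
    simp only [current, ringWave_mul_conj_sub_period N hζ, sub_zero]
    ring
  have sum_current : ∑ k ∈ Finset.range N, (current (k + 1 : ℕ) - current k) = -2 * current 0 := by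
    rw [Finset.sum_range_sub (fun k : ℕ => current k), current_period, Nat.cast_zero]
    ring
  have continuity : ∀ k : ℕ,
      (ringWave N (-ζ) x (2 * m - 1 - k - 1) - ringWave N (-ζ) x (2 * m - 1 - k + 1)) / 2
          * conj (ringWave N ζ x (2 * n - 1 - k))
        + ringWave N (-ζ) x (2 * m - 1 - k)
          * star ((ringWave N ζ x (2 * n - 1 - k - 1) - ringWave N ζ x (2 * n - 1 - k + 1)) / 2)
        = (current (k + 1 : ℕ) - current k) / 2 := fun k => by
    have shift : ∀ a : ℤ, a - (k + 1) = a - 1 - k ∧ a - 1 - k - 1 = a - 1 - (k + 1)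
        ∧ a - 1 - k + 1 = a - k := fun a => ⟨by ring, by ring, by ring⟩
    simp only [current, Nat.cast_succ, shift, star_div₀, star_sub, RCLike.star_def, map_ofNat]
    ring
  refine ((HasDerivAt.fun_sum fun k (_ : k ∈ Finset.range N) =>
    (hasDerivAt_ringWave hN (by rwa [neg_sq] : (-ζ) ^ 2 = 1) x (2 * m - 1 - k)).mul
      (hasDerivAt_ringWave hN hζ x (2 * n - 1 - k)).star).div_const 2).congr_deriv ?_
  refine (congrArg (· / 2) (Finset.sum_congr rfl fun k _ => continuity k)).trans ?_
  rw [← Finset.sum_div, sum_current]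
  simp only [current, sub_zero]
  ring

theorem overlapN_zero_of_mem {M : ℕ} {ζ : ℝ} {m n : ℤ} (hm : 1 ≤ m) (hmM : m ≤ M)
    (hn : 1 ≤ n) (hnM : n ≤ M) : overlapN (2 * M) ζ 0 m n = kronecker m n := by
  obtain ⟨i, rfl⟩ : ∃ i : ℕ, m = i + 1 := ⟨(m - 1).toNat, by omega⟩
  have term_eq : ∀ k ∈ Finset.range (2 * M), ringWave (2 * M) (-ζ) 0 (2 * (i + 1) - 1 - k)
      * conj (ringWave (2 * M) ζ 0 (2 * n - 1 - k))
      = (if k = 2 * i + 1 then kronecker (i + 1) n else 0)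
        + (if k = 2 * i then kronecker (i + 1) n else 0) := fun k hk => by
    have hk' := Finset.mem_range.mp hk
    rw [ringWave_zero_right (by push_cast; omega) (by push_cast; omega),
      ringWave_zero_right (by push_cast; omega) (by push_cast; omega), kronecker]
    split_ifs <;> first | omega | simp
  rw [overlapN, Finset.sum_congr rfl term_eq, Finset.sum_add_distrib, Finset.sum_ite_eq',
    Finset.sum_ite_eq', if_pos (Finset.mem_range.mpr (by omega)),
    if_pos (Finset.mem_range.mpr (by omega)), add_self_div_two]

/-- The sign `1` for `m ≥ 1` and `-1` for `m ≤ 0`: the sign of the half line on which the `m`-th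
initial orbital sits. -/
def halfSign (m : ℤ) : ℂ := if 1 ≤ m then 1 else -1

theorem norm_halfSign (m : ℤ) : ‖halfSign m‖ = 1 := by
  unfold halfSign
  split_ifs <;> simp

theorem halfSign_mul_overlapN_zero {M : ℕ} {ζ : ℝ} (hζ : ζ ^ 2 = 1) {m n : ℤ}
    (hm : -M < 2 * m) (hmM : 2 * m ≤ M) (hn : -M < 2 * n) (hnM : 2 * n ≤ M) :
    halfSign m * overlapN (2 * M) ζ 0 m n = kronecker m n := by
  have ζ_ne_zero := ne_zero_of_sq_eq_one hζ
  have ζ_sq : (ζ : ℂ) ^ 2 = 1 := mod_cast hζ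
  have shift_left : ∀ n, overlapN (2 * M) ζ 0 m n = -ζ * overlapN (2 * M) ζ 0 (m + M) n :=
    fun n => by rw [← overlapN_sub_left ζ_ne_zero, add_sub_cancel_right]
  have shift_right : ∀ m, overlapN (2 * M) ζ 0 m n = ζ * overlapN (2 * M) ζ 0 m (n + M) :=
    fun m => by rw [← overlapN_sub_right ζ_ne_zero, add_sub_cancel_right]
  rcases le_or_gt 1 m with m_pos | m_nonpos <;> rcases le_or_gt 1 n with n_pos | n_nonpos
  · rw [halfSign, if_pos m_pos, one_mul,
      overlapN_zero_of_mem m_pos (by omega) n_pos (by omega)]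
  · rw [halfSign, if_pos m_pos, one_mul, shift_right,
      overlapN_zero_of_mem m_pos (by omega) (by omega) (by omega)]
    simp [kronecker, show m ≠ n + M by omega, show m ≠ n by omega]
  · rw [halfSign, if_neg (by omega), shift_left,
      overlapN_zero_of_mem (by omega) (by omega) n_pos (by omega)]
    simp [kronecker, show m + M ≠ n by omega, show m ≠ n by omega]
  · rw [halfSign, if_neg (by omega), shift_left, shift_right,
      overlapN_zero_of_mem (by omega) (by omega) (by omega) (by omega)]
    simp only [kronecker, add_left_inj]
    split_ifs
    · linear_combination ζ_sq
    · simp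

theorem exists_ringWave_window_le (X : ℝ) : ∃ C : ℝ, 0 ≤ C ∧
    ∀ (M : ℕ) (ζ x : ℝ) (m y : ℤ), 0 < M → ζ ^ 2 = 1 → |x| ≤ X → -M < 2 * m → 2 * m ≤ M →
      y = 2 * m ∨ y = 2 * m - 1 → ‖ringWave (2 * M) ζ x y‖ ≤ C * decay m := by
  obtain ⟨C, hC, bound⟩ := exists_ringWave_le_decay X
  refine ⟨C * 5 ^ 2, by positivity, fun M ζ x m y hM hζ hx hm hmM hy => ?_⟩
  have two_mul_abs_le : 2 * |y| ≤ (2 * M : ℕ) + 2 * (1 : ℕ) := by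
    have := abs_le (a := y).mpr ⟨(by omega : -(M + 1 : ℤ) ≤ y), by omega⟩
    push_cast
    omega
  have bound_y := bound (2 * M) ζ x y 1 (by omega) hζ hx two_mul_abs_le
  norm_num at bound_y ⊢
  refine bound_y.trans ?_
  gcongr
  exact decay_le_decay (by simp only [Int.abs_eq_natAbs]; omega)

/-- Integrates `hasDerivAt_overlapN` from the initial value: the current across the cut involves
only wave functions at the position of the cut, where both are small. -/
theorem exists_overlapN_sub_kronecker_le (x : ℝ) : ∃ C : ℝ, 0 ≤ C ∧
    ∀ (M : ℕ) (ζ : ℝ) (m n : ℤ), 0 < M → ζ ^ 2 = 1 →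
      -M < 2 * m → 2 * m ≤ M → -M < 2 * n → 2 * n ≤ M →
        ‖halfSign m * overlapN (2 * M) ζ x m n - kronecker m n‖ ≤ C * decay m * decay n := by
  obtain ⟨C, hC, bound⟩ := exists_ringWave_window_le |x|
  refine ⟨C ^ 2 * |x|, by positivity, fun M ζ m n hM hζ hm hmM hn hnM => ?_⟩
  have deriv_le : ∀ s ∈ Set.uIcc 0 x,
      ‖-(ringWave (2 * M) (-ζ) s (2 * m - 1) * conj (ringWave (2 * M) ζ s (2 * n))
        + ringWave (2 * M) (-ζ) s (2 * m) * conj (ringWave (2 * M) ζ s (2 * n - 1))) / 2‖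
        ≤ C ^ 2 * decay m * decay n := fun s hs => by
    have abs_s_le : |s| ≤ |x| := by simpa using Set.abs_sub_left_of_mem_uIcc hs
    have product_le : ∀ a b : ℤ, a = 2 * m ∨ a = 2 * m - 1 → b = 2 * n ∨ b = 2 * n - 1 →
        ‖ringWave (2 * M) (-ζ) s a * conj (ringWave (2 * M) ζ s b)‖
          ≤ C ^ 2 * decay m * decay n := fun a b ha hb => by
      have decay_nonneg := (decay_pos m).le
      rw [norm_mul, RCLike.norm_conj]
      refine (mul_le_mul (bound M (-ζ) s m a hM (by rwa [neg_sq]) abs_s_le hm hmM ha)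
        (bound M ζ s n b hM hζ abs_s_le hn hnM hb) (norm_nonneg _)
        (by positivity)).trans_eq ?_
      ring
    rw [norm_div, norm_neg, Complex.norm_ofNat, div_le_iff₀ two_pos]
    refine (norm_add_le _ _).trans ?_
    linarith [product_le (2 * m - 1) (2 * n) (by simp) (by simp),
      product_le (2 * m) (2 * n - 1) (by simp) (by simp)]
  have mean_value := (convex_uIcc 0 x).norm_image_sub_le_of_norm_hasDerivWithin_le
    (fun s _ => (hasDerivAt_overlapN (by omega) hζ s m n).hasDerivWithinAt) deriv_le
    Set.left_mem_uIcc Set.right_mem_uIcc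
  rw [sub_zero, Real.norm_eq_abs] at mean_value
  rw [← halfSign_mul_overlapN_zero hζ hm hmM hn hnM, ← mul_sub, norm_mul, norm_halfSign, one_mul]
  linarith

end Overlap

/-! ### The limit of the finite-size matrix -/

section MomentumSums

/-- The `j`-th quasi-momentum with `exp (I * p * N) = exp (I * θ)`, for even `N`. -/
def momentum (N : ℕ) (θ : ℝ) (j : ℕ) : ℝ := -π + (2 * π * j + θ) / N

theorem injective_momentum {N : ℕ} (hN : 0 < N) (θ : ℝ) : Function.Injective (momentum N θ) := by
  intro i j h
  have N_ne_zero : (N : ℝ) ≠ 0 := mod_cast hN.ne'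
  simpa [momentum, div_left_inj' N_ne_zero, Real.pi_ne_zero] using h

theorem exp_momentum_mul {M : ℕ} (hM : 0 < M) (θ : ℝ) (j : ℕ) :
    Complex.exp (I * momentum (2 * M) θ j * (2 * M : ℕ)) = Complex.exp (I * θ) := by
  have M_ne_zero : (M : ℂ) ≠ 0 := mod_cast hM.ne'
  refine Complex.exp_eq_exp_iff_exists_int.mpr ⟨j - M, ?_⟩
  simp only [momentum]
  push_cast
  field_simp
  ring

theorem momentum_mem_Ico {N : ℕ} {θ : ℝ} (hθ : 0 ≤ θ) (hθ' : θ < 2 * π) {j : ℕ} (hj : j < N) :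
    momentum N θ j ∈ Set.Ico (-π) π := by
  have N_pos : (0 : ℝ) < N := mod_cast Nat.zero_lt_of_lt hj
  have j_succ_le : (j : ℝ) + 1 ≤ N := mod_cast hj
  have fraction_nonneg : 0 ≤ (2 * π * j + θ) / N := by positivity
  have fraction_lt : (2 * π * j + θ) / N < 2 * π := by
    rw [div_lt_iff₀ N_pos]
    nlinarith [Real.pi_pos]
  exact ⟨by unfold momentum; linarith, by unfold momentum; linarith⟩

theorem exists_momentum_eq {M : ℕ} {θ p : ℝ} (hθ : 0 ≤ θ) (hθ' : θ < 2 * π)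
    (hp : p ∈ Set.Ico (-π) π)
    (hexp : Complex.exp (I * p * (2 * M : ℕ)) = Complex.exp (I * θ)) (hM : 0 < M) :
    ∃ j < 2 * M, momentum (2 * M) θ j = p := by
  have M_pos : (0 : ℝ) < M := mod_cast hM
  have := Real.pi_pos
  obtain ⟨n, hn⟩ := Complex.exp_eq_exp_iff_exists_int.mp hexp
  have p_eq : p * (2 * M) = θ + n * (2 * π) := by
    have : I * ((p * (2 * M) : ℝ) : ℂ) = I * ((θ + n * (2 * π) : ℝ) : ℂ) := by
      push_cast at hn ⊢
      linear_combination hn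
    exact_mod_cast mul_left_cancel₀ Complex.I_ne_zero this
  have le_n : -(M : ℤ) ≤ n := by
    by_contra! h
    have : (n : ℝ) ≤ -M - 1 := mod_cast (by omega : n ≤ -(M : ℤ) - 1)
    nlinarith [hp.1]
  have n_lt : n < M := by
    by_contra! h
    have : (M : ℝ) ≤ n := mod_cast h
    nlinarith [hp.2]
  obtain ⟨j, hj⟩ := Int.eq_ofNat_of_zero_le (by omega : 0 ≤ n + M)
  have j_eq : (j : ℝ) = n + M := mod_cast hj.symm
  refine ⟨j, by omega, ?_⟩
  rw [momentum, j_eq]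
  push_cast
  field_simp
  linarith

theorem quasiMomenta_eq_image {M : ℕ} (hM : 0 < M) {θ : ℝ} (hθ : 0 ≤ θ) (hθ' : θ < 2 * π) :
    quasiMomenta (2 * M) (Complex.exp (I * θ))
      = momentum (2 * M) θ '' (Finset.range (2 * M) : Set ℕ) := by
  ext p
  simp only [quasiMomenta, Set.mem_ofPred_eq, Set.mem_image, Finset.coe_range, Set.mem_Iio]
  constructor
  · rintro ⟨hp, hexp⟩
    exact exists_momentum_eq hθ hθ' hp hexp hM
  · rintro ⟨j, hj, rfl⟩
    exact ⟨momentum_mem_Ico hθ hθ' hj, exp_momentum_mul hM θ j⟩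

theorem finsum_mem_quasiMomenta {M : ℕ} (hM : 0 < M) {θ : ℝ} (hθ : 0 ≤ θ) (hθ' : θ < 2 * π)
    {E : Type*} [AddCommMonoid E] (f : ℝ → E) :
    ∑ᶠ (p : ℝ) (_ : p ∈ quasiMomenta (2 * M) (Complex.exp (I * θ))), f p
      = ∑ j ∈ Finset.range (2 * M), f (momentum (2 * M) θ j) := by
  rw [quasiMomenta_eq_image hM hθ hθ',
    finsum_mem_image (injective_momentum (by omega) θ).injOn, finsum_mem_coe_finset]

theorem sum_exp_momentum_eq_zero {N : ℕ} (hN : 0 < N) (θ : ℝ) {d : ℤ} (hd : ¬ (N : ℤ) ∣ d) :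
    ∑ j ∈ Finset.range N, Complex.exp (I * (d * momentum N θ j)) = 0 := by
  have N_ne_zero : (N : ℂ) ≠ 0 := mod_cast hN.ne'
  let w : ℂ := Complex.exp (2 * π * I / N) ^ d
  have term_eq : ∀ j : ℕ, Complex.exp (I * (d * momentum N θ j))
      = Complex.exp (I * (d * (-π + θ / N))) * w ^ j := fun j => by
    simp only [w, momentum, ← Complex.exp_int_mul, ← Complex.exp_nat_mul, ← Complex.exp_add]
    congr 1
    push_cast
    field_simp
    ring
  have primitive := Complex.isPrimitiveRoot_exp N hN.ne'
  have w_pow : w ^ N = 1 := by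
    rw [← zpow_natCast, zpow_comm, zpow_natCast, primitive.pow_eq_one, one_zpow]
  have w_ne_one : w ≠ 1 := fun h => hd ((primitive.zpow_eq_one_iff_dvd d).mp h)
  have geom_sum : (w - 1) * ∑ j ∈ Finset.range N, w ^ j = 0 := by
    rw [mul_geom_sum, w_pow, sub_self]
  rw [Finset.sum_congr rfl fun j _ => term_eq j, ← Finset.mul_sum,
    (mul_eq_zero.mp geom_sum).resolve_left (sub_ne_zero.mpr w_ne_one), mul_zero]

/-- The plane wave of momentum `p` on `ℤ`, evolved under the dispersion relation `cos p` for the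
time `x`. -/
def planeWave (x p : ℝ) (y : ℤ) : ℂ := Complex.exp (I * (y * p + x * Real.cos p))

theorem planeWave_sub_one (x p : ℝ) (y : ℤ) :
    planeWave x p (y - 1) = Complex.exp (-(I * p)) * planeWave x p y := by
  rw [planeWave, planeWave, ← Complex.exp_add]
  congr 1
  push_cast
  ring

theorem planeWave_mul_conj_sub (x p q : ℝ) (a b k : ℤ) :
    planeWave x p (a - k) * conj (planeWave x q (b - k))
      = Complex.exp (I * (a * p - b * q + x * (Real.cos p - Real.cos q)))
        * (Complex.exp (I * (p - q)))⁻¹ ^ k := by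
  rw [planeWave, planeWave, ← Complex.exp_conj, ← Complex.exp_neg, ← Complex.exp_int_mul,
    ← Complex.exp_add, ← Complex.exp_add]
  congr 1
  simp only [map_mul, map_add, Complex.conj_I, Complex.conj_ofReal, map_intCast]
  push_cast
  ring

theorem hasSum_planeWave (x p : ℝ) (y : ℤ) :
    HasSum (fun k : ℤ => (besselJ k x : ℂ) * I ^ k * Complex.exp (I * ((y - k : ℤ) * p)))
      (planeWave x p y) := by
  have jacobi_anger := (hasSum_besselJ_mul_exp x (π / 2 - p)).mul_left (Complex.exp (I * (y * p)))
  rw [Real.sin_pi_div_two_sub, ← Complex.exp_add, ← mul_add] at jacobi_anger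
  refine jacobi_anger.congr_fun fun k => ?_
  have I_zpow : I ^ k = Complex.exp (k * (π / 2 * I)) := by
    rw [Complex.exp_int_mul, Complex.exp_pi_div_two_mul_I]
  rw [I_zpow, mul_assoc, ← Complex.exp_add, mul_left_comm (Complex.exp _), ← Complex.exp_add]
  congr 2
  push_cast
  ring

/-- Summing over the momenta of a ring keeps of the Jacobi–Anger expansion only the Bessel
functions whose orders are congruent modulo the length of the ring. -/
theorem sum_planeWave {M : ℕ} (hM : 0 < M) {θ z : ℝ} (hθ : Complex.exp (I * θ) = z)
    (hz : z ^ 2 = 1) (x : ℝ) (y : ℤ) :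
    ∑ j ∈ Finset.range (2 * M), planeWave x (momentum (2 * M) θ j) y
      = (2 * M : ℕ) * (I ^ y * ringBessel (2 * M) ((-1) ^ M * z) x y) := by
  have sign_sq : ((-1) ^ M * z) ^ 2 = 1 := by
    rw [mul_pow, hz, ← pow_mul, pow_mul', neg_one_sq, one_pow, one_mul]
  have z_inv : (z : ℂ)⁻¹ = z := inv_eq_of_mul_eq_one_right (by rw [← sq]; exact_mod_cast hz)
  have expansion := hasSum_sum fun j (_ : j ∈ Finset.range (2 * M)) =>
    hasSum_planeWave x (momentum (2 * M) θ j) y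
  simp only [← Finset.mul_sum] at expansion
  rw [← (injective_add_mul (N := 2 * M) (by omega) y).hasSum_iff] at expansion
  · have bessel_sum := Complex.hasSum_ofReal.mpr
      (summable_ringBessel (N := 2 * M) (by omega) sign_sq x y).hasSum
    refine expansion.unique (((bessel_sum.mul_left (I ^ y)).mul_left _).congr_fun fun l => ?_)
    have exp_eq : ∀ j ∈ Finset.range (2 * M),
        Complex.exp (I * ((y - (y + l * (2 * M : ℕ)) : ℤ) * momentum (2 * M) θ j)) = (z : ℂ) ^ l :=
      fun j _ => by
        rw [show I * (((y - (y + l * (2 * M : ℕ)) : ℤ) : ℂ) * momentum (2 * M) θ j)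
            = ((-l : ℤ) : ℂ) * (I * momentum (2 * M) θ j * (2 * M : ℕ)) by push_cast; ring,
          Complex.exp_int_mul, exp_momentum_mul hM, hθ, zpow_neg, ← inv_zpow, z_inv]
    have I_zpow : I ^ (y + l * ((2 * M : ℕ) : ℤ)) = I ^ y * ((-1) ^ M) ^ l := by
      rw [zpow_add₀ Complex.I_ne_zero, mul_comm l, zpow_mul, zpow_natCast, pow_mul, Complex.I_sq]
    simp only [Function.comp]
    rw [Finset.sum_congr rfl exp_eq, Finset.sum_const, Finset.card_range, nsmul_eq_mul, I_zpow]
    push_cast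
    rw [mul_zpow]
    ring
  · intro k hk
    rw [sum_exp_momentum_eq_zero (by omega), mul_zero]
    rintro ⟨l, hl⟩
    exact hk ⟨-l, by simp only; linarith⟩

theorem sum_planeWave_add_sub_one {M : ℕ} (hM : 0 < M) {θ z : ℝ} (hθ : Complex.exp (I * θ) = z)
    (hz : z ^ 2 = 1) (x : ℝ) (y : ℤ) :
    ∑ j ∈ Finset.range (2 * M),
        (planeWave x (momentum (2 * M) θ j) y + planeWave x (momentum (2 * M) θ j) (y - 1))
      = (2 * M : ℕ) * (I ^ y * ringWave (2 * M) ((-1) ^ M * z) x y) := by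
  rw [Finset.sum_add_distrib, sum_planeWave hM hθ hz, sum_planeWave hM hθ hz,
    zpow_sub_one₀ Complex.I_ne_zero, Complex.inv_I, ringWave]
  ring

theorem inv_sub_one_eq_geom_sum {K : Type*} [Field K] [NeZero (2 : K)] {w : K} {N : ℕ}
    (hw : w ^ N = -1) : (w - 1)⁻¹ = (∑ k ∈ Finset.range N, w⁻¹ ^ (k + 1)) / 2 := by
  have two_ne_zero : (2 : K) ≠ 0 := NeZero.ne 2
  have w_ne_zero : w ≠ 0 := by
    rintro rfl
    rcases eq_or_ne N 0 with rfl | hN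
    · exact two_ne_zero (by linear_combination hw)
    · simp [hN] at hw
  have telescope : (w - 1) * ∑ k ∈ Finset.range N, w⁻¹ ^ (k + 1) = 2 := by
    have term_eq : ∀ k : ℕ, (w - 1) * w⁻¹ ^ (k + 1) = w⁻¹ ^ k - w⁻¹ ^ (k + 1) := fun k => by
      rw [sub_one_mul, pow_succ', ← mul_assoc, mul_inv_cancel₀ w_ne_zero, one_mul]
    rw [Finset.mul_sum, Finset.sum_congr rfl fun k _ => term_eq k,
      Finset.sum_range_sub' fun k => w⁻¹ ^ k, inv_pow w N, hw]
    norm_num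
  refine inv_eq_of_mul_eq_one_right ?_
  rw [mul_div_assoc', telescope, div_self two_ne_zero]

theorem PhiN_summand_eq {N : ℕ} {p q : ℝ} (hp : Complex.exp (I * p * N) = 1)
    (hq : Complex.exp (I * q * N) = -1) (m n : ℤ) (t : ℝ) :
    (1 + Complex.exp (-(I * p))) * (1 + Complex.exp (I * q))
      * Complex.exp (I * (2 * (m * p - n * q) + t * (dispersion p - dispersion q)))
      / (Complex.exp (I * (p - q)) - 1)
    = (∑ k ∈ Finset.range N,
      (planeWave (4 * t) p (2 * m - 1 - k) + planeWave (4 * t) p (2 * m - 1 - k - 1))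
        * conj (planeWave (4 * t) q (2 * n - 1 - k) + planeWave (4 * t) q (2 * n - 1 - k - 1)))
      / 2 := by
  have exp_pow : Complex.exp (I * (p - q)) ^ N = -1 := by
    rw [← Complex.exp_nat_mul, show (N : ℂ) * (I * (p - q)) = I * p * N - I * q * N by ring,
      Complex.exp_sub, hp, hq]
    norm_num
  have phase_eq : I * (((2 * m : ℤ) : ℂ) * p - ((2 * n : ℤ) : ℂ) * q
      + (4 * t : ℝ) * (Real.cos p - Real.cos q))
      = I * (2 * (m * p - n * q) + t * (dispersion p - dispersion q)) := by
    simp only [dispersion]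
    push_cast
    ring
  rw [div_eq_mul_inv, inv_sub_one_eq_geom_sum exp_pow, mul_div_assoc', Finset.mul_sum]
  refine congrArg (· / 2) (Finset.sum_congr rfl fun k _ => ?_)
  have shift := planeWave_mul_conj_sub (4 * t) p q (2 * m) (2 * n) (k + 1)
  rw [phase_eq, ← sub_sub, ← sub_sub, sub_right_comm, sub_right_comm (2 * n), ← Nat.cast_add_one,
    zpow_natCast] at shift
  have exp_conj : conj (Complex.exp (-(I * q))) = Complex.exp (I * q) := by
    simp [← Complex.exp_conj]
  rw [planeWave_sub_one, planeWave_sub_one, map_add, map_mul, exp_conj]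
  linear_combination -(1 + Complex.exp (-(I * p))) * (1 + Complex.exp (I * q)) * shift

theorem I_zpow_mul_conj (a b k : ℤ) :
    I ^ (2 * a - k) * conj (I ^ (2 * b - k)) = (-1) ^ (a - b) := by
  rw [map_zpow₀, Complex.conj_I, ← Complex.inv_I, inv_zpow, ← zpow_neg,
    ← zpow_add₀ Complex.I_ne_zero, show 2 * a - k + -(2 * b - k) = 2 * (a - b) by ring, zpow_mul,
    ← Complex.I_sq, zpow_ofNat]

theorem PhiN_eq_sum_range {M : ℕ} (hM : 0 < M) (m n : ℤ) (t : ℝ) :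
    PhiN (2 * M) m n t = 1 / ((2 * M : ℕ) : ℂ) ^ 2 *
      ∑ i ∈ Finset.range (2 * M), ∑ j ∈ Finset.range (2 * M), (∑ k ∈ Finset.range (2 * M),
        (planeWave (4 * t) (momentum (2 * M) 0 i) (2 * m - 1 - k)
          + planeWave (4 * t) (momentum (2 * M) 0 i) (2 * m - 1 - k - 1))
        * conj (planeWave (4 * t) (momentum (2 * M) π j) (2 * n - 1 - k)
          + planeWave (4 * t) (momentum (2 * M) π j) (2 * n - 1 - k - 1))) / 2 := by
  have exp_zero : Complex.exp (I * (0 : ℝ)) = 1 := by simp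
  have exp_pi : Complex.exp (I * π) = -1 := by rw [mul_comm, Complex.exp_pi_mul_I]
  have finsum_plus : ∀ f : ℝ → ℂ, _ := finsum_mem_quasiMomenta hM (θ := 0) le_rfl (by positivity)
  have finsum_minus : ∀ f : ℝ → ℂ, _ :=
    finsum_mem_quasiMomenta hM Real.pi_pos.le (by linarith [Real.pi_pos])
  rw [exp_zero] at finsum_plus
  rw [exp_pi] at finsum_minus
  simp only [PhiN, finsum_plus, finsum_minus]
  refine congrArg _ (Finset.sum_congr rfl fun i _ => Finset.sum_congr rfl fun j _ => ?_)
  exact PhiN_summand_eq ((exp_momentum_mul hM 0 i).trans exp_zero)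
    ((exp_momentum_mul hM π j).trans exp_pi) m n t

theorem PhiN_eq_overlapN {M : ℕ} (hM : 0 < M) (m n : ℤ) (t : ℝ) :
    PhiN (2 * M) m n t = (-1) ^ (m - n) * overlapN (2 * M) (-(-1) ^ M) (4 * t) m n := by
  have N_ne_zero : ((2 * M : ℕ) : ℂ) ≠ 0 := mod_cast (by omega : 2 * M ≠ 0)
  have sum_plus := sum_planeWave_add_sub_one hM (θ := 0) (z := 1) (by simp) (by norm_num) (4 * t)
  have sum_minus := sum_planeWave_add_sub_one hM (θ := π) (z := -1)
    (by rw [mul_comm, Complex.exp_pi_mul_I]; simp) (by norm_num) (4 * t)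
  have sum_mul_conj : ∀ f g : ℕ → ℕ → ℂ,
      ∑ i ∈ Finset.range (2 * M), ∑ j ∈ Finset.range (2 * M),
        (∑ k ∈ Finset.range (2 * M), f k i * conj (g k j)) / 2
      = (∑ k ∈ Finset.range (2 * M), (∑ i ∈ Finset.range (2 * M), f k i)
        * conj (∑ j ∈ Finset.range (2 * M), g k j)) / 2 := fun f g => by
    simp only [map_sum, Finset.sum_mul_sum, ← Finset.sum_div]
    exact congrArg (· / 2)
      ((Finset.sum_congr rfl fun i _ => Finset.sum_comm).trans Finset.sum_comm)
  rw [PhiN_eq_sum_range hM, sum_mul_conj]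
  simp only [sum_plus, sum_minus, overlapN, map_mul, Complex.conj_natCast, mul_one, mul_neg_one,
    neg_neg]
  rw [mul_div_assoc', mul_div_assoc', Finset.mul_sum, Finset.mul_sum]
  refine congrArg (· / 2) (Finset.sum_congr rfl fun k _ => ?_)
  have I_zpow := I_zpow_mul_conj m n (1 + k)
  rw [← sub_sub, ← sub_sub] at I_zpow
  rw [← I_zpow]
  field_simp

theorem tendsto_PhiN (t : ℝ) (m n : ℤ) :
    Tendsto (fun L : ℕ => PhiN (2 * (L + 1)) m n t) atTop
      (𝓝 ((-1) ^ (m - n) * limitKernel (4 * t) m n)) := by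
  have tendsto_overlap := (tendsto_overlapN (ζ := fun N => -(-1) ^ (N / 2))
    (fun N => by rw [neg_sq, ← pow_mul, pow_mul', neg_one_sq, one_pow]) (4 * t) m n).const_mul
    ((-1 : ℂ) ^ (m - n))
  refine (tendsto_overlap.comp (tendsto_add_atTop_nat 1)).congr fun L => ?_
  rw [PhiN_eq_overlapN (Nat.succ_pos L)]
  simp

end MomentumSums

/-! ### The Hamiltonian in a product basis -/

section ProductBasis

variable {N : ℕ}

theorem tensorOp_mul (A B : Fin N → Matrix (Fin 2) (Fin 2) ℂ) :
    tensorOp A * tensorOp B = tensorOp fun k => A k * B k := by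
  ext s s'
  simp only [tensorOp, Matrix.mul_apply, Matrix.of_apply, ← Finset.prod_mul_distrib]
  rw [Finset.prod_univ_sum, Fintype.piFinset_univ]

theorem tensorOp_one : tensorOp (fun _ : Fin N => 1) = 1 := by
  ext s s'
  simp only [tensorOp, Matrix.of_apply, Matrix.one_apply, Finset.prod_ite_zero,
    Finset.prod_const_one, Finset.mem_univ, true_imp_iff, funext_iff]

theorem conjTranspose_tensorOp (A : Fin N → Matrix (Fin 2) (Fin 2) ℂ) :
    (tensorOp A)ᴴ = tensorOp fun k => (A k)ᴴ := by
  ext s s'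
  simp [tensorOp, Matrix.conjTranspose_apply, star_prod]

theorem tensorOp_mulVec_tensorState (A : Fin N → Matrix (Fin 2) (Fin 2) ℂ)
    (v : Fin N → Fin 2 → ℂ) :
    tensorOp A *ᵥ tensorState v = tensorState fun k => A k *ᵥ v k := by
  ext s
  simp only [tensorOp, tensorState, Matrix.mulVec, dotProduct, Matrix.of_apply,
    ← Finset.prod_mul_distrib]
  rw [Finset.prod_univ_sum, Fintype.piFinset_univ]

theorem tensorState_smul (c : ℂ) (v : Fin N → Fin 2 → ℂ) :
    tensorState (fun k => c • v k) = c ^ N • tensorState v := by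
  ext s
  simp [tensorState, Finset.prod_mul_distrib]

theorem siteOp_mul_tensorOp {A B : Matrix (Fin 2) (Fin 2) ℂ}
    {U : Fin N → Matrix (Fin 2) (Fin 2) ℂ} {n : Fin N} (h : A * U n = U n * B) :
    siteOp A n * tensorOp U = tensorOp U * siteOp B n := by
  rw [siteOp, siteOp, tensorOp_mul, tensorOp_mul]
  congr 1
  funext k
  rcases eq_or_ne k n with rfl | hk
  · simpa using h
  · simp [Function.update_of_ne hk]

theorem commute_siteOp (A B : Matrix (Fin 2) (Fin 2) ℂ) {m n : Fin N} (hmn : m ≠ n) :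
    Commute (siteOp A m) (siteOp B n) :=
  siteOp_mul_tensorOp (by rw [Function.update_of_ne hmn, mul_one, one_mul])

theorem conjTranspose_siteOp (A : Matrix (Fin 2) (Fin 2) ℂ) (n : Fin N) :
    (siteOp A n)ᴴ = siteOp Aᴴ n := by
  rw [siteOp, conjTranspose_tensorOp, siteOp]
  congr 1
  funext k
  rcases eq_or_ne k n with rfl | hk
  · simp
  · simp [Function.update_of_ne hk]

theorem siteOp_apply_update (A : Matrix (Fin 2) (Fin 2) ℂ) (n : Fin N) (s : Config N) (a : Fin 2) :
    siteOp A n s (Function.update s n a) = A (s n) a := by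
  rw [siteOp, tensorOp, Matrix.of_apply, Finset.prod_eq_single_of_mem n (Finset.mem_univ n)]
  · simp
  · intro k _ hk
    simp [Function.update_of_ne hk]

theorem siteOp_apply_eq_zero (A : Matrix (Fin 2) (Fin 2) ℂ) {n k : Fin N} (hkn : k ≠ n)
    {s s' : Config N} (hk : s k ≠ s' k) : siteOp A n s s' = 0 :=
  Finset.prod_eq_zero (Finset.mem_univ k) <| by
    rw [Function.update_of_ne hkn, Matrix.one_apply_ne hk]

theorem siteOp_mulVec (A : Matrix (Fin 2) (Fin 2) ℂ) (n : Fin N) (ψ : Config N → ℂ)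
    (s : Config N) :
    (siteOp A n *ᵥ ψ) s = ∑ a, A (s n) a * ψ (Function.update s n a) := by
  symm
  refine Fintype.sum_of_injective (fun a => Function.update s n a)
    (Function.update_injective s n) _ _ (fun s' hs' => ?_) fun a => ?_
  · obtain ⟨k, hkn, hk⟩ : ∃ k, k ≠ n ∧ s k ≠ s' k := by
      by_contra! h
      exact hs' ⟨s' n, Function.update_eq_iff.mpr ⟨rfl, fun k hk => h k hk⟩⟩
    exact (congrArg (· * ψ s') (siteOp_apply_eq_zero A hkn hk)).trans (zero_mul _)
  · exact congrArg (· * ψ _) (siteOp_apply_update A n s a).symm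

theorem siteOp_neg (A : Matrix (Fin 2) (Fin 2) ℂ) (n : Fin N) : siteOp (-A) n = -siteOp A n := by
  refine Matrix.mulVec_injective (funext₂ fun ψ s => ?_)
  simp only [Matrix.neg_mulVec, Pi.neg_apply, siteOp_mulVec, Matrix.neg_apply, neg_mul,
    Finset.sum_neg_distrib]

theorem conjTranspose_sigmaX : sigmaXᴴ = sigmaX := by
  ext i j
  fin_cases i <;> fin_cases j <;> simp [sigmaX, Matrix.conjTranspose_apply]

theorem conjTranspose_sigmaY : sigmaYᴴ = sigmaY := by
  ext i j
  fin_cases i <;> fin_cases j <;> simp [sigmaY, Matrix.conjTranspose_apply]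

theorem add_one_ne_self_of_two_le [NeZero N] (hN : 2 ≤ N) (n : Fin N) : n + 1 ≠ n := by
  obtain ⟨K, rfl⟩ := Nat.exists_eq_add_of_le' hN
  simp

theorem conjTranspose_hamiltonian [NeZero N] (hN : 2 ≤ N) : (hamiltonian N)ᴴ = hamiltonian N := by
  rw [hamiltonian, Matrix.conjTranspose_sum]
  refine Finset.sum_congr rfl fun n _ => ?_
  have next_ne := add_one_ne_self_of_two_le hN n
  simp only [finRotate_apply, Matrix.conjTranspose_add, Matrix.conjTranspose_mul,
    conjTranspose_siteOp, conjTranspose_sigmaX, conjTranspose_sigmaY]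
  rw [commute_siteOp _ _ next_ne, commute_siteOp _ _ next_ne]

/-- The Pauli matrix `σ^z`. -/
def sigmaZ : Matrix (Fin 2) (Fin 2) ℂ := !![1, 0; 0, -1]

/-- The local change of basis, to the eigenvectors of `σ^x` on even sites and of `σ^y` on odd
sites. In the product of these bases the Hamiltonian moves domain walls. -/
def localBasis (n : ℕ) : Matrix (Fin 2) (Fin 2) ℂ :=
  ((1 / √2 : ℝ) : ℂ) • if Even n then !![1, 1; 1, -1] else !![1, 1; I, -I]

/-- The matrix of `σ^x` in the local basis. -/
def localX (n : ℕ) : Matrix (Fin 2) (Fin 2) ℂ := if Even n then sigmaZ else sigmaY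

/-- The matrix of `σ^y` in the local basis. -/
def localY (n : ℕ) : Matrix (Fin 2) (Fin 2) ℂ := if Even n then -sigmaY else sigmaZ

theorem sigmaX_mul_localBasis (n : ℕ) : sigmaX * localBasis n = localBasis n * localX n := by
  rw [localBasis, localX, Matrix.mul_smul, Matrix.smul_mul]
  congr 1
  split_ifs <;> ext i j <;> fin_cases i <;> fin_cases j <;>
    simp [sigmaX, sigmaY, sigmaZ, Matrix.mul_apply]

theorem sigmaY_mul_localBasis (n : ℕ) : sigmaY * localBasis n = localBasis n * localY n := by
  rw [localBasis, localY, Matrix.mul_smul, Matrix.smul_mul]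
  congr 1
  split_ifs <;> ext i j <;> fin_cases i <;> fin_cases j <;>
    simp [sigmaY, sigmaZ, Matrix.mul_apply]

theorem conjTranspose_localBasis_mul_self (n : ℕ) : (localBasis n)ᴴ * localBasis n = 1 := by
  have normalization : star ((1 / √2 : ℝ) : ℂ) * ((1 / √2 : ℝ) : ℂ) = 1 / 2 := by
    rw [RCLike.star_def, Complex.conj_ofReal, ← Complex.ofReal_mul, div_mul_div_comm, one_mul,
      Real.mul_self_sqrt (by norm_num)]
    norm_num
  rw [localBasis, Matrix.conjTranspose_smul, Matrix.smul_mul, Matrix.mul_smul, smul_smul,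
    normalization]
  split_ifs <;> ext i j <;> fin_cases i <;> fin_cases j <;>
    simp [Matrix.mul_apply, Matrix.conjTranspose_apply] <;> norm_num

/-- The product of the local changes of basis. -/
def globalBasis (N : ℕ) : Matrix (Config N) (Config N) ℂ := tensorOp fun n => localBasis n

theorem conjTranspose_globalBasis_mul_self (N : ℕ) : (globalBasis N)ᴴ * globalBasis N = 1 := by
  simp only [globalBasis, conjTranspose_tensorOp, tensorOp_mul, conjTranspose_localBasis_mul_self,
    tensorOp_one]

theorem siteOp_sigmaX_mul_globalBasis (n : Fin N) :
    siteOp sigmaX n * globalBasis N = globalBasis N * siteOp (localX n) n :=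
  siteOp_mul_tensorOp (sigmaX_mul_localBasis n)

theorem siteOp_sigmaY_mul_globalBasis (n : Fin N) :
    siteOp sigmaY n * globalBasis N = globalBasis N * siteOp (localY n) n :=
  siteOp_mul_tensorOp (sigmaY_mul_localBasis n)

/-- The matrix of the Hamiltonian in the product basis. -/
def wallHamiltonian (N : ℕ) : Matrix (Config N) (Config N) ℂ :=
  ∑ n : Fin N, (siteOp (localX n) n * siteOp (localX (finRotate N n)) (finRotate N n)
    + siteOp (localY n) n * siteOp (localY (finRotate N n)) (finRotate N n))

theorem hamiltonian_mul_globalBasis (N : ℕ) :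
    hamiltonian N * globalBasis N = globalBasis N * wallHamiltonian N := by
  simp only [hamiltonian, wallHamiltonian, Finset.sum_mul, Finset.mul_sum, add_mul, mul_add,
    mul_assoc, siteOp_sigmaX_mul_globalBasis, siteOp_sigmaY_mul_globalBasis]
  simp only [← mul_assoc, siteOp_sigmaX_mul_globalBasis, siteOp_sigmaY_mul_globalBasis]

/-- The configuration with the spin at site `n` flipped. -/
def flipAt (s : Config N) (n : Fin N) : Config N := Function.update s n (1 - s n)

/-- The type of the bond between the sites `k` and `k + 1`; a domain wall is a bond of type `-1`.
The factor `(-1) ^ k` makes the walls of an alternating pattern of spins be every other bond. -/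
def bondType [NeZero N] (s : Config N) (k : Fin N) : ℂ :=
  (-1) ^ ((k : ℕ) + (s k : ℕ) + (s (k + 1) : ℕ))

theorem siteOp_sigmaZ_mulVec (n : Fin N) (ψ : Config N → ℂ) (s : Config N) :
    (siteOp sigmaZ n *ᵥ ψ) s = (-1) ^ (s n : ℕ) * ψ s := by
  have update_eq_self : ∀ a, a = s n → Function.update s n a = s := fun a ha => by
    rw [ha, Function.update_eq_self]
  rw [siteOp_mulVec]
  generalize s n = b at *
  fin_cases b <;> simp [sigmaZ, update_eq_self]

theorem siteOp_sigmaY_mulVec (n : Fin N) (ψ : Config N → ℂ) (s : Config N) :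
    (siteOp sigmaY n *ᵥ ψ) s = -I * (-1) ^ (s n : ℕ) * ψ (flipAt s n) := by
  rw [siteOp_mulVec, flipAt]
  generalize s n = b at *
  fin_cases b <;> simp [sigmaY]

theorem siteOp_sigmaZ_mul_siteOp_sigmaY_mulVec (m n : Fin N) (ψ : Config N → ℂ) (s : Config N) :
    ((siteOp sigmaZ m * siteOp sigmaY n) *ᵥ ψ) s
      = -I * (-1) ^ ((s m : ℕ) + (s n : ℕ)) * ψ (flipAt s n) := by
  rw [← Matrix.mulVec_mulVec, siteOp_sigmaZ_mulVec, siteOp_sigmaY_mulVec, pow_add]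
  ring

theorem even_val_add_one [NeZero N] (hN : Even N) (n : Fin N) :
    Even ((n + 1 : Fin N) : ℕ) ↔ ¬ Even (n : ℕ) := by
  obtain ⟨K, rfl⟩ := Nat.exists_eq_succ_of_ne_zero (NeZero.ne N)
  have val_eq : ((n + 1 : Fin (K + 1)) : ℕ) = _ := Fin.val_add_one n
  rw [val_eq]
  split_ifs with h
  · subst h
    simpa [Nat.even_add_one] using hN
  · rw [Nat.even_add_one]

theorem localX_mul_add_localY_mul [NeZero N] (hN : Even N) (hN' : 2 ≤ N) (n : Fin N) :
    siteOp (localX n) n * siteOp (localX (n + 1 : Fin N)) (n + 1)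
        + siteOp (localY n) n * siteOp (localY (n + 1 : Fin N)) (n + 1)
      = (-1 : ℂ) ^ (n : ℕ) • (siteOp sigmaZ n * siteOp sigmaY (n + 1)
        - siteOp sigmaZ (n + 1) * siteOp sigmaY n) := by
  have commute_YZ := commute_siteOp sigmaY sigmaZ (add_one_ne_self_of_two_le hN' n).symm
  rcases Nat.even_or_odd (n : ℕ) with hn | hn
  · have next_odd : ¬ Even ((n + 1 : Fin N) : ℕ) := by rwa [even_val_add_one hN, not_not]
    simp only [localX, localY, hn, next_odd, if_true, if_false, hn.neg_one_pow, one_smul,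
      siteOp_neg, neg_mul, commute_YZ.eq, ← sub_eq_add_neg]
  · have next_even : Even ((n + 1 : Fin N) : ℕ) := by
      rwa [even_val_add_one hN, Nat.not_even_iff_odd]
    simp only [localX, localY, Nat.not_even_iff_odd.mpr hn, next_even, if_true, if_false,
      hn.neg_one_pow, neg_one_smul, siteOp_neg, mul_neg, commute_YZ.eq, neg_sub, ← sub_eq_add_neg]

theorem wallHamiltonian_mulVec [NeZero N] (hN : Even N) (hN' : 2 ≤ N) (ψ : Config N → ℂ)
    (s : Config N) :
    -I * (wallHamiltonian N *ᵥ ψ) s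
      = ∑ n : Fin N, (bondType s n - bondType s (n - 1)) * ψ (flipAt s n) := by
  have bond_term : ∀ n : Fin N, -I * ((siteOp (localX n) n * siteOp (localX (n + 1 : Fin N)) (n + 1)
        + siteOp (localY n) n * siteOp (localY (n + 1 : Fin N)) (n + 1)) *ᵥ ψ) s
      = bondType s n * ψ (flipAt s n) - bondType s n * ψ (flipAt s (n + 1)) := fun n => by
    rw [localX_mul_add_localY_mul hN hN', Matrix.smul_mulVec, Matrix.sub_mulVec, Pi.smul_apply,
      Pi.sub_apply, siteOp_sigmaZ_mul_siteOp_sigmaY_mulVec, siteOp_sigmaZ_mul_siteOp_sigmaY_mulVec,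
      bondType, add_assoc, pow_add _ (n : ℕ), smul_eq_mul, add_comm (s (n + 1) : ℕ)]
    linear_combination (-1) ^ (n : ℕ) * (-1) ^ ((s n : ℕ) + (s (n + 1) : ℕ))
      * (ψ (flipAt s (n + 1)) - ψ (flipAt s n)) * Complex.I_sq
  have shift_sum : ∑ n : Fin N, bondType s n * ψ (flipAt s (n + 1))
      = ∑ n : Fin N, bondType s (n - 1) * ψ (flipAt s n) := by
    rw [← Equiv.sum_comp (Equiv.addRight (1 : Fin N)) fun n => bondType s (n - 1) * _]
    simp
  simp only [wallHamiltonian, finRotate_apply, Matrix.sum_mulVec, Finset.sum_apply,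
    Finset.mul_sum, bond_term, Finset.sum_sub_distrib, shift_sum, sub_mul]

/-- The amplitudes of `Ω` in the product basis. -/
def wallOmega (N : ℕ) : Config N → ℂ :=
  tensorState fun n => if Even (n : ℕ) then ![1, 0] else ![(1 - I) / 2, (1 + I) / 2]

theorem localBasis_mulVec_eq (n : ℕ) :
    localBasis n *ᵥ (if Even n then ![1, 0] else ![(1 - I) / 2, (1 + I) / 2])
      = ((1 / √2 : ℝ) : ℂ) • ![1, 1] := by
  rw [localBasis, Matrix.smul_mulVec]
  congr 1
  ext a
  split_ifs <;> fin_cases a <;> simp [Matrix.mulVec, dotProduct, Fin.sum_univ_two]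
  · ring
  · linear_combination -Complex.I_sq

theorem globalBasis_mulVec_wallOmega (N : ℕ) : globalBasis N *ᵥ wallOmega N = omega N := by
  have normalization : 1 / √(2 ^ N) = (1 / √2) ^ N := by
    have sqrt_two_pow : √(2 ^ N) = √2 ^ N :=
      (Real.sqrt_eq_iff_mul_self_eq_of_pos (by positivity)).mpr <| by
        rw [← mul_pow, Real.mul_self_sqrt zero_le_two]
    rw [div_pow, one_pow, sqrt_two_pow]
  simp only [globalBasis, wallOmega, tensorOp_mulVec_tensorState, localBasis_mulVec_eq, omega,
    tensorState_smul, normalization, Complex.ofReal_pow]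

theorem exp_neg_smul_mulVec_eq_of_hasDerivAt {n : Type*} [Fintype n] [DecidableEq n]
    (H : Matrix n n ℂ) {y : ℝ → n → ℂ}
    (hy : ∀ t i, HasDerivAt (fun s => y s i) (-I * (H *ᵥ y t) i) t) (t : ℝ) :
    NormedSpace.exp (-(I * t) • H) *ᵥ y 0 = y t := by
  rw [← exp_smul_mulVec_eq_of_hasDerivAt (-I • H)
    (fun t i => (hy t i).congr_deriv (by rw [Matrix.smul_mulVec, Pi.smul_apply, smul_eq_mul])) t]
  congr 2
  rw [← neg_mul, mul_comm, mul_smul, Complex.coe_smul]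

theorem relaxationN_eq_star_dotProduct [NeZero N] (hN : 2 ≤ N) {t : ℝ} {ψ : Config N → ℂ}
    (hψ : NormedSpace.exp (-(I * t) • hamiltonian N) *ᵥ omega N = ψ) :
    relaxationN N t = star ψ ⬝ᵥ siteOp sigmaX (0 : Fin N) *ᵥ ψ := by
  have star_evolved : star (omega N) ᵥ* NormedSpace.exp ((I * t) • hamiltonian N) = star ψ := by
    rw [← hψ, Matrix.star_mulVec, ← Matrix.exp_conjTranspose, Matrix.conjTranspose_smul,
      conjTranspose_hamiltonian hN]
    congr 3
    simp
  rw [relaxationN, ← Matrix.mulVec_mulVec, ← Matrix.mulVec_mulVec, hψ, Matrix.dotProduct_mulVec,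
    star_evolved]

theorem relaxationN_eq_of_hasDerivAt [NeZero N] (hN : Even N) (hN' : 2 ≤ N)
    {Ψ : ℝ → Config N → ℂ} (initial : Ψ 0 = wallOmega N)
    (hΨ : ∀ t s, HasDerivAt (fun t => Ψ t s)
      (∑ n : Fin N, (bondType s n - bondType s (n - 1)) * Ψ t (flipAt s n)) t) (t : ℝ) :
    relaxationN N t = ∑ s : Config N, (-1) ^ (s 0 : ℕ) * (Ψ t s * conj (Ψ t s)) := by
  have evolution : ∀ t s, HasDerivAt (fun t => (globalBasis N *ᵥ Ψ t) s)
      (-I * (hamiltonian N *ᵥ (globalBasis N *ᵥ Ψ t)) s) t := fun t s => by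
    refine (HasDerivAt.fun_sum fun s' (_ : s' ∈ Finset.univ) =>
      (hΨ t s').const_mul (globalBasis N s s')).congr_deriv ?_
    rw [Matrix.mulVec_mulVec, hamiltonian_mul_globalBasis, ← Matrix.mulVec_mulVec, Matrix.mulVec,
      dotProduct, Finset.mul_sum]
    refine Finset.sum_congr rfl fun s' _ => ?_
    rw [← wallHamiltonian_mulVec hN hN']
    ring
  have evolved := exp_neg_smul_mulVec_eq_of_hasDerivAt (hamiltonian N) evolution t
  rw [initial, globalBasis_mulVec_wallOmega] at evolved
  have localX_zero : localX ((0 : Fin N) : ℕ) = sigmaZ := by simp [localX]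
  rw [relaxationN_eq_star_dotProduct hN' evolved, Matrix.mulVec_mulVec,
    siteOp_sigmaX_mul_globalBasis, localX_zero, ← Matrix.mulVec_mulVec, Matrix.star_mulVec,
    Matrix.dotProduct_mulVec, Matrix.vecMul_vecMul, conjTranspose_globalBasis_mul_self,
    Matrix.vecMul_one]
  refine Finset.sum_congr rfl fun s _ => ?_
  rw [siteOp_sigmaZ_mulVec, Pi.star_apply, RCLike.star_def]
  ring

end ProductBasis

/-! ### Domain walls -/

section Walls

variable {N : ℕ} [NeZero N]

theorem val_add_one (k : Fin N) :
    ((k + 1 : Fin N) : ℕ) = if (k : ℕ) + 1 = N then 0 else (k : ℕ) + 1 := by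
  rw [Fin.val_add, Fin.val_one', Nat.add_mod_mod]
  split_ifs with h
  · rw [h, Nat.mod_self]
  · exact Nat.mod_eq_of_lt (by omega)

theorem val_sub_one (k : Fin N) :
    ((k - 1 : Fin N) : ℕ) = if (k : ℕ) = 0 then N - 1 else (k : ℕ) - 1 := by
  have val_eq := val_add_one (k - 1)
  rw [sub_add_cancel] at val_eq
  split_ifs at val_eq ⊢ <;> omega

theorem sub_one_ne_self_of_two_le (hN : 2 ≤ N) (k : Fin N) : k - 1 ≠ k := fun h =>
  add_one_ne_self_of_two_le hN (k - 1) ((sub_add_cancel k 1).trans h.symm)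

/-- The bonds that carry a domain wall. -/
def walls (s : Config N) : Finset (Fin N) :=
  Finset.univ.filter fun k => Odd ((k : ℕ) + (s k : ℕ) + (s (k + 1) : ℕ))

theorem mem_walls {s : Config N} {k : Fin N} :
    k ∈ walls s ↔ Odd ((k : ℕ) + (s k : ℕ) + (s (k + 1) : ℕ)) := by
  simp [walls]

theorem bondType_eq_ite (s : Config N) (k : Fin N) :
    bondType s k = if k ∈ walls s then -1 else 1 := by
  rw [bondType]
  split_ifs with h
  · exact (mem_walls.mp h).neg_one_pow
  · exact (Nat.not_odd_iff_even.mp (mt mem_walls.mpr h)).neg_one_pow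

theorem mem_walls_flipAt_of_ne {s : Config N} {n k : Fin N} (hkn : k ≠ n) (hkn' : k ≠ n - 1) :
    k ∈ walls (flipAt s n) ↔ k ∈ walls s := by
  have next_ne : k + 1 ≠ n := fun h => hkn' (eq_sub_of_add_eq h)
  rw [mem_walls, mem_walls, flipAt, Function.update_of_ne hkn, Function.update_of_ne next_ne]

theorem odd_val_one_sub_add (b : Fin 2) (m : ℕ) :
    Odd (m + ((1 - b : Fin 2) : ℕ)) ↔ ¬ Odd (m + (b : ℕ)) := by
  fin_cases b <;> simp [Nat.odd_add_one]

theorem mem_walls_flipAt_self (hN : 2 ≤ N) {s : Config N} {n : Fin N} :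
    n ∈ walls (flipAt s n) ↔ n ∉ walls s := by
  rw [mem_walls, mem_walls, flipAt, Function.update_self,
    Function.update_of_ne (add_one_ne_self_of_two_le hN n), add_right_comm, odd_val_one_sub_add,
    add_right_comm]

theorem mem_walls_flipAt_sub_one (hN : 2 ≤ N) {s : Config N} {n : Fin N} :
    n - 1 ∈ walls (flipAt s n) ↔ n - 1 ∉ walls s := by
  rw [mem_walls, mem_walls, flipAt, sub_add_cancel, Function.update_self,
    Function.update_of_ne (sub_one_ne_self_of_two_le hN n), odd_val_one_sub_add]

theorem walls_flipAt (hN : 2 ≤ N) {s : Config N} {k : Fin N} (hk : k ∈ walls s)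
    (hk' : k - 1 ∉ walls s) : walls (flipAt s k) = insert (k - 1) ((walls s).erase k) := by
  ext l
  rw [Finset.mem_insert, Finset.mem_erase]
  by_cases hl : l = k - 1
  · subst hl
    simp [mem_walls_flipAt_sub_one hN, hk']
  by_cases hlk : l = k
  · subst hlk
    simp [mem_walls_flipAt_self hN, hk, hl]
  · simp [mem_walls_flipAt_of_ne hlk hl, hl, hlk]

theorem walls_flipAt_add_one (hN : 2 ≤ N) {s : Config N} {k : Fin N} (hk : k ∈ walls s)
    (hk' : k + 1 ∉ walls s) :
    walls (flipAt s (k + 1)) = insert (k + 1) ((walls s).erase k) := by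
  ext l
  rw [Finset.mem_insert, Finset.mem_erase]
  by_cases hl : l = k + 1
  · subst hl
    simp [mem_walls_flipAt_self hN, hk']
  by_cases hlk : l = k
  · subst hlk
    have mem_iff := mem_walls_flipAt_sub_one hN (s := s) (n := l + 1)
    rw [add_sub_cancel_right] at mem_iff
    simp [mem_iff, hk, hl]
  · rw [mem_walls_flipAt_of_ne hl (by rwa [add_sub_cancel_right])]
    simp [hl, hlk]

theorem card_walls_flipAt (hN : 2 ≤ N) {s : Config N} {n : Fin N}
    (hn : n ∈ walls s ↔ n - 1 ∉ walls s) : (walls (flipAt s n)).card = (walls s).card := by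
  by_cases mem : n ∈ walls s
  · have not_mem := hn.mp mem
    rw [walls_flipAt hN mem not_mem, Finset.card_insert_of_notMem
      (mt Finset.mem_of_mem_erase not_mem), Finset.card_erase_add_one mem]
  · have mem_sub_one : n - 1 ∈ walls s := not_not.mp (mt hn.mpr mem)
    have moved := walls_flipAt_add_one hN mem_sub_one (by rwa [sub_add_cancel])
    rw [sub_add_cancel] at moved
    rw [moved, Finset.card_insert_of_notMem (mt Finset.mem_of_mem_erase mem),
      Finset.card_erase_add_one mem_sub_one]

theorem injective_walls : Function.Injective fun s : Config N => (s 0, walls s) := by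
  intro s s' h
  obtain ⟨eq_zero, eq_walls⟩ := Prod.mk.inj h
  have eq_at : ∀ k : ℕ, ∀ hk : k < N, s ⟨k, hk⟩ = s' ⟨k, hk⟩ := by
    intro k
    induction k with
    | zero => exact fun _ => eq_zero
    | succ k ih =>
      intro hk
      have next : (⟨k, by omega⟩ : Fin N) + 1 = ⟨k + 1, hk⟩ :=
        Fin.ext ((val_add_one _).trans (if_neg hk.ne))
      have wall_iff : (⟨k, by omega⟩ : Fin N) ∈ walls s ↔ (⟨k, by omega⟩ : Fin N) ∈ walls s' := by
        rw [eq_walls]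
      rw [mem_walls, mem_walls, next, ih, Nat.odd_iff, Nat.odd_iff] at wall_iff
      omega
  exact funext fun k => eq_at k k.2

end Walls

theorem even_sum_range_add {n : ℕ} {b : ℕ → ℕ} (hb : ∑ j ∈ Finset.range (2 * n), b j = n) :
    Even (∑ j ∈ Finset.range (2 * n), (j + b j)) := by
  have sum_id : ∑ j ∈ Finset.range (2 * n), j = n * (2 * n - 1) := by
    rw [Finset.sum_range_id, mul_assoc, Nat.mul_div_cancel_left _ two_pos]
  rw [Finset.sum_add_distrib, hb, sum_id, ← Nat.mul_succ]
  rcases n with _ | n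
  · simp
  · exact ⟨(n + 1) * (n + 1), by rw [← mul_add]; congr 1; omega⟩

theorem exists_config_of_walls {M : ℕ} [NeZero (2 * M)] (a : Fin 2) {T : Finset (Fin (2 * M))}
    (hT : T.card = M) : ∃ s : Config (2 * M), s 0 = a ∧ walls s = T := by
  let b : ℕ → ℕ := fun j => if j ∈ T.map Fin.valEmbedding then 1 else 0
  let c : ℕ → ℕ := fun k => a + ∑ j ∈ Finset.range k, (j + b j)
  have c_succ : ∀ k, c (k + 1) = c k + (k + b k) := fun k => by
    simp only [c, Finset.sum_range_succ, add_assoc]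
  have sum_b : ∑ j ∈ Finset.range (2 * M), b j = M := by
    rw [Finset.sum_ite_mem, Finset.inter_eq_right.mpr]
    · simpa using hT
    · intro j hj
      obtain ⟨k, _, rfl⟩ := Finset.mem_map.mp hj
      exact Finset.mem_range.mpr k.2
  have closing : c (2 * M) % 2 = a := by
    obtain ⟨m, hm⟩ := even_sum_range_add sum_b
    simp only [c, hm]
    omega
  have b_mod_two : ∀ k : Fin (2 * M), b k % 2 = 1 ↔ k ∈ T := fun k => by
    have mem_iff : (k : ℕ) ∈ T.map Fin.valEmbedding ↔ k ∈ T := Finset.mem_map' Fin.valEmbedding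
    simp only [b, mem_iff]
    split_ifs with hk <;> simp [hk]
  have c_zero : c 0 = a := by simp [c]
  refine ⟨fun k => ⟨c k % 2, Nat.mod_lt _ two_pos⟩, Fin.ext ?_, ?_⟩
  · simp only [Fin.val_zero, c_zero]
    exact Nat.mod_eq_of_lt a.2
  · ext k
    have c_next := c_succ k
    rw [mem_walls, ← b_mod_two, Nat.odd_iff]
    simp only [val_add_one]
    split_ifs with hk
    · rw [hk] at c_next
      simp only [c_zero]
      omega
    · omega

theorem sum_config_eq_sum_walls {M : ℕ} [NeZero (2 * M)] {R : Type*} [AddCommMonoid R]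
    (F : Fin 2 → Finset (Fin (2 * M)) → R) (hF : ∀ a T, T.card ≠ M → F a T = 0) :
    ∑ s : Config (2 * M), F (s 0) (walls s) = ∑ T, (F 0 T + F 1 T) := by
  rw [Fintype.sum_of_injective (fun s : Config (2 * M) => (s 0, walls s)) injective_walls _
    (fun p : Fin 2 × Finset (Fin (2 * M)) => F p.1 p.2) ?_ fun _ => rfl,
    Fintype.sum_prod_type, Fin.sum_univ_two, Finset.sum_add_distrib]
  rintro ⟨a, T⟩ h
  refine hF a T fun hT => h ?_
  obtain ⟨s, s_zero, walls_s⟩ := exists_config_of_walls a hT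
  exact ⟨s, Prod.ext s_zero walls_s⟩

/-! ### Free motion of domain walls -/

section FreeMotion

/-- The position of a bond of the ring on the line. -/
def position {N : ℕ} (k : Fin N) : ℤ := (k : ℕ)

theorem position_zero {N : ℕ} [NeZero N] : position (0 : Fin N) = 0 := by simp [position]

/-- The orbitals `φ` restricted to the bonds of the ring. -/
def onBonds {M : ℕ} (N : ℕ) (φ : Fin M → ℤ → ℂ) : Fin M → Fin N → ℂ := fun i k => φ i (position k)

theorem slaterDet_onBonds {M N : ℕ} (φ : Fin M → ℤ → ℂ) (x : Fin M → Fin N) :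
    slaterDet (onBonds N φ) x = slaterDet φ (position ∘ x) := rfl

theorem slaterDet_update_position {M N : ℕ} (φ : Fin M → ℤ → ℂ) (x : Fin M → Fin N) (j : Fin M)
    (v : Fin N) :
    slaterDet φ (Function.update (position ∘ x) j (position v))
      = slaterDet (onBonds N φ) (Function.update x j v) := by
  rw [slaterDet_onBonds, Function.comp_update]

theorem slaterDet_update_position_of_mem {M N : ℕ} (φ : Fin M → ℤ → ℂ) {x : Fin M → Fin N}
    {j : Fin M} {v : Fin N} (hv : v ∈ Finset.univ.image x) (hne : v ≠ x j) :
    slaterDet φ (Function.update (position ∘ x) j (position v)) = 0 := by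
  obtain ⟨i, _, rfl⟩ := Finset.mem_image.mp hv
  have hij : i ≠ j := fun h => hne (congrArg x h)
  rw [slaterDet_update_position]
  refine slaterDet_eq_zero_of_eq _ hij ?_
  rw [Function.update_of_ne hij, Function.update_self]

theorem slaterDet_update_position_of_adjacent {M N : ℕ} (φ : Fin M → ℤ → ℂ) {x : Fin M → Fin N}
    (hx : StrictMono x) {j : Fin M} {v : Fin N} (hv : v ∉ Finset.univ.image x)
    (adjacent : (v : ℕ) = x j + 1 ∨ (x j : ℕ) = v + 1) :
    slaterDet φ (Function.update (position ∘ x) j (position v))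
      = slaterAmp (onBonds N φ) (insert v ((Finset.univ.image x).erase (x j))) := by
  have ne_v : ∀ i, (x i : ℕ) ≠ v := fun i h =>
    hv (Finset.mem_image.mpr ⟨i, Finset.mem_univ i, Fin.ext h⟩)
  have ordered : StrictMono (Function.update x j v) := by
    refine strictMono_update hx (fun i hi => ?_) fun i hi => ?_ <;>
    · have := Fin.lt_def.mp (hx hi)
      have := ne_v i
      rw [Fin.lt_def]
      omega
  rw [slaterDet_update_position, ← image_update_univ hx.injective, slaterAmp_image _ ordered]

theorem image_cons {L : ℕ} {α : Type*} [DecidableEq α] (a : α) (p : Fin L → α) :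
    Finset.univ.image (Fin.cons a p : Fin (L + 1) → α) = insert a (Finset.univ.image p) :=
  Finset.coe_injective (by simp [Fin.range_cons])

theorem image_snoc {L : ℕ} {α : Type*} [DecidableEq α] (a : α) (p : Fin L → α) :
    Finset.univ.image (Fin.snoc p a : Fin (L + 1) → α) = insert a (Finset.univ.image p) :=
  Finset.coe_injective (by simp [Fin.range_snoc])

/-- Carrying the rightmost particle around the ring to the first bond moves it past the `L` other
ones; the sign `(-1) ^ L` in the quasi-periodicity of the orbitals compensates for this. -/
theorem slaterDet_snoc_wrap {L N : ℕ} [NeZero N] {η : ℂ} {φ : Fin (L + 1) → ℤ → ℂ}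
    (hφ : ∀ i k, φ i (k + N) = η * (-1) ^ L * φ i k) {p : Fin L → Fin N} (hp : StrictMono p)
    (h0 : 0 ∉ Finset.univ.image p) :
    slaterDet φ (Fin.snoc (position ∘ p) N)
      = η * slaterAmp (onBonds N φ) (insert 0 (Finset.univ.image p)) := by
  have ordered : StrictMono (Fin.cons 0 p : Fin (L + 1) → Fin N) :=
    strictMono_cons hp fun i => lt_of_le_of_ne (Fin.zero_le _) fun h =>
      h0 (Finset.mem_image.mpr ⟨i, Finset.mem_univ i, h.symm⟩)
  rw [slaterDet_snoc_of_eq_smul φ (b := 0) (c := η * (-1) ^ L) _ fun i => by rw [← hφ, zero_add],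
    ← image_cons, slaterAmp_image _ ordered, slaterDet_onBonds, Fin.comp_cons, mul_assoc η,
    ← mul_pow]
  simp [position]

theorem slaterDet_cons_wrap {L N : ℕ} {η : ℂ} (hη : η ^ 2 = 1) {φ : Fin (L + 1) → ℤ → ℂ}
    (hφ : ∀ i k, φ i (k + N) = η * (-1) ^ L * φ i k) {p : Fin L → Fin N} (hp : StrictMono p)
    {v : Fin N} (hv : position v = -1 + N) (hvp : v ∉ Finset.univ.image p) :
    slaterDet φ (Fin.cons (-1) (position ∘ p))
      = η * slaterAmp (onBonds N φ) (insert v (Finset.univ.image p)) := by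
  have ordered : StrictMono (Fin.snoc p v : Fin (L + 1) → Fin N) :=
    strictMono_snoc hp fun i => by
      have ne_v : (p i : ℕ) ≠ v := fun h =>
        hvp (Finset.mem_image.mpr ⟨i, Finset.mem_univ i, Fin.ext h⟩)
      have := (p i).2
      rw [position] at hv
      rw [Fin.lt_def]
      omega
  rw [← image_snoc, slaterAmp_image _ ordered, slaterDet_onBonds, Fin.comp_snoc, hv,
    slaterDet_snoc_of_eq_smul φ (b := -1) (c := η * (-1) ^ L) _ fun i => hφ i _]
  have sign_sq : ((-1 : ℂ) ^ L) ^ 2 = 1 := by rw [← pow_mul, pow_mul']; simp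
  linear_combination (-slaterDet φ (Fin.cons (-1) (position ∘ p))) * (hη + η ^ 2 * sign_sq)

theorem image_erase_zero {L : ℕ} {α : Type*} [DecidableEq α] {x : Fin (L + 1) → α}
    (hx : Function.Injective x) :
    (Finset.univ.image x).erase (x 0) = Finset.univ.image (Fin.tail x) := by
  conv_lhs => rw [← Fin.cons_self_tail x, image_cons, Fin.cons_zero]
  refine Finset.erase_insert fun h => ?_
  obtain ⟨i, _, hi⟩ := Finset.mem_image.mp h
  exact Fin.succ_ne_zero i (hx hi)

theorem image_erase_last {L : ℕ} {α : Type*} [DecidableEq α] {x : Fin (L + 1) → α}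
    (hx : Function.Injective x) :
    (Finset.univ.image x).erase (x (Fin.last L)) = Finset.univ.image (Fin.init x) := by
  conv_lhs => rw [← Fin.snoc_init_self x, image_snoc, Fin.snoc_last]
  refine Finset.erase_insert fun h => ?_
  obtain ⟨i, _, hi⟩ := Finset.mem_image.mp h
  exact (Fin.castSucc_lt_last i).ne (hx hi)

theorem slaterDet_update_last_wrap {L N : ℕ} [NeZero N] {η : ℂ} {φ : Fin (L + 1) → ℤ → ℂ}
    (hφ : ∀ i k, φ i (k + N) = η * (-1) ^ L * φ i k) {x : Fin (L + 1) → Fin N} (hx : StrictMono x)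
    (h0 : 0 ∉ Finset.univ.image x) :
    slaterDet φ (Function.update (position ∘ x) (Fin.last L) N)
      = η * slaterAmp (onBonds N φ) (insert 0 ((Finset.univ.image x).erase (x (Fin.last L)))) := by
  have not_mem : 0 ∉ (Finset.univ.image x).erase (x (Fin.last L)) :=
    mt Finset.mem_of_mem_erase h0
  rw [image_erase_last hx.injective] at not_mem ⊢
  rw [← Fin.snoc_init_self (position ∘ x), Fin.update_snoc_last]
  exact slaterDet_snoc_wrap hφ (hx.comp Fin.strictMono_castSucc) not_mem

theorem slaterDet_update_zero_wrap {L N : ℕ} {η : ℂ} (hη : η ^ 2 = 1) {φ : Fin (L + 1) → ℤ → ℂ}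
    (hφ : ∀ i k, φ i (k + N) = η * (-1) ^ L * φ i k) {x : Fin (L + 1) → Fin N} (hx : StrictMono x)
    {v : Fin N} (hv : position v = -1 + N) (hvx : v ∉ Finset.univ.image x) :
    slaterDet φ (Function.update (position ∘ x) 0 (-1))
      = η * slaterAmp (onBonds N φ) (insert v ((Finset.univ.image x).erase (x 0))) := by
  have not_mem : v ∉ (Finset.univ.image x).erase (x 0) := mt Finset.mem_of_mem_erase hvx
  rw [image_erase_zero hx.injective] at not_mem ⊢
  rw [← Fin.cons_self_tail (position ∘ x), Fin.update_cons_zero]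
  exact slaterDet_cons_wrap hη hφ (hx.comp Fin.strictMono_succ) hv not_mem

/-- The amplitudes of the state in which the walls fill the orbitals `φ`. Two configurations with
the same walls differ by a global spin flip, under which the state has parity `η`. -/
def wallState {M N : ℕ} [NeZero N] (η : ℂ) (φ : Fin M → ℤ → ℂ) (s : Config N) : ℂ :=
  η ^ (s 0 : ℕ) * slaterAmp (onBonds N φ) (walls s)

theorem wallState_of_card_ne {M N : ℕ} [NeZero N] (η : ℂ) (φ : Fin M → ℤ → ℂ) {s : Config N}
    (hs : (walls s).card ≠ M) : wallState η φ s = 0 := by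
  rw [wallState, slaterAmp_of_card_ne _ hs, mul_zero]

theorem wallState_of_image_eq {M N : ℕ} [NeZero N] (η : ℂ) (φ : Fin M → ℤ → ℂ) {s : Config N}
    {x : Fin M → Fin N} (hx : StrictMono x) (hxs : Finset.univ.image x = walls s) :
    wallState η φ s = η ^ (s 0 : ℕ) * slaterDet φ (position ∘ x) := by
  rw [wallState, ← hxs, slaterAmp_image _ hx, slaterDet_onBonds]

theorem flipAt_zero_of_ne {N : ℕ} [NeZero N] (s : Config N) {n : Fin N} (h : n ≠ 0) :
    flipAt s n 0 = s 0 := Function.update_of_ne h.symm _ _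

theorem pow_flipAt_zero {N : ℕ} [NeZero N] {η : ℂ} (hη : η ^ 2 = 1) (s : Config N) :
    η ^ (flipAt s 0 0 : ℕ) = η ^ (s 0 : ℕ) * η := by
  rw [flipAt, Function.update_self]
  generalize s 0 = b
  fin_cases b
  · simp
  · simpa [← sq] using hη.symm

variable {L N : ℕ} [NeZero N] {η : ℂ} {φ : Fin (L + 1) → ℤ → ℂ} {s : Config N}
  {x : Fin (L + 1) → Fin N}

theorem slaterDet_hop_right (hN : 2 ≤ N) (hη : η ^ 2 = 1)
    (hφ : ∀ i k, φ i (k + N) = η * (-1) ^ L * φ i k) (hx : StrictMono x)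
    (hxs : Finset.univ.image x = walls s) (j : Fin (L + 1)) :
    η ^ (s 0 : ℕ) * slaterDet φ (Function.update (position ∘ x) j (position (x j) + 1))
      = if x j + 1 ∈ walls s then 0 else wallState η φ (flipAt s (x j + 1)) := by
  have mem_walls_x : x j ∈ walls s := hxs ▸ Finset.mem_image_of_mem x (Finset.mem_univ j)
  have val_next := val_add_one (x j)
  split_ifs at val_next with wrap
  · have next : x j + 1 = 0 := Fin.ext (by rw [val_next, Fin.val_zero])
    have target : position (x j) + 1 = N := by
      rw [position]
      exact_mod_cast wrap
    split_ifs with occupied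
    · have vanish := slaterDet_update_position_of_mem φ (hxs ▸ occupied)
        (add_one_ne_self_of_two_le hN (x j))
      rw [next, position_zero] at vanish
      rw [slaterDet_update_smul φ _ j (b := 0) fun i => by rw [target, ← hφ, zero_add], vanish,
        mul_zero, mul_zero]
    · obtain rfl : j = Fin.last L := by
        by_contra hj
        have := Fin.lt_def.mp (hx (Fin.lt_last_iff_ne_last.mpr hj))
        omega
      have moved := walls_flipAt_add_one hN mem_walls_x occupied
      rw [next] at moved occupied
      rw [next, target, wallState, moved, pow_flipAt_zero hη, mul_assoc,
        slaterDet_update_last_wrap hφ hx (hxs ▸ occupied), hxs]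
  · have target : position (x j) + 1 = position (x j + 1) := by
      rw [position, position, val_next, Nat.cast_succ]
    rw [target]
    split_ifs with occupied
    · rw [slaterDet_update_position_of_mem φ (hxs ▸ occupied) (add_one_ne_self_of_two_le hN _),
        mul_zero]
    · have next_ne_zero : x j + 1 ≠ 0 := fun h => by simp [h] at val_next
      rw [slaterDet_update_position_of_adjacent φ hx (hxs ▸ occupied) (Or.inl val_next), wallState,
        flipAt_zero_of_ne s next_ne_zero, walls_flipAt_add_one hN mem_walls_x occupied, hxs]

theorem slaterDet_hop_left (hN : 2 ≤ N) (hη : η ^ 2 = 1)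
    (hφ : ∀ i k, φ i (k + N) = η * (-1) ^ L * φ i k) (hx : StrictMono x)
    (hxs : Finset.univ.image x = walls s) (j : Fin (L + 1)) :
    η ^ (s 0 : ℕ) * slaterDet φ (Function.update (position ∘ x) j (position (x j) - 1))
      = if x j - 1 ∈ walls s then 0 else wallState η φ (flipAt s (x j)) := by
  have mem_walls_x : x j ∈ walls s := hxs ▸ Finset.mem_image_of_mem x (Finset.mem_univ j)
  have val_prev := val_sub_one (x j)
  split_ifs at val_prev with wrap
  · have at_zero : x j = 0 := Fin.ext (by rw [wrap, Fin.val_zero])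
    have target : position (x j) - 1 = -1 := by rw [at_zero, position_zero, zero_sub]
    have position_prev : position (x j - 1) = -1 + N := by
      rw [position, val_prev, Nat.cast_sub (by omega)]
      ring
    rw [target]
    split_ifs with occupied
    · have sign_sq : (η * (-1) ^ L) ^ 2 = 1 := by rw [mul_pow, hη, ← pow_mul, pow_mul']; simp
      have vanish := slaterDet_update_position_of_mem φ (hxs ▸ occupied)
        (sub_one_ne_self_of_two_le hN (x j))
      rw [slaterDet_update_smul φ _ j (b := position (x j - 1)) (c := η * (-1) ^ L) fun i => by
        rw [position_prev, hφ, ← mul_assoc, ← sq, sign_sq, one_mul], vanish, mul_zero, mul_zero]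
    · obtain rfl : j = 0 := by
        by_contra hj
        have := Fin.lt_def.mp (hx (Fin.pos_of_ne_zero hj))
        omega
      have parity : η ^ (flipAt s (x 0) 0 : ℕ) = η ^ (s 0 : ℕ) * η := by
        rw [at_zero, pow_flipAt_zero hη]
      rw [wallState, walls_flipAt hN mem_walls_x occupied, parity, mul_assoc,
        slaterDet_update_zero_wrap hη hφ hx position_prev (hxs ▸ occupied), hxs]
  · have target : position (x j) - 1 = position (x j - 1) := by
      rw [position, position, val_prev, Nat.cast_pred (Nat.pos_of_ne_zero wrap)]
    rw [target]
    split_ifs with occupied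
    · rw [slaterDet_update_position_of_mem φ (hxs ▸ occupied) (sub_one_ne_self_of_two_le hN _),
        mul_zero]
    · have ne_zero : x j ≠ 0 := fun h => wrap (by rw [h, Fin.val_zero])
      rw [slaterDet_update_position_of_adjacent φ hx (hxs ▸ occupied) (Or.inr (by omega)),
        wallState, flipAt_zero_of_ne s ne_zero, walls_flipAt hN mem_walls_x occupied, hxs]

theorem sum_bondType_sub_mul (s : Config N) (ψ : Fin N → ℂ) :
    ∑ n, (bondType s n - bondType s (n - 1)) * ψ n
      = ∑ k ∈ walls s, ((if k + 1 ∈ walls s then 0 else 2 * ψ (k + 1))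
        - if k - 1 ∈ walls s then 0 else 2 * ψ k) := by
  have split_term : ∀ n, (bondType s n - bondType s (n - 1)) * ψ n
      = (if n - 1 ∈ walls s then (if n ∈ walls s then 0 else 2 * ψ n) else 0)
        - (if n ∈ walls s then (if n - 1 ∈ walls s then 0 else 2 * ψ n) else 0) := fun n => by
    rw [bondType_eq_ite, bondType_eq_ite]
    split_ifs <;> ring
  simp only [split_term]
  rw [Finset.sum_sub_distrib, ← Equiv.sum_comp (Equiv.addRight (1 : Fin N)),
    Finset.sum_sub_distrib]
  simp only [Equiv.coe_addRight, add_sub_cancel_right, Finset.sum_ite_mem, Finset.univ_inter]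
  congr!

/-- The walls move as free fermions: the orbitals of a Slater determinant evolve independently. -/
theorem hasDerivAt_wallState (hN : 2 ≤ N) (hη : η ^ 2 = 1) {φ : ℝ → Fin (L + 1) → ℤ → ℂ}
    {t : ℝ} (hφ : ∀ i k, φ t i (k + N) = η * (-1) ^ L * φ t i k)
    (hφ' : ∀ i k, HasDerivAt (fun t => φ t i k) (2 * (φ t i (k + 1) - φ t i (k - 1))) t)
    (s : Config N) :
    HasDerivAt (fun t => wallState η (φ t) s)
      (∑ n, (bondType s n - bondType s (n - 1)) * wallState η (φ t) (flipAt s n)) t := by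
  by_cases card_eq : (walls s).card = L + 1
  · obtain ⟨x, hx, hxs⟩ := exists_strictMono_image_eq card_eq
    simp only [wallState_of_image_eq η _ hx hxs]
    refine ((hasDerivAt_slaterDet fun i j => hφ' i ((position ∘ x) j)).const_mul
      (η ^ (s 0 : ℕ))).congr_deriv ?_
    rw [sum_bondType_sub_mul s fun n => wallState η (φ t) (flipAt s n), Finset.mul_sum,
      ← hxs, Finset.sum_image hx.injective.injOn]
    refine Finset.sum_congr rfl fun j _ => ?_
    have hop_right := slaterDet_hop_right hN hη hφ hx hxs j
    have hop_left := slaterDet_hop_left hN hη hφ hx hxs j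
    rw [mul_left_comm, mul_sub, Function.comp_apply, hop_right, hop_left, hxs]
    split_ifs <;> ring
  · simp only [wallState_of_card_ne η _ card_eq]
    refine (hasDerivAt_const t (0 : ℂ)).congr_deriv (Finset.sum_eq_zero fun n _ => ?_).symm
    by_cases hn : n ∈ walls s ↔ n - 1 ∉ walls s
    · rw [wallState_of_card_ne, mul_zero]
      rwa [card_walls_flipAt hN hn]
    · rw [bondType_eq_ite, bondType_eq_ite, sub_mul, sub_eq_zero]
      by_cases mem : n ∈ walls s <;> simp_all

end FreeMotion

/-! ### The polarized state as a Slater determinant -/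

section InitialState

variable {M : ℕ}

/-- The bonds of the ring in pairs: bond `2i + b` is member `b` of pair `i`. -/
def pairBond (i : Fin M) (b : Fin 2) : Fin (2 * M) := ⟨2 * i + b, by omega⟩

theorem pairBond_inj {i j : Fin M} {b c : Fin 2} : pairBond i b = pairBond j c ↔ i = j ∧ b = c := by
  simp only [pairBond, Fin.ext_iff]
  omega

theorem exists_eq_pairBond (k : Fin (2 * M)) : ∃ i b, k = pairBond i b :=
  ⟨⟨k / 2, by omega⟩, ⟨k % 2, by omega⟩, Fin.ext (Nat.div_add_mod _ _).symm⟩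

theorem strictMono_pairBond (c : Fin M → Fin 2) : StrictMono fun i => pairBond i (c i) := by
  intro i j hij
  simp only [pairBond, Fin.lt_def] at hij ⊢
  omega

theorem pairBond_mem_image {c : Fin M → Fin 2} {i : Fin M} {b : Fin 2} :
    pairBond i b ∈ Finset.univ.image (fun j => pairBond j (c j)) ↔ c i = b := by
  simp [pairBond_inj]

/-- The orbitals of the initial state: orbital `i` is supported on the bonds `2i` and `2i + 1`. -/
def pairOrbital (i : Fin M) (k : Fin (2 * M)) : ℂ :=
  if k = pairBond i 0 then I else if k = pairBond i 1 then 1 else 0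

theorem slaterAmp_pairOrbital_image (c : Fin M → Fin 2) :
    slaterAmp pairOrbital (Finset.univ.image fun i => pairBond i (c i))
      = ∏ i, if c i = 0 then I else 1 := by
  rw [slaterAmp_image _ (strictMono_pairBond c), slaterDet, ← Matrix.det_diagonal]
  congr 1
  ext i j
  rw [Matrix.of_apply, pairOrbital, Matrix.diagonal_apply]
  rcases eq_or_ne i j with rfl | hij
  · rcases Fin.exists_fin_two.mp ⟨c i, rfl⟩ with h | h <;> simp [pairBond_inj, ← h]
  · simp [pairBond_inj, hij, hij.symm]

theorem exists_eq_image_pairBond_of_slaterAmp_ne_zero {T : Finset (Fin (2 * M))}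
    (hT : slaterAmp pairOrbital T ≠ 0) :
    ∃ c : Fin M → Fin 2, T = Finset.univ.image fun i => pairBond i (c i) := by
  obtain ⟨x, hx, rfl⟩ := exists_strictMono_image_eq
    (not_imp_comm.mp (slaterAmp_of_card_ne pairOrbital) hT)
  rw [slaterAmp_image _ hx, slaterDet, Matrix.det_apply] at hT
  obtain ⟨σ, -, term_ne_zero⟩ := Finset.exists_ne_zero_of_sum_ne_zero hT
  have orbital_ne_zero (i) : pairOrbital i (x (σ.symm i)) ≠ 0 := by
    have := Finset.prod_ne_zero_iff.mp (right_ne_zero_of_smul term_ne_zero) (σ.symm i)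
      (Finset.mem_univ _)
    rwa [Matrix.of_apply, σ.apply_symm_apply] at this
  have in_pair (i) : ∃ b, x (σ.symm i) = pairBond i b := by
    by_contra! h
    exact orbital_ne_zero i (by rw [pairOrbital, if_neg (h 0), if_neg (h 1)])
  choose c hc using in_pair
  refine ⟨c, ?_⟩
  rw [← funext hc]
  exact Finset.coe_injective (by
    simpa only [Finset.coe_image, Finset.coe_univ, Set.image_univ, Function.comp_def]
      using (σ.symm.surjective.range_comp x).symm)

/-- The occupation numbers of the sites, continued by zero to all of `ℕ`. -/
def occ {N : ℕ} (s : Config N) (k : ℕ) : ℕ := if h : k < N then (s ⟨k, h⟩ : ℕ) else 0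

theorem occ_val {N : ℕ} (s : Config N) (k : Fin N) : occ s k = s k := dif_pos k.2

theorem occ_of_le {N : ℕ} (s : Config N) {k : ℕ} (hk : N ≤ k) : occ s k = 0 :=
  dif_neg (not_lt.mpr hk)

theorem occ_le_one {N : ℕ} (s : Config N) (k : ℕ) : occ s k ≤ 1 := by
  rw [occ]
  split_ifs
  · omega
  · exact zero_le_one

theorem mem_walls_iff_occ {N : ℕ} [NeZero N] {s : Config N} (h0 : s 0 = 0) (k : Fin N) :
    k ∈ walls s ↔ Odd ((k : ℕ) + occ s k + occ s (k + 1)) := by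
  have val_next := val_add_one k
  rw [mem_walls, occ_val]
  split_ifs at val_next with wrap
  · rw [Fin.ext (b := 0) val_next, h0, occ_of_le s wrap.ge, Fin.val_zero]
  · rw [← val_next, occ_val]

theorem wallOmega_apply_of_ne {N : ℕ} {s : Config N} {k : Fin N} (hk : Even (k : ℕ))
    (hs : s k ≠ 0) : wallOmega N s = 0 := by
  refine Finset.prod_eq_zero (Finset.mem_univ k) ?_
  simp only [if_pos hk, Fin.eq_one_of_ne_zero _ hs]
  rfl

theorem wallOmega_apply_of_even_empty {s : Config (2 * M)}
    (even_empty : ∀ j, occ s (2 * j) = 0) :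
    wallOmega (2 * M) s
      = ((1 - I) / 2) ^ M * ∏ j : Fin M, if occ s (2 * j + 1) = 0 then 1 else I := by
  have even_factor (j : Fin M) : s (pairBond j 0) = 0 :=
    Fin.ext (by rw [← occ_val]; exact even_empty j)
  have odd_factor (j : Fin M) : (![(1 - I) / 2, (1 + I) / 2] : Fin 2 → ℂ) (s (pairBond j 1))
      = (1 - I) / 2 * if occ s (2 * j + 1) = 0 then 1 else I := by
    have occ_eq : occ s (2 * j + 1) = s (pairBond j 1) := occ_val s (pairBond j 1)
    rw [occ_eq]
    generalize s (pairBond j 1) = b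
    fin_cases b
    · simp
    · simp only [Fin.mk_one, Matrix.cons_val_one, Matrix.cons_val_fin_one, one_ne_zero, if_false]
      linear_combination (1 / 2) * Complex.I_sq
  let pairs : Fin M × Fin 2 ≃ Fin (2 * M) := Equiv.ofBijective (fun p => pairBond p.1 p.2)
    ⟨fun p q h => Prod.ext_iff.mpr (pairBond_inj.mp h), fun k => by
      obtain ⟨i, b, rfl⟩ := exists_eq_pairBond k
      exact ⟨(i, b), rfl⟩⟩
  have pairs_apply (p) : pairs p = pairBond p.1 p.2 := rfl
  rw [wallOmega, tensorState, ← pairs.prod_comp, Fintype.prod_prod_type, ← Fin.prod_const,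
    ← Finset.prod_mul_distrib]
  refine Finset.prod_congr rfl fun j _ => ?_
  rw [Fin.prod_univ_two, ← odd_factor]
  simp only [pairs_apply, even_factor]
  simp [pairBond]

variable [NeZero (2 * M)] {s : Config (2 * M)}

theorem pairBond_zero_mem_walls (h0 : s 0 = 0) (i : Fin M) :
    pairBond i 0 ∈ walls s ↔ Odd (occ s (2 * i) + occ s (2 * i + 1)) := by
  rw [mem_walls_iff_occ h0]
  simp only [pairBond, Fin.val_zero, add_zero, Nat.odd_iff]
  omega

theorem pairBond_one_mem_walls (h0 : s 0 = 0) (i : Fin M) :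
    pairBond i 1 ∈ walls s ↔ Even (occ s (2 * i + 1) + occ s (2 * (i + 1))) := by
  rw [mem_walls_iff_occ h0, show ((pairBond i 1 : Fin (2 * M)) : ℕ) = 2 * i + 1 from rfl,
    show 2 * (i : ℕ) + 1 + 1 = 2 * (i + 1) by ring, Nat.odd_iff, Nat.even_iff]
  omega

/-- With exactly one wall in each pair of bonds, the occupation does not change from one even site
to the next. -/
theorem occ_even_eq_zero_of_walls_eq (h0 : s 0 = 0) {c : Fin M → Fin 2}
    (hc : walls s = Finset.univ.image fun i => pairBond i (c i)) (j : ℕ) : occ s (2 * j) = 0 := by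
  induction j with
  | zero => simpa [h0] using occ_val s 0
  | succ j ih =>
    rcases lt_or_ge j M with hj | hj
    · have first := pairBond_zero_mem_walls h0 ⟨j, hj⟩
      have second := pairBond_one_mem_walls h0 ⟨j, hj⟩
      rw [hc, pairBond_mem_image, Nat.odd_iff, ih] at first
      rw [hc, pairBond_mem_image, Nat.even_iff] at second
      have := occ_le_one s (2 * j + 1)
      have := occ_le_one s (2 * (j + 1))
      dsimp only at first second
      omega
    · exact occ_of_le s (by omega)

theorem walls_eq_image_pairBond (h0 : s 0 = 0) (even_empty : ∀ j, occ s (2 * j) = 0) :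
    walls s = Finset.univ.image fun i : Fin M =>
      pairBond i (if occ s (2 * i + 1) = 0 then 1 else 0) := by
  ext k
  obtain ⟨i, b, rfl⟩ := exists_eq_pairBond k
  have := occ_le_one s (2 * i + 1)
  rw [pairBond_mem_image]
  fin_cases b
  · refine (pairBond_zero_mem_walls h0 i).trans ?_
    rw [even_empty, Nat.odd_iff]
    split_ifs <;> simp <;> omega
  · refine (pairBond_one_mem_walls h0 i).trans ?_
    rw [even_empty, Nat.even_iff]
    split_ifs <;> simp <;> omega

theorem slaterAmp_pairOrbital_walls (h0 : s 0 = 0) (even_empty : ∀ j, occ s (2 * j) = 0) :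
    slaterAmp pairOrbital (walls s) = ∏ j : Fin M, if occ s (2 * j + 1) = 0 then 1 else I := by
  rw [walls_eq_image_pairBond h0 even_empty, slaterAmp_pairOrbital_image]
  refine Finset.prod_congr rfl fun i _ => ?_
  split_ifs <;> simp_all

theorem slaterAmp_pairOrbital_walls_eq_zero (h0 : s 0 = 0)
    (not_even_empty : ¬ ∀ j, occ s (2 * j) = 0) : slaterAmp pairOrbital (walls s) = 0 := by
  by_contra hne
  obtain ⟨c, hc⟩ := exists_eq_image_pairBond_of_slaterAmp_ne_zero hne
  exact not_even_empty (occ_even_eq_zero_of_walls_eq h0 hc)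

theorem wallOmega_eq (s : Config (2 * M)) :
    wallOmega (2 * M) s
      = ((1 - I) / 2) ^ M * ((1 + (-1) ^ (s 0 : ℕ)) / 2) * slaterAmp pairOrbital (walls s) := by
  by_cases h0 : s 0 = 0
  · by_cases even_empty : ∀ j, occ s (2 * j) = 0
    · rw [wallOmega_apply_of_even_empty even_empty, slaterAmp_pairOrbital_walls h0 even_empty, h0]
      norm_num
    · rw [slaterAmp_pairOrbital_walls_eq_zero h0 even_empty, mul_zero]
      push Not at even_empty
      obtain ⟨j, hj⟩ := even_empty
      have hjM : 2 * j < 2 * M := not_le.mp (mt (occ_of_le s) hj)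
      exact wallOmega_apply_of_ne (k := ⟨2 * j, hjM⟩) (even_two_mul j) fun h =>
        hj ((dif_pos hjM).trans (by rw [h, Fin.val_zero]))
  · rw [wallOmega_apply_of_ne (k := 0) (by simp) h0, Fin.eq_one_of_ne_zero _ h0]
    simp

end InitialState

/-! ### The relaxation function as a determinant -/

section Relaxation

/-- The orbitals on a ring of `N` bonds with boundary sign `ζ` at time `t`, evolved from
`pairOrbital`. -/
def orbital (N : ℕ) (ζ t : ℝ) {M : ℕ} (i : Fin M) (k : ℤ) : ℂ :=
  conj (ringWave N ζ (4 * t) (2 * ((i : ℕ) + 1) - 1 - k))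

theorem orbital_add_period (N : ℕ) {ζ : ℝ} (hζ : ζ ≠ 0) (t : ℝ) {M : ℕ} (i : Fin M) (k : ℤ) :
    orbital N ζ t i (k + N) = ζ * orbital N ζ t i k := by
  rw [orbital, ← sub_sub, ringWave_sub_period N hζ, map_mul, Complex.conj_ofReal, orbital]

theorem hasDerivAt_orbital {N : ℕ} (hN : 0 < N) {ζ : ℝ} (hζ : ζ ^ 2 = 1) (t : ℝ) {M : ℕ}
    (i : Fin M) (k : ℤ) : HasDerivAt (fun t => orbital N ζ t i k)
      (2 * (orbital N ζ t i (k + 1) - orbital N ζ t i (k - 1))) t := by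
  have chain := ((hasDerivAt_ringWave hN hζ (4 * t) (2 * ((i : ℕ) + 1) - 1 - k)).scomp t
    ((hasDerivAt_id t).const_mul 4)).star
  refine chain.congr_deriv ?_
  rw [orbital, orbital, ← sub_sub,
    show 2 * (((i : ℕ) : ℤ) + 1) - 1 - (k - 1) = 2 * ((i : ℕ) + 1) - 1 - k + 1 by ring]
  simp only [mul_one, Complex.real_smul, Complex.ofReal_ofNat, star_mul', star_ofNat, star_div₀,
    star_sub, RCLike.star_def]
  ring

theorem onBonds_orbital_zero {M : ℕ} (ζ : ℝ) :
    onBonds (2 * M) (orbital (2 * M) ζ 0) = (pairOrbital : Fin M → Fin (2 * M) → ℂ) := by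
  funext i k
  rw [onBonds, orbital, mul_zero, position, ringWave_zero_right (by omega) (by omega), pairOrbital]
  simp only [Fin.ext_iff, pairBond, Fin.val_zero, Fin.val_one]
  split_ifs <;> first | omega | simp

theorem det_overlapN_eq_sum_slaterAmp (M N : ℕ) (ζ t : ℝ) :
    (Matrix.of fun i j : Fin M => overlapN N ζ (4 * t) ((i : ℕ) + 1) ((j : ℕ) + 1)).det
      = (1 / 2) ^ M * ∑ T, conj (slaterAmp (onBonds N (orbital N (-ζ) t (M := M))) T)
        * slaterAmp (onBonds N (orbital N ζ t (M := M))) T := by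
  simp only [map_slaterAmp]
  rw [sum_slaterAmp_mul_slaterAmp]
  have scaling := Matrix.det_smul (Matrix.of fun i j : Fin M =>
    ∑ k, conj (onBonds N (orbital N (-ζ) t) i k) * onBonds N (orbital N ζ t) j k) (1 / 2 : ℂ)
  rw [Fintype.card_fin] at scaling
  rw [← scaling]
  congr 1
  ext i j
  rw [Matrix.of_apply, Matrix.smul_apply, Matrix.of_apply, overlapN, ← Fin.sum_univ_eq_sum_range
    (fun k => ringWave N (-ζ) (4 * t) (2 * ((i : ℕ) + 1) - 1 - k)
      * conj (ringWave N ζ (4 * t) (2 * ((j : ℕ) + 1) - 1 - k)))]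
  simp only [onBonds, orbital, position, Complex.conj_conj, smul_eq_mul]
  ring

/-- The component of parity `η` of the evolved state, up to normalization. -/
def parityState (L : ℕ) (η t : ℝ) (s : Config (2 * (L + 1))) : ℂ :=
  wallState η (orbital (2 * (L + 1)) (η * (-1) ^ L) t (M := L + 1)) s

theorem hasDerivAt_parityState (L : ℕ) {η : ℝ} (hη : η ^ 2 = 1) (t : ℝ)
    (s : Config (2 * (L + 1))) :
    HasDerivAt (fun t => parityState L η t s)
      (∑ n, (bondType s n - bondType s (n - 1)) * parityState L η t (flipAt s n)) t := by
  have boundary_sq : (η * (-1) ^ L) ^ 2 = 1 := by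
    rw [mul_pow, hη, one_mul, ← pow_mul, (Nat.even_mul.mpr (Or.inr even_two)).neg_one_pow]
  refine hasDerivAt_wallState (by omega) (by exact_mod_cast hη) (fun i k => ?_)
    (fun i k => hasDerivAt_orbital (by omega) boundary_sq t i k) s
  rw [orbital_add_period _ (ne_zero_of_sq_eq_one boundary_sq)]
  push_cast
  rfl

/-- The evolved state, whose two parity components have opposite boundary conditions. -/
def evolvedState (L : ℕ) (t : ℝ) (s : Config (2 * (L + 1))) : ℂ :=
  ((1 - I) / 2) ^ (L + 1) / 2 * (parityState L 1 t s + parityState L (-1) t s)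

theorem evolvedState_zero (L : ℕ) : evolvedState L 0 = wallOmega (2 * (L + 1)) := by
  funext s
  rw [evolvedState, parityState, parityState, wallState, wallState, onBonds_orbital_zero,
    onBonds_orbital_zero, wallOmega_eq]
  simp only [Complex.ofReal_one, Complex.ofReal_neg, one_pow, one_mul]
  ring

theorem hasDerivAt_evolvedState (L : ℕ) (t : ℝ) (s : Config (2 * (L + 1))) :
    HasDerivAt (fun t => evolvedState L t s)
      (∑ n, (bondType s n - bondType s (n - 1)) * evolvedState L t (flipAt s n)) t := by
  refine (((hasDerivAt_parityState L (one_pow 2) t s).add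
    (hasDerivAt_parityState L (by norm_num) t s)).const_mul _).congr_deriv ?_
  rw [← Finset.sum_add_distrib, Finset.mul_sum]
  refine Finset.sum_congr rfl fun n _ => ?_
  rw [evolvedState]
  ring

theorem relaxationN_eq_det (L : ℕ) (t : ℝ) :
    relaxationN (2 * (L + 1)) t
      = ((Matrix.of fun i j : Fin (L + 1) =>
          overlapN (2 * (L + 1)) ((-1) ^ L) (4 * t) ((i : ℕ) + 1) ((j : ℕ) + 1)).det.re : ℂ) := by
  set α : ℂ := ((1 - I) / 2) ^ (L + 1) with hα
  set A := slaterAmp (onBonds (2 * (L + 1)) (orbital (2 * (L + 1)) ((-1) ^ L) t (M := L + 1)))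
    with hA
  set B := slaterAmp (onBonds (2 * (L + 1)) (orbital (2 * (L + 1)) (-(-1) ^ L) t (M := L + 1)))
    with hB
  have evolved_apply (s) :
      evolvedState L t s = α / 2 * (A (walls s) + (-1) ^ (s 0 : ℕ) * B (walls s)) := by
    simp [evolvedState, parityState, wallState, hα, hA, hB]
  have normalization : α * conj α = (1 / 2) ^ (L + 1) := by
    rw [hα, map_pow, ← mul_pow]
    congr 1
    simp only [map_div₀, map_sub, map_one, Complex.conj_I, map_ofNat]
    linear_combination (-1 / 4) * Complex.I_sq
  rw [relaxationN_eq_of_hasDerivAt (even_two_mul _) (by omega) (evolvedState_zero L)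
    (hasDerivAt_evolvedState L)]
  simp only [evolved_apply]
  rw [sum_config_eq_sum_walls (fun a T => (-1) ^ (a : ℕ)
      * ((α / 2 * (A T + (-1) ^ (a : ℕ) * B T)) * conj (α / 2 * (A T + (-1) ^ (a : ℕ) * B T))))
    fun a T hT => by simp [hA, hB, slaterAmp_of_card_ne _ hT],
    det_overlapN_eq_sum_slaterAmp, ← hA, ← hB, Complex.re_eq_add_conj, map_mul, map_sum,
    Finset.mul_sum, Finset.mul_sum, ← Finset.sum_add_distrib, Finset.sum_div]
  refine Finset.sum_congr rfl fun T _ => ?_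
  simp only [map_mul, map_div₀, map_add, map_pow, map_one, map_ofNat, map_neg, Complex.conj_conj,
    Fin.val_zero, Fin.val_one, pow_zero, pow_one]
  linear_combination (1 / 2) * (A T * conj (B T) + B T * conj (A T)) * normalization

end Relaxation

/-! ### Infinite determinants -/

section Window

/-- The representatives modulo `M` closest to the origin, namely the integers `m` with
`-M < 2m ≤ M`. -/
def window (M : ℕ) : Finset ℤ := Finset.Ioc (-M / 2) (M / 2)

theorem mem_window {M : ℕ} {m : ℤ} : m ∈ window M ↔ -(M : ℤ) < 2 * m ∧ 2 * m ≤ M := by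
  rw [window, Finset.mem_Ioc]
  omega

/-- The representative modulo `M` in the window of the index `i + 1`. -/
def wrap {M : ℕ} (i : Fin M) : window M :=
  ⟨if 2 * ((i : ℕ) + 1) ≤ M then (i : ℕ) + 1 else (i : ℕ) + 1 - M, by
    rw [mem_window]
    split_ifs <;> omega⟩

theorem bijective_wrap (M : ℕ) : Function.Bijective (wrap (M := M)) := by
  constructor
  · intro i j hij
    have val_eq := congrArg Subtype.val hij
    simp only [wrap] at val_eq
    split_ifs at val_eq <;> exact Fin.ext (by omega)
  · rintro ⟨m, hm⟩
    rw [mem_window] at hm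
    rcases le_or_gt 1 m with pos | nonpos
    · refine ⟨⟨(m - 1).toNat, by omega⟩, Subtype.ext ?_⟩
      simp only [wrap]
      split_ifs <;> omega
    · refine ⟨⟨(m + M - 1).toNat, by omega⟩, Subtype.ext ?_⟩
      simp only [wrap]
      split_ifs <;> omega

/-- Wrapping multiplies rows by `-ζ` and columns by `ζ`; together with the sign of the half-line
each `ζ` appears twice. -/
theorem det_overlapN_eq_det_window (M : ℕ) {ζ : ℝ} (hζ : ζ ^ 2 = 1) (x : ℝ) :
    (Matrix.of fun i j : Fin M => overlapN (2 * M) ζ x ((i : ℕ) + 1) ((j : ℕ) + 1)).det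
      = (Matrix.of fun m n : window M => halfSign m * overlapN (2 * M) ζ x m n).det := by
  let boundarySign : Fin M → ℂ := fun i => if 2 * ((i : ℕ) + 1) ≤ M then 1 else ζ
  have prod_sq : (∏ i, boundarySign i) * ∏ i, boundarySign i = 1 := by
    rw [← Finset.prod_mul_distrib]
    refine Finset.prod_eq_one fun i _ => ?_
    simp only [boundarySign]
    split_ifs
    · exact one_mul 1
    · exact_mod_cast (sq ζ).symm.trans hζ
  have reindexed : (Matrix.of fun m n : window M =>
        halfSign m * overlapN (2 * M) ζ x m n).submatrix
      (Equiv.ofBijective _ (bijective_wrap M)) (Equiv.ofBijective _ (bijective_wrap M))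
      = Matrix.of fun i j => boundarySign i * (Matrix.of fun i j => boundarySign j *
        (Matrix.of fun i j : Fin M =>
          overlapN (2 * M) ζ x ((i : ℕ) + 1) ((j : ℕ) + 1)) i j) i j := by
    have ζ_ne_zero := ne_zero_of_sq_eq_one hζ
    ext i j
    simp only [Matrix.submatrix_apply, Matrix.of_apply, Equiv.ofBijective_apply, wrap,
      boundarySign, halfSign]
    split_ifs <;>
      first
        | omega
        | ring1
        | (simp only [overlapN_sub_left ζ_ne_zero, overlapN_sub_right ζ_ne_zero] <;> ring1)
  rw [← Matrix.det_submatrix_equiv_self (Equiv.ofBijective _ (bijective_wrap M)), reindexed,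
    Matrix.det_mul_column, Matrix.det_mul_row, ← mul_assoc, prod_sq, one_mul]

end Window

section Fredholm

/-- The deviation from the identity of the kernel `κ` with its nonpositive rows negated. -/
def signedDefect (κ : ℤ → ℤ → ℂ) : Matrix ℤ ℤ ℂ :=
  Matrix.of fun m n => halfSign m * κ m n - kronecker m n

theorem one_add_principal_signedDefect (κ : ℤ → ℤ → ℂ) (W : Finset ℤ) :
    1 + principal (signedDefect κ) W = Matrix.of fun m n : W => halfSign m * κ m n := by
  ext m n
  simp only [Matrix.add_apply, Matrix.one_apply, principal, Matrix.submatrix_apply, signedDefect,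
    Matrix.of_apply, kronecker, Subtype.ext_iff]
  ring

theorem tendsto_signedDefect {α : Type*} {l : Filter α} {κ : α → ℤ → ℤ → ℂ} {κlim : ℤ → ℤ → ℂ}
    {m n : ℤ} (h : Tendsto (fun a => κ a m n) l (𝓝 (κlim m n))) :
    Tendsto (fun a => signedDefect (κ a) m n) l (𝓝 (signedDefect κlim m n)) :=
  (h.const_mul (halfSign m)).sub_const (kronecker m n)

theorem exists_signedDefect_limitKernel_le (x : ℝ) : ∃ C : ℝ, 0 ≤ C ∧ ∀ m n : ℤ,
    ‖signedDefect (limitKernel x) m n‖ ≤ C * decay m * decay n := by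
  obtain ⟨C, hC, bound⟩ := exists_overlapN_sub_kronecker_le x
  refine ⟨C, hC, fun m n => le_of_tendsto (tendsto_signedDefect
    (tendsto_overlapN (ζ := fun _ => 1) (fun _ => one_pow 2) x m n)).norm ?_⟩
  filter_upwards [eventually_gt_atTop (2 * m.natAbs + 2 * n.natAbs)] with M hM
  exact bound M 1 m n (by omega) (one_pow 2) (by omega) (by omega) (by omega) (by omega)

theorem tendsto_det_overlapN (x : ℝ) :
    Tendsto (fun L : ℕ => (Matrix.of fun i j : Fin (L + 1) =>
      overlapN (2 * (L + 1)) ((-1) ^ L) x ((i : ℕ) + 1) ((j : ℕ) + 1)).det) atTop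
      (𝓝 (fredholmDet (signedDefect (limitKernel x)))) := by
  obtain ⟨C, hC, bound⟩ := exists_overlapN_sub_kronecker_le x
  have sign_sq (L : ℕ) : ((-1 : ℝ) ^ L) ^ 2 = 1 := by
    rw [← pow_mul, pow_mul', neg_one_sq, one_pow]
  have entrywise (m n : ℤ) : Tendsto (fun L : ℕ => overlapN (2 * (L + 1)) ((-1) ^ L) x m n) atTop
      (𝓝 (limitKernel x m n)) := by
    refine ((tendsto_overlapN (ζ := fun N => (-1) ^ (N / 2 - 1)) (fun N => sign_sq _) x m n).comp
      (tendsto_add_atTop_nat 1)).congr fun L => ?_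
    simp
  simp only [det_overlapN_eq_det_window _ (sign_sq _), ← one_add_principal_signedDefect]
  refine tendsto_det_one_add_principal hC (fun m => (decay_pos m).le) summable_decay (fun m => ?_)
    (fun L m hm n hn => ?_) fun m n => tendsto_signedDefect (entrywise m n)
  · filter_upwards [eventually_gt_atTop (2 * m.natAbs)] with L hL
    rw [mem_window]
    omega
  · rw [mem_window] at hm hn
    exact bound (L + 1) _ m n L.succ_pos (sign_sq L) hm.1 hm.2 hn.1 hn.2

theorem tendsto_det_limitKernel (x : ℝ) :
    Tendsto (fun r : ℕ => (Matrix.of fun m n : Finset.Icc (1 - (r : ℤ)) r =>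
      halfSign m * limitKernel x m n).det) atTop
      (𝓝 (fredholmDet (signedDefect (limitKernel x)))) := by
  obtain ⟨C, hC, bound⟩ := exists_signedDefect_limitKernel_le x
  simp only [← one_add_principal_signedDefect]
  refine tendsto_det_one_add_principal hC (fun m => (decay_pos m).le) summable_decay (fun m => ?_)
    (fun _ m _ n _ => bound m n) fun m n => tendsto_const_nhds
  filter_upwards [eventually_gt_atTop m.natAbs] with r hr
  rw [Finset.mem_Icc]
  omega

end Fredholm

section Reflection

/-- The limit kernel folded along the reflection `n ↦ 1 - n`, on the indices `1, …, r`. -/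
def foldedMatrix (x : ℝ) (r : ℕ) : Matrix (Fin r) (Fin r) ℂ :=
  Matrix.of fun i j => limitKernel x ((i : ℕ) + 1) ((j : ℕ) + 1)
    + limitKernel x ((i : ℕ) + 1) (1 - ((j : ℕ) + 1))

theorem matrixA_eq_foldedMatrix (r : ℕ) (t : ℝ) : matrixA r t = foldedMatrix (4 * t) r := by
  ext i j
  rw [foldedMatrix, Matrix.of_apply, limitKernel_eq_kronecker_add_kernelK t _ (by omega),
    limitKernel_of_ne t (by omega)]
  rfl

/-- The indices `1, …, r` and their reflections `0, …, 1 - r`. -/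
def reflectIndex (r : ℕ) : Fin r ⊕ Fin r → Finset.Icc (1 - (r : ℤ)) r
  | Sum.inl i => ⟨(i : ℕ) + 1, by rw [Finset.mem_Icc]; omega⟩
  | Sum.inr i => ⟨1 - ((i : ℕ) + 1), by rw [Finset.mem_Icc]; omega⟩

theorem bijective_reflectIndex (r : ℕ) : Function.Bijective (reflectIndex r) := by
  constructor
  · rintro (i | i) (j | j) hij <;> have val_eq := congrArg Subtype.val hij <;>
      simp only [reflectIndex] at val_eq
    · exact congrArg Sum.inl (Fin.ext (by omega))
    · omega
    · omega
    · exact congrArg Sum.inr (Fin.ext (by omega))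
  · rintro ⟨m, hm⟩
    rw [Finset.mem_Icc] at hm
    rcases le_or_gt 1 m with pos | nonpos
    · exact ⟨Sum.inl ⟨(m - 1).toNat, by omega⟩, Subtype.ext (by simp only [reflectIndex]; omega)⟩
    · exact ⟨Sum.inr ⟨(-m).toNat, by omega⟩, Subtype.ext (by simp only [reflectIndex]; omega)⟩

theorem limitKernel_one_sub_left (x : ℝ) (m n : ℤ) :
    limitKernel x (1 - m) n = -limitKernel x m (1 - n) := by
  rw [← limitKernel_one_sub, sub_sub_cancel]

/-- In the basis of reflected pairs the matrix has the block form `(P Q; Q P)`, where `P + Q` is the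
folded matrix and `P - Q` its adjoint. -/
theorem det_limitKernel_eq_mul_conj (x : ℝ) (r : ℕ) :
    (Matrix.of fun m n : Finset.Icc (1 - (r : ℤ)) r => halfSign m * limitKernel x m n).det
      = (foldedMatrix x r).det * conj (foldedMatrix x r).det := by
  let P : Matrix (Fin r) (Fin r) ℂ :=
    Matrix.of fun i j => limitKernel x ((i : ℕ) + 1) ((j : ℕ) + 1)
  let Q : Matrix (Fin r) (Fin r) ℂ :=
    Matrix.of fun i j => limitKernel x ((i : ℕ) + 1) (1 - ((j : ℕ) + 1))
  have folded_eq : foldedMatrix x r = P + Q := rfl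
  have adjoint_eq : (foldedMatrix x r)ᴴ = P - Q := by
    ext i j
    rw [Matrix.conjTranspose_apply, foldedMatrix, Matrix.of_apply, star_add, ← starRingEnd_apply,
      ← starRingEnd_apply, conj_limitKernel, conj_limitKernel, limitKernel_one_sub_left,
      ← sub_eq_add_neg]
    rfl
  have block_form : (Matrix.of fun m n : Finset.Icc (1 - (r : ℤ)) r =>
        halfSign m * limitKernel x m n).submatrix
      (Equiv.ofBijective _ (bijective_reflectIndex r))
      (Equiv.ofBijective _ (bijective_reflectIndex r)) = Matrix.fromBlocks P Q Q P := by
    have sign_pos (i : Fin r) : halfSign ((i : ℕ) + 1) = 1 := if_pos (by omega)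
    have sign_neg (i : Fin r) : halfSign (1 - ((i : ℕ) + 1)) = -1 := if_neg (by omega)
    ext (i | i) (j | j) <;>
      simp only [Matrix.submatrix_apply, Matrix.of_apply, Equiv.ofBijective_apply, reflectIndex,
        Matrix.fromBlocks_apply₁₁, Matrix.fromBlocks_apply₁₂, Matrix.fromBlocks_apply₂₁,
        Matrix.fromBlocks_apply₂₂, P, Q, sign_pos, sign_neg, limitKernel_one_sub_left,
        sub_sub_cancel, one_mul, neg_one_mul, neg_neg]
  rw [starRingEnd_apply, ← Matrix.det_conjTranspose, adjoint_eq, folded_eq, ← det_fromBlocks_symm,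
    ← block_form, Matrix.det_submatrix_equiv_self]

/-- The deviation of the folded matrix from the identity, indexed by all of `ℕ`. -/
def foldedDefect (x : ℝ) : Matrix ℕ ℕ ℂ :=
  Matrix.of fun i j => signedDefect (limitKernel x) (i + 1) (j + 1)
    + signedDefect (limitKernel x) (i + 1) (-j)

theorem det_one_add_principal_foldedDefect (x : ℝ) (r : ℕ) :
    (1 + principal (foldedDefect x) (Finset.range r)).det = (foldedMatrix x r).det := by
  let indices : Fin r ≃ Finset.range r :=
    Fin.equivSubtype.trans (Equiv.subtypeEquivRight fun _ => Finset.mem_range.symm)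
  have indices_apply (i) : (indices i : ℕ) = i := rfl
  rw [← Matrix.det_submatrix_equiv_self indices]
  congr 1
  ext i j
  have sign_pos : halfSign ((i : ℕ) + 1) = 1 := if_pos (by omega)
  have off_diagonal : kronecker ((i : ℕ) + 1) (-(j : ℕ)) = 0 := if_neg (by omega)
  have reflected : (1 : ℤ) - ((j : ℕ) + 1) = -(j : ℕ) := by omega
  have diagonal : kronecker ((i : ℕ) + 1) ((j : ℕ) + 1)
      = (1 : Matrix (Finset.range r) (Finset.range r) ℂ) (indices i) (indices j) := by
    simp [Matrix.one_apply, kronecker, Fin.ext_iff]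
  simp only [foldedDefect, foldedMatrix, signedDefect, principal, Matrix.submatrix_apply,
    Matrix.add_apply, Matrix.of_apply, indices_apply, sign_pos, off_diagonal, diagonal, reflected]
  ring

theorem tendsto_det_foldedMatrix (x : ℝ) :
    Tendsto (fun r => (foldedMatrix x r).det) atTop (𝓝 (fredholmDet (foldedDefect x))) := by
  obtain ⟨C, hC, bound⟩ := exists_signedDefect_limitKernel_le x
  simp only [← det_one_add_principal_foldedDefect]
  refine tendsto_det_one_add_principal (b := fun i : ℕ => decay i) (C := 2 * C) (by positivity)
    (fun i => (decay_pos i).le) (summable_decay.comp_injective Nat.cast_injective) (fun i => ?_)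
    (fun r i _ j _ => ?_) fun i j => tendsto_const_nhds
  · filter_upwards [eventually_gt_atTop i] with r hr
    exact Finset.mem_range.mpr hr
  · have := (decay_pos i).le
    have := (decay_pos (j + 1)).le
    have decay_succ (k : ℕ) : decay (k + 1) ≤ decay k :=
      decay_le_decay (abs_le_abs_of_nonneg (by omega) (by omega))
    calc ‖foldedDefect x i j‖
        ≤ C * decay (i + 1) * decay (j + 1) + C * decay (i + 1) * decay (-j) :=
          norm_add_le_of_le (bound _ _) (bound _ _)
      _ ≤ C * decay i * decay j + C * decay i * decay j := by
          gcongr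
          · exact decay_succ i
          · exact decay_succ j
          · exact (decay_pos _).le
          · exact decay_succ i
          · exact decay_le_decay (abs_neg _).ge
      _ = 2 * C * decay i * decay j := by ring

/-- Both sides are limits of the determinants over the symmetric windows `1 - r, …, r`. -/
theorem fredholmDet_signedDefect_limitKernel (x : ℝ) :
    fredholmDet (signedDefect (limitKernel x))
      = fredholmDet (foldedDefect x) * conj (fredholmDet (foldedDefect x)) := by
  refine tendsto_nhds_unique (tendsto_det_limitKernel x) ?_
  simp only [det_limitKernel_eq_mul_conj]
  have folded := tendsto_det_foldedMatrix x
  exact folded.mul ((Complex.continuous_conj.tendsto _).comp folded)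

end Reflection

section Limit

theorem tendsto_relaxationN (t : ℝ) :
    Tendsto (fun L : ℕ => relaxationN (2 * (L + 1)) t) atTop
      (𝓝 ((‖fredholmDet (foldedDefect (4 * t))‖ ^ 2 : ℝ) : ℂ)) := by
  simp only [relaxationN_eq_det]
  rw [← Complex.ofReal_re (‖fredholmDet (foldedDefect (4 * t))‖ ^ 2), Complex.ofReal_pow,
    ← Complex.mul_conj', ← fredholmDet_signedDefect_limitKernel]
  exact ((Complex.continuous_ofReal.comp Complex.continuous_re).tendsto _).comp
    (tendsto_det_overlapN (4 * t))

theorem tendsto_det_matrixA (t : ℝ) :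
    Tendsto (fun r => (matrixA r t).det) atTop (𝓝 (fredholmDet (foldedDefect (4 * t)))) := by
  simpa only [matrixA_eq_foldedMatrix] using tendsto_det_foldedMatrix (4 * t)

end Limit

end SpinHelix

end

theorem mainTheorem3 (t : ℝ) :
    (∀ m n : ℤ, 1 ≤ m → 1 ≤ n →
      Tendsto (fun L : ℕ => SpinHelix.PhiN (2 * (L + 1)) m n t) atTop
        (𝓝 ((-1 : ℂ) ^ (m - n) * (SpinHelix.kronecker m n + SpinHelix.kernelK m n t)))) ∧
    ∃ (S : ℝ) (D : ℂ),
      Tendsto (fun L : ℕ => SpinHelix.relaxationN (2 * (L + 1)) t) atTop (𝓝 (S : ℂ)) ∧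
      Tendsto (fun r : ℕ => SpinHelix.relaxationTrunc r t) atTop (𝓝 S) ∧
      Tendsto (fun r : ℕ => (SpinHelix.matrixA r t).det) atTop (𝓝 D) ∧
      (S : ℂ) = D * (starRingEnd ℂ) D := by
  let D := SpinHelix.fredholmDet (SpinHelix.foldedDefect (4 * t))
  have det_tendsto := SpinHelix.tendsto_det_matrixA t
  refine ⟨fun m n _ hn => ?_, ‖D‖ ^ 2, D, SpinHelix.tendsto_relaxationN t,
    det_tendsto.norm.pow 2, det_tendsto, ?_⟩
  · rw [← SpinHelix.limitKernel_eq_kronecker_add_kernelK t m hn]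
    exact SpinHelix.tendsto_PhiN t m n
  · rw [Complex.mul_conj', Complex.ofReal_pow]
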